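/- Let $q\in\mathbb C$ with $0<|q|<1$. Write $(a)_\infty=\prod_{j\ge 0}(1-aq^j)$, $\theta(x)=(x)_\infty(q/x)_\infty$, and for $k\in\mathbb Z$ let $(a)_k=\prod_{i=0}^{k-1}(1-aq^i)$ if $k\ge 0$ and $(a)_k=\prod_{i=1}^{-k}(1-aq^{-i})^{-1}$ if $k<0$. Repeated arguments denote products, e.g. $(az^{\pm})_k=(az)_k(a/z)_k$, $(q\lambda^\pm/b)_\infty=(q\lambda/b)_\infty(q\lambda^{-1}/b)_\infty$ and $\theta(x,y)=\theta(x)\theta(y)$. Let $b_1,\dots,b_6\in\mathbb C$ satisfy $b_1\cdots b_6=q$, $b_i/b_j\notin q^{\mathbb Z}$ for $i<j$, and $b_ib_j\notin q^{\mathbb Z}$ for $i\le j$. Let $V$ be the complex vector space of rational functions $f$ in the variable $(z+z^{-1})/2$ that are regular, also at infinity, except for possible simple poles at the points $(z+z^{-1})/2$ with $z\in b_jq^{n}$, $1\le j\le 6$, $n\in\mathbb Z_{<0}$. There is a unique linear functional $\mathbf J$ on $V$ (Rahman's functional) such that, for all integers $k_1,\dots,k_6$ with $k_1+\dots+k_6=0$,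 $$\mathbf J\bigl((b_1z^\pm)_{k_1}\cdots(b_6z^\pm)_{k_6}\bigr)=\frac{\prod_{1\le i<j\le 6}(b_ib_j)_{k_i+k_j}}{\prod_{j=1}^6q^{\binom{k_j}2}b_j^{k_j}}.$$ Moreover, let $\lambda,\mu\in\mathbb C\setminus\{0\}$ be generic in the sense that none of $\lambda^2,\ \mu^2,\ \lambda\mu,\ \mu/\lambda,\ \lambda b_j,\ \lambda/b_j,\ \mu b_j,\ \mu/b_j$ $(1\le j\le 6)$ lies in $q^{\mathbb Z}$. Then for every $f\in V$ $$\mathbf J(f)=A(\lambda,\mu)\,S_f(\lambda)+A(\mu,\lambda)\,S_f(\mu),$$ where $$A(\lambda,\mu)=\frac{(1-\lambda^2)\left\{\prod_{j=1}^6\theta(\mu b_j)-\frac{q}{\mu^2}\prod_{j=1}^6\theta(\mu/b_j)\right\}\prod_{j=1}^6(q\lambda^\pm/b_j)_\infty}{(q)_\infty\,\theta(\lambda^2,\mu^2,\lambda\mu,\mu/\lambda)\prod_{1\le i<j\le 6}(q/b_ib_j)_\infty},$$ $$S_f(\lambda)=\sum_{x=-\infty}^{\infty}\frac{1-\lambda^2q^{2x}}{1-\lambda^2}\,q^x\prod_{j=1}^6\frac{(\lambda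 b_j)_x}{(q\lambda/b_j)_x}\;f\!\left(\frac{\lambda q^x+\lambda^{-1}q^{-x}}2\right),$$ and both bilateral series converge absolutely. -/

import Mathlib

noncomputable section

namespace Rahman

/-- The q-shifted factorial with integer index: for `k ≥ 0` it is `(1 - a) (1 - a q) ⋯ (1 - a q^(k-1))`,
and for `k < 0` it is `((1 - a q⁻¹) (1 - a q⁻²) ⋯ (1 - a q^k))⁻¹`. -/
def qPoch (q a : ℂ) : ℤ → ℂ
  | Int.ofNat n => ∏ i ∈ Finset.range n, (1 - a * q ^ i)
  | Int.negSucc n => (∏ i ∈ Finset.range (n + 1), (1 - a * (q ^ (i + 1))⁻¹))⁻¹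

/-- The infinite q-shifted factorial `∏_{j ≥ 0} (1 - a q^j)`. -/
def qPochInf (q a : ℂ) : ℂ := ∏' j : ℕ, (1 - a * q ^ j)

/-- The theta function `(x; q)_∞ (q/x; q)_∞`. -/
def theta (q x : ℂ) : ℂ := qPochInf q x * qPochInf q (q / x)

/-- The standing assumptions on the parameters: the balancing condition and genericity. -/
structure IsParameter (q : ℂ) (b : Fin 6 → ℂ) : Prop where
  balanced : ∏ j, b j = q
  div_ne : ∀ i j, i < j → ∀ n : ℤ, b i / b j ≠ q ^ n
  mul_ne : ∀ i j, i ≤ j → ∀ n : ℤ, b i * b j ≠ q ^ n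

/-- The value of `(z + z⁻¹) / 2`. -/
def joukowski (z : ℂ) : ℂ := (z + z⁻¹) / 2

/-- The points `(z + z⁻¹) / 2` with `z ∈ b_j q^n` for some `j` and some integer `n < 0`; the points with
`z⁻¹ ∈ b_j q^n` are the same ones. -/
def polePoints (q : ℂ) (b : Fin 6 → ℂ) : Set ℂ :=
  {x | ∃ (j : Fin 6) (n : ℤ), n < 0 ∧ x = joukowski (b j * q ^ n)}

/-- A rational function has at most a simple pole at `a` iff its reduced denominator divides
`(X - a) s` for a polynomial `s` that does not vanish at `a`. -/
theorem rootMultiplicity_denom_le_one_iff (f : RatFunc ℂ) (a : ℂ) :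
    f.denom.rootMultiplicity a ≤ 1 ↔
      ∃ s : Polynomial ℂ, s.eval a ≠ 0 ∧ f.denom ∣ (Polynomial.X - Polynomial.C a) * s := by
  have hd := f.denom_ne_zero
  constructor
  · intro h
    obtain ⟨s, hs, hs'⟩ := Polynomial.exists_eq_pow_rootMultiplicity_mul_and_not_dvd f.denom hd a
    refine ⟨s, fun h0 => hs' (Polynomial.dvd_iff_isRoot.2 h0), ?_⟩
    conv_lhs => rw [hs]
    exact mul_dvd_mul_right (by simpa using pow_dvd_pow (Polynomial.X - Polynomial.C a) h) s
  · rintro ⟨s, hs, hdvd⟩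
    have hs0 : s ≠ 0 := by rintro rfl; simp at hs
    have hne : (Polynomial.X - Polynomial.C a) * s ≠ 0 :=
      mul_ne_zero (Polynomial.X_sub_C_ne_zero a) hs0
    have h1 := Polynomial.rootMultiplicity_le_rootMultiplicity_of_dvd hne hdvd a
    have h2 : Polynomial.rootMultiplicity a s = 0 := Polynomial.rootMultiplicity_eq_zero hs
    rw [Polynomial.rootMultiplicity_mul hne, Polynomial.rootMultiplicity_X_sub_C_self, h2] at h1
    exact h1

/-- The vector space of rational functions in the variable `x = (z + z⁻¹) / 2` that are regular except for
possible simple poles at `polePoints q b`, and that are regular at infinity. -/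
def V (q : ℂ) (b : Fin 6 → ℂ) : Submodule ℂ (RatFunc ℂ) where
  carrier := {f | (∀ a, f.denom.IsRoot a → a ∈ polePoints q b) ∧
    (∀ a, f.denom.rootMultiplicity a ≤ 1) ∧ f.num.natDegree ≤ f.denom.natDegree}
  zero_mem' := by
    refine ⟨fun a h => ?_, fun a => ?_, ?_⟩
    · simp at h
    · simp [Polynomial.rootMultiplicity_eq_zero]
    · simp
  add_mem' := by
    rintro f g ⟨hf1, hf2, hf3⟩ ⟨hg1, hg2, hg3⟩
    refine ⟨fun a h => ?_, fun a => ?_, ?_⟩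
    · have := h.dvd (RatFunc.denom_add_dvd f g)
      rcases Polynomial.root_mul.1 this with h | h
      exacts [hf1 a h, hg1 a h]
    · obtain ⟨s, hs, hsd⟩ := (rootMultiplicity_denom_le_one_iff f a).1 (hf2 a)
      obtain ⟨t, ht, htd⟩ := (rootMultiplicity_denom_le_one_iff g a).1 (hg2 a)
      refine (rootMultiplicity_denom_le_one_iff _ a).2
        ⟨s * t, by simp [hs, ht], ?_⟩
      have hX := Polynomial.X_sub_C_ne_zero a
      have hs0 : s ≠ 0 := by rintro rfl; simp at hs
      have ht0 : t ≠ 0 := by rintro rfl; simp at ht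
      have hne := mul_ne_zero hX (mul_ne_zero hs0 ht0)
      have h1 : f.denom ∣ (Polynomial.X - Polynomial.C a) * (s * t) :=
        hsd.trans ⟨t, by ring⟩
      have h2 : g.denom ∣ (Polynomial.X - Polynomial.C a) * (s * t) :=
        htd.trans ⟨s, by ring⟩
      obtain ⟨u, hu⟩ := (RatFunc.denom_dvd hne).1 h1
      obtain ⟨v, hv⟩ := (RatFunc.denom_dvd hne).1 h2
      exact (RatFunc.denom_dvd hne).2 ⟨u + v, by
        conv_lhs => rw [hu, hv]
        rw [map_add, add_div]⟩
    · by_cases hg : g = 0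
      · simpa [hg] using hf3
      by_cases hfg : f + g = 0
      · simp [hfg]
      have h := RatFunc.intDegree_add_le hg hfg
      have e1 : f.intDegree ≤ 0 := by simp only [RatFunc.intDegree]; omega
      have e2 : g.intDegree ≤ 0 := by simp only [RatFunc.intDegree]; omega
      have e3 := h.trans (max_le e1 e2)
      simp only [RatFunc.intDegree] at e3
      omega
  smul_mem' := by
    rintro c f ⟨hf1, hf2, hf3⟩
    have hdvd : (c • f).denom ∣ f.denom := by
      have := RatFunc.denom_mul_dvd (RatFunc.C c) f
      rwa [RatFunc.denom_C, one_mul, ← RatFunc.smul_eq_C_mul] at this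
    refine ⟨fun a h => hf1 a (h.dvd hdvd), fun a => ?_, ?_⟩
    · exact (Polynomial.rootMultiplicity_le_rootMultiplicity_of_dvd f.denom_ne_zero hdvd a).trans
        (hf2 a)
    · by_cases hc : c = 0
      · simp [hc]
      by_cases hf : f = 0
      · simp [hf]
      have hC : RatFunc.C c ≠ 0 := by simpa using hc
      have h := RatFunc.intDegree_mul hC hf
      rw [← RatFunc.smul_eq_C_mul, RatFunc.intDegree_C] at h
      simp only [RatFunc.intDegree] at h
      omega

/-- The value `f((z + z⁻¹) / 2)`. -/
def evalAt {q : ℂ} {b : Fin 6 → ℂ} (f : V q b) (z : ℂ) : ℂ :=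
  RatFunc.eval (RingHom.id ℂ) (joukowski z) (f : RatFunc ℂ)

/-- `f` is the rational function `(b_1 z, b_1/z)_{k_1} ⋯ (b_6 z, b_6/z)_{k_6}` of `(z + z⁻¹) / 2`: the two
agree wherever `z` and `z⁻¹` avoid all the geometric progressions `b_j q^ℤ`. -/
def IsShiftedProduct {q : ℂ} {b : Fin 6 → ℂ} (k : Fin 6 → ℤ) (f : V q b) : Prop :=
  ∀ z : ℂ, z ≠ 0 → (∀ (j : Fin 6) (n : ℤ), z ≠ b j * q ^ n ∧ z⁻¹ ≠ b j * q ^ n) →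
    evalAt f z = ∏ j, (qPoch q (b j * z) (k j) * qPoch q (b j / z) (k j))

/-- The property that determines Rahman's functional: its values on the shifted products with
`k_1 + ⋯ + k_6 = 0`. -/
def IsRahmanFunctional (q : ℂ) (b : Fin 6 → ℂ) (J : V q b →ₗ[ℂ] ℂ) : Prop :=
  ∀ k : Fin 6 → ℤ, ∑ j, k j = 0 → ∀ f : V q b, IsShiftedProduct k f →
    J f = (∏ i, ∏ j ∈ Finset.Ioi i, qPoch q (b i * b j) (k i + k j)) /
      ∏ j, (q ^ (k j * (k j - 1) / 2) * b j ^ k j)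

/-- The genericity conditions on the two auxiliary parameters: none of `lam²`, `mu²`, `lam mu`, `mu/lam`,
`lam b_j`, `lam/b_j`, `mu b_j`, `mu/b_j` lies in `q^ℤ`. -/
structure IsGenericPair (q : ℂ) (b : Fin 6 → ℂ) (lam mu : ℂ) : Prop where
  lam_ne : lam ≠ 0
  mu_ne : mu ≠ 0
  lam_sq : ∀ n : ℤ, lam ^ 2 ≠ q ^ n
  mu_sq : ∀ n : ℤ, mu ^ 2 ≠ q ^ n
  lam_mul_mu : ∀ n : ℤ, lam * mu ≠ q ^ n
  mu_div_lam : ∀ n : ℤ, mu / lam ≠ q ^ n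
  lam_mul : ∀ (j : Fin 6) (n : ℤ), lam * b j ≠ q ^ n
  lam_div : ∀ (j : Fin 6) (n : ℤ), lam / b j ≠ q ^ n
  mu_mul : ∀ (j : Fin 6) (n : ℤ), mu * b j ≠ q ^ n
  mu_div : ∀ (j : Fin 6) (n : ℤ), mu / b j ≠ q ^ n

/-- The constant in front of the sum over `lam q^ℤ`. -/
def coeff (q : ℂ) (b : Fin 6 → ℂ) (lam mu : ℂ) : ℂ :=
  ((1 - lam ^ 2) *
      ((∏ j, theta q (mu * b j)) - q / mu ^ 2 * ∏ j, theta q (mu / b j)) *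
      ∏ j, (qPochInf q (q * lam / b j) * qPochInf q (q * lam⁻¹ / b j))) /
    (qPochInf q q * (theta q (lam ^ 2) * theta q (mu ^ 2) * theta q (lam * mu) * theta q (mu / lam)) *
      ∏ i, ∏ j ∈ Finset.Ioi i, qPochInf q (q / (b i * b j)))

/-- The weight at the point `lam q^x`, the general term of the very-well-poised bilateral series. -/
def weight (q : ℂ) (b : Fin 6 → ℂ) (lam : ℂ) (x : ℤ) : ℂ :=
  (1 - lam ^ 2 * q ^ (2 * x)) / (1 - lam ^ 2) * q ^ x *
    ∏ j, (qPoch q (lam * b j) x / qPoch q (q * lam / b j) x)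

end Rahman

end

/-! Write O(z) = (z - 1/z) ∏ (q z^±/b_j)_∞ for `oddKernel`. Multiplying S_f(λ) by O(λ) clears its
denominators; for f = 1 the result is L(λ) = Σ λ^{6x} q^{3x²} O(λ q^x), the `latticeSum`. Reindexing
gives L(λq) = q^{-3} λ^{-6} L(λ) and L(1/λ) = -L(λ). Because ∏ b_j = q, the antisymmetrization T(μ)
of μ^{-2} ∏ θ(μ b_j) (`thetaDiff`) has the same two symmetries, and A(λ, μ) = -O(λ) T(μ) / (P Θ(λ,
μ)) with P = (q)_∞ ∏ (q/b_i b_j)_∞ (`pairProd`) and Θ the theta product `thetaCross`. So the case f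
= 1 is the determinant evaluation T(λ) L(μ) - T(μ) L(λ) = P Θ(λ, μ), which is `casoratian_eq`.

Proof of the evaluation. An odd function with this multiplier vanishes wherever λ² ∈ q^ℤ, and one
further zero determines it up to a scalar. Hence the determinant is C(b) Θ(λ, μ) with C(b)
independent of λ and μ (`IsOddTheta.exists_casoratian`). To find C(b), fix p = b_0 b_1 with |p| < 1
and vary s = b_0. For generic parameters P has simple zeros in s, and C vanishes at them: when b_i
b_j = q^{n+1}, both T and L vanish at b_j. So C/P is holomorphic in s ≠ 0. Replacing (b_0, b_1) by
(b_0 q^k, b_1 q^{-k}) multiplies C and P by the same factor, up to terms bounded above for C and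
bounded below for P, so C/P is bounded on a bilateral sequence of circles and is constant by
Liouville. At s = 1/b_2 the bilateral series has a single term and the constant is 1. The identity
theorem along `deform` removes |p| < 1 and the extra genericity.

A shifted product is absorbed by moving the parameters: O, T and P for b_j q^{k_j} differ from those
for b_j by explicit scalars, so the determinant evaluation for the moved parameters gives the
prescribed value of J (`bilateralValue_shiftedProduct`).

Finally V is spanned by 1 and the fractions 1/(x - a), whose values on λ q^ℤ are bounded up to
finitely many points, so the series converge. It is also spanned by the shifted products, by
triangularity in the order of the poles, so the functional is unique. Hence any one generic pair
constructs J and every generic pair represents it. -/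

namespace Rahman

open Filter Topology

/-! ### Infinite and integer-index q-shifted factorials. -/

section Pochhammer

variable {q : ℂ}

lemma summable_norm_mul_pow (hq1 : ‖q‖ < 1) (a : ℂ) : Summable fun j : ℕ => ‖-(a * q ^ j)‖ := by
  simp only [norm_neg, norm_mul, norm_pow]
  exact (summable_geometric_of_lt_one (norm_nonneg _) hq1).mul_left _

lemma multipliable_qPochInf (hq1 : ‖q‖ < 1) (a : ℂ) : Multipliable fun j : ℕ => 1 - a * q ^ j := by
  simpa [sub_eq_add_neg] using multipliable_one_add_of_summable (summable_norm_mul_pow hq1 a)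

/-- This is 1 + x ≤ e^x together with the geometric series. The bound does not depend on `n`, so it
serves the finite products and, in the limit, the infinite one. -/
lemma norm_prod_one_sub_le (hq1 : ‖q‖ < 1) (a : ℂ) (n : ℕ) :
    ‖∏ i ∈ Finset.range n, (1 - a * q ^ i)‖ ≤ Real.exp (‖a‖ / (1 - ‖q‖)) := by
  have h1 : ∀ i ∈ Finset.range n, ‖1 - a * q ^ i‖ ≤ Real.exp (‖a‖ * ‖q‖ ^ i) := fun i _ => by
    refine (norm_sub_le _ _).trans ?_
    rw [norm_one, norm_mul, norm_pow, add_comm]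
    exact Real.add_one_le_exp _
  rw [norm_prod]
  refine (Finset.prod_le_prod (fun _ _ => norm_nonneg _) h1).trans ?_
  rw [← Real.exp_sum, Real.exp_le_exp, ← Finset.mul_sum, div_eq_mul_inv]
  gcongr
  rw [← tsum_geometric_of_lt_one (norm_nonneg _) hq1]
  exact (summable_geometric_of_lt_one (norm_nonneg _) hq1).sum_le_tsum _ (fun _ _ => by positivity)

lemma norm_qPochInf_le (hq1 : ‖q‖ < 1) (a : ℂ) :
    ‖qPochInf q a‖ ≤ Real.exp (‖a‖ / (1 - ‖q‖)) :=
  le_of_tendsto (multipliable_qPochInf hq1 a).hasProd.tendsto_prod_nat.norm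
    (Eventually.of_forall fun n => norm_prod_one_sub_le hq1 a n)

lemma qPochInf_eq_prod_mul (hq1 : ‖q‖ < 1) (a : ℂ) (n : ℕ) :
    qPochInf q a = (∏ i ∈ Finset.range n, (1 - a * q ^ i)) * qPochInf q (a * q ^ n) := by
  have h : Multipliable fun j : ℕ => 1 - a * q ^ (j + n) := by
    simpa [pow_add, mul_assoc, mul_comm, mul_left_comm] using multipliable_qPochInf hq1 (a * q ^ n)
  have := h.prod_mul_tprod_nat_mul' (f := fun j : ℕ => 1 - a * q ^ j)
  rw [qPochInf, ← this, qPochInf]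
  congr 1
  refine tprod_congr fun j => ?_
  rw [pow_add]; ring

lemma qPochInf_eq_one_sub_mul (hq1 : ‖q‖ < 1) (a : ℂ) :
    qPochInf q a = (1 - a) * qPochInf q (a * q) := by
  simpa using qPochInf_eq_prod_mul hq1 a 1

lemma qPochInf_eq_zero_iff (hq1 : ‖q‖ < 1) {a : ℂ} :
    qPochInf q a = 0 ↔ ∃ n : ℕ, a * q ^ n = 1 := by
  constructor
  · intro h
    by_contra! hn
    refine tprod_one_add_ne_zero_of_summable (f := fun j : ℕ => -(a * q ^ j)) (fun i => ?_)
      (summable_norm_mul_pow hq1 a) (by simpa [qPochInf, sub_eq_add_neg] using h)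
    rw [← sub_eq_add_neg, sub_ne_zero]
    exact (hn i).symm
  · rintro ⟨n, hn⟩
    rw [qPochInf_eq_prod_mul hq1 a (n + 1), Finset.prod_range_succ, hn]
    simp

lemma differentiable_qPochInf (hq1 : ‖q‖ < 1) : Differentiable ℂ (qPochInf q) := by
  intro a
  have hu : Summable fun j : ℕ => (‖a‖ + 1) * ‖q‖ ^ j :=
    (summable_geometric_of_lt_one (norm_nonneg _) hq1).mul_left _
  have h := hu.hasProdLocallyUniformlyOn_nat_one_add (f := fun (j : ℕ) (x : ℂ) => -(x * q ^ j))
    (K := Metric.ball (0 : ℂ) (‖a‖ + 1)) Metric.isOpen_ball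
    (Eventually.of_forall fun n x hx => by
      rw [norm_neg, norm_mul, norm_pow]
      have : ‖x‖ < ‖a‖ + 1 := by simpa using hx
      gcongr) (fun n => by fun_prop)
  have hd := h.differentiableOn (.of_forall fun _ => by
    simpa [Finset.prod_fn] using DifferentiableOn.finsetProd (fun _ _ => by fun_prop))
    Metric.isOpen_ball
  have := hd.differentiableAt (Metric.isOpen_ball.mem_nhds (x := a) (by simp))
  refine this.congr_of_eventuallyEq (Eventually.of_forall fun x => ?_)
  simp [qPochInf, sub_eq_add_neg]

/-- Exactly one factor vanishes at `a`, because the powers of `q` are distinct for 0 < |q| < 1. By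
the product rule the derivative is -q^n times the remaining factors. -/
lemma deriv_qPochInf_ne_zero (hq0 : q ≠ 0) (hq1 : ‖q‖ < 1) {a : ℂ} (ha : qPochInf q a = 0) :
    deriv (qPochInf q) a ≠ 0 := by
  obtain ⟨n, hn⟩ := (qPochInf_eq_zero_iff hq1).1 ha
  have hfun : qPochInf q = fun x => (1 - x * q ^ n) *
      ((∏ i ∈ Finset.range n, (1 - x * q ^ i)) * qPochInf q (x * q ^ (n + 1))) := by
    ext x
    rw [qPochInf_eq_prod_mul hq1 x (n + 1), Finset.prod_range_succ]
    ring
  have hP := differentiable_qPochInf hq1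
  have hd : DifferentiableAt ℂ (fun x => (∏ i ∈ Finset.range n, (1 - x * q ^ i)) *
      qPochInf q (x * q ^ (n + 1))) a := by
    refine DifferentiableAt.mul (DifferentiableAt.fun_finsetProd fun i _ => by fun_prop) ?_
    exact (hP _).comp a (by fun_prop)
  have h1 : HasDerivAt (fun x : ℂ => 1 - x * q ^ n) (-(q ^ n)) a := by
    simpa using ((hasDerivAt_id a).mul_const (q ^ n)).const_sub 1
  have h2 := h1.mul hd.hasDerivAt
  have hinj : ∀ m : ℕ, m ≠ n → a * q ^ m ≠ 1 := by
    intro m hm h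
    have ha0 : a ≠ 0 := by rintro rfl; simp at h
    have : q ^ m = q ^ n := mul_left_cancel₀ ha0 (h.trans hn.symm)
    have h3 : ‖q‖ ^ m = ‖q‖ ^ n := by rw [← norm_pow, this, norm_pow]
    exact hm (pow_right_injective₀ (norm_pos_iff.2 hq0) hq1.ne h3)
  have h4 : HasDerivAt (qPochInf q) _ a :=
    h2.congr_of_eventuallyEq (.of_forall fun x => congrFun hfun x)
  rw [h4.deriv, hn]
  simp only [sub_self, zero_mul, add_zero]
  refine mul_ne_zero (neg_ne_zero.2 (pow_ne_zero _ hq0)) (mul_ne_zero ?_ ?_)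
  · refine Finset.prod_ne_zero_iff.2 fun i hi => ?_
    rw [sub_ne_zero]
    exact (hinj i (Finset.mem_range.1 hi).ne).symm
  · intro h
    obtain ⟨m, hm⟩ := (qPochInf_eq_zero_iff hq1).1 h
    refine hinj (n + 1 + m) (by omega) ?_
    rw [pow_add, ← mul_assoc, hm]

lemma qPochInf_ne_zero (hq1 : ‖q‖ < 1) {a : ℂ} (ha : ∀ n : ℤ, a ≠ q ^ n) :
    qPochInf q a ≠ 0 := by
  intro h
  obtain ⟨n, hn⟩ := (qPochInf_eq_zero_iff hq1).1 h
  refine ha (-n) ?_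
  rw [zpow_neg, zpow_natCast]
  exact eq_inv_of_mul_eq_one_left hn

lemma qPochInf_self_ne_zero (hq1 : ‖q‖ < 1) : qPochInf q q ≠ 0 := by
  intro h
  obtain ⟨n, hn⟩ := (qPochInf_eq_zero_iff hq1).1 h
  rw [← pow_succ'] at hn
  have : ‖q‖ ^ (n + 1) = 1 := by rw [← norm_pow, hn, norm_one]
  exact absurd this (pow_lt_one₀ (norm_nonneg _) hq1 (by omega)).ne

lemma mul_zpow_avoids (hq0 : q ≠ 0) {a : ℂ} (ha : ∀ n : ℤ, a ≠ q ^ n) (k : ℤ) :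
    ∀ n : ℤ, a * q ^ k ≠ q ^ n := by
  intro n h
  refine ha (n - k) ?_
  rw [zpow_sub₀ hq0, ← h, mul_div_cancel_right₀ _ (zpow_ne_zero _ hq0)]

/-- `(a)_∞ = (a)_k (a q^k)_∞` for every integer `k`. -/
lemma qPochInf_eq_qPoch_mul (hq0 : q ≠ 0) (hq1 : ‖q‖ < 1) {a : ℂ} (ha : ∀ n : ℤ, a ≠ q ^ n)
    (k : ℤ) : qPochInf q a = qPoch q a k * qPochInf q (a * q ^ k) := by
  rcases k with n | n
  · simpa [qPoch] using qPochInf_eq_prod_mul hq1 a n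
  · have h := qPochInf_eq_prod_mul hq1 (a * q ^ (Int.negSucc n)) (n + 1)
    have hk : q ^ Int.negSucc n * q ^ (n + 1) = 1 := by
      rw [zpow_negSucc]; exact inv_mul_cancel₀ (pow_ne_zero _ hq0)
    rw [mul_assoc, hk, mul_one] at h
    have hprod : ∏ i ∈ Finset.range (n + 1), (1 - a * q ^ (Int.negSucc n) * q ^ i) =
        ∏ i ∈ Finset.range (n + 1), (1 - a * (q ^ (i + 1))⁻¹) := by
      rw [← Finset.prod_range_reflect]
      refine Finset.prod_congr rfl fun i hi => ?_
      have hi' := Finset.mem_range.1 hi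
      rw [mul_assoc, zpow_negSucc]
      congr 2
      rw [inv_mul_eq_div, div_eq_iff (pow_ne_zero _ hq0), eq_inv_mul_iff_mul_eq₀ (pow_ne_zero _ hq0),
        ← pow_add]
      congr 1
      omega
    rw [hprod] at h
    have hne : ∏ i ∈ Finset.range (n + 1), (1 - a * (q ^ (i + 1))⁻¹) ≠ 0 := by
      refine Finset.prod_ne_zero_iff.2 fun i _ => ?_
      rw [sub_ne_zero]
      intro h0
      refine ha (i + 1) ?_
      have := (eq_inv_of_mul_eq_one_left h0.symm)
      rw [this, inv_inv]; norm_cast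
    rw [qPoch, h, inv_mul_cancel_left₀ hne]

lemma qPoch_eq_div (hq0 : q ≠ 0) (hq1 : ‖q‖ < 1) {a : ℂ} (ha : ∀ n : ℤ, a ≠ q ^ n)
    (k : ℤ) : qPoch q a k = qPochInf q a / qPochInf q (a * q ^ k) := by
  rw [eq_div_iff (qPochInf_ne_zero hq1 (mul_zpow_avoids hq0 ha k)),
    ← qPochInf_eq_qPoch_mul hq0 hq1 ha]

lemma qPoch_ne_zero (hq0 : q ≠ 0) (hq1 : ‖q‖ < 1) {a : ℂ} (ha : ∀ n : ℤ, a ≠ q ^ n)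
    (k : ℤ) : qPoch q a k ≠ 0 := by
  rw [qPoch_eq_div hq0 hq1 ha]
  exact div_ne_zero (qPochInf_ne_zero hq1 ha)
    (qPochInf_ne_zero hq1 (mul_zpow_avoids hq0 ha k))

end Pochhammer

/-! ### Quasi-periodicity and zeros of the theta function. -/

section Theta

variable {q : ℂ}

lemma two_mul_choose_two (k : ℤ) : 2 * (k * (k - 1) / 2) = k * (k - 1) :=
  Int.mul_ediv_cancel' (by
    rcases Int.even_or_odd k with h | h
    · exact (h.two_dvd).mul_right _
    · exact ((h.sub_odd odd_one).two_dvd).mul_left _)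

lemma theta_mul_q (hq0 : q ≠ 0) (hq1 : ‖q‖ < 1) {x : ℂ} (hx : x ≠ 0) :
    theta q (x * q) = -x⁻¹ * theta q x := by
  rw [theta, theta, qPochInf_eq_one_sub_mul hq1 x]
  have : q / (x * q) = x⁻¹ := by field_simp
  rw [this, qPochInf_eq_one_sub_mul hq1 x⁻¹, inv_mul_eq_div]
  field_simp
  ring

/-- The quasi-periodicity of theta functions of degree `m`, iterated. -/
lemma quasiperiodic_iterate {F : ℂ → ℂ} (hq0 : q ≠ 0) {c : ℂ} (hc : c ≠ 0) {m : ℤ}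
    (hF : ∀ x, x ≠ 0 → F (x * q) = c * x ^ (-m) * F x) {x : ℂ} (hx : x ≠ 0) (k : ℤ) :
    F (x * q ^ k) = c ^ k * x ^ (-(m * k)) * q ^ (-(m * (k * (k - 1) / 2))) * F x := by
  have step : ∀ k : ℤ, F (x * q ^ (k + 1)) = c * x ^ (-m) * q ^ (-(m * k)) * F (x * q ^ k) := by
    intro k
    have hxk : x * q ^ k ≠ 0 := mul_ne_zero hx (zpow_ne_zero _ hq0)
    rw [zpow_add_one₀ hq0, ← mul_assoc, hF _ hxk, mul_zpow, ← zpow_mul]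
    rw [show k * -m = -(m * k) by ring]; ring
  have aux : ∀ k : ℤ, c ^ (k + 1) * x ^ (-(m * (k + 1))) * q ^ (-(m * ((k + 1) * (k + 1 - 1) / 2))) =
      c * x ^ (-m) * q ^ (-(m * k)) *
      (c ^ k * x ^ (-(m * k)) * q ^ (-(m * (k * (k - 1) / 2)))) := by
    intro k
    have e : (k + 1) * (k + 1 - 1) / 2 = k * (k - 1) / 2 + k := by
      have h1 := two_mul_choose_two k
      have h2 := two_mul_choose_two (k + 1)
      have : 2 * ((k + 1) * (k + 1 - 1) / 2) = 2 * (k * (k - 1) / 2 + k) := by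
        rw [h2, mul_add, h1]; ring
      omega
    rw [e, zpow_add_one₀ hc, show -(m * (k + 1)) = -(m * k) + -m by ring, zpow_add₀ hx,
      show -(m * (k * (k - 1) / 2 + k)) = -(m * k) + -(m * (k * (k - 1) / 2)) by ring, zpow_add₀ hq0]
    ring
  induction k using Int.induction_on with
  | zero => simp
  | succ n ih => rw [step, ih, aux]; ring
  | pred n ih =>
    have h1 := step (-(n : ℤ) - 1)
    have h2 := aux (-(n : ℤ) - 1)
    simp only [sub_add_cancel] at h1 h2
    have hne : c * x ^ (-m) * q ^ (-(m * (-(n : ℤ) - 1))) ≠ 0 :=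
      mul_ne_zero (mul_ne_zero hc (zpow_ne_zero _ hx)) (zpow_ne_zero _ hq0)
    apply mul_left_cancel₀ hne
    rw [← h1, ih, h2]; ring

lemma theta_mul_zpow (hq0 : q ≠ 0) (hq1 : ‖q‖ < 1) {x : ℂ} (hx : x ≠ 0) (k : ℤ) :
    theta q (x * q ^ k) = (-1) ^ k * x ^ (-k) * q ^ (-(k * (k - 1) / 2)) * theta q x := by
  simpa using quasiperiodic_iterate (F := theta q) (c := -1) (m := 1) hq0 (by simp)
    (fun x hx => by rw [theta_mul_q hq0 hq1 hx]; simp) hx k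

lemma theta_inv (hq1 : ‖q‖ < 1) {x : ℂ} (hx : x ≠ 0) :
    theta q x⁻¹ = -x⁻¹ * theta q x := by
  rw [theta, theta, qPochInf_eq_one_sub_mul hq1 x, qPochInf_eq_one_sub_mul hq1 x⁻¹, inv_mul_eq_div,
    div_inv_eq_mul, mul_comm q x]
  field_simp
  ring

lemma theta_eq_zero_iff (hq0 : q ≠ 0) (hq1 : ‖q‖ < 1) {x : ℂ} (hx : x ≠ 0) :
    theta q x = 0 ↔ ∃ n : ℤ, x = q ^ n := by
  constructor
  · intro h
    rcases mul_eq_zero.1 h with h | h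
    · by_contra! hn
      exact qPochInf_ne_zero hq1 hn h
    · by_contra! hn
      refine qPochInf_ne_zero hq1 (fun n hn' => hn (1 - n) ?_) h
      rw [zpow_sub₀ hq0, zpow_one, ← hn', div_div_cancel₀ hq0]
  · rintro ⟨n, rfl⟩
    have := theta_mul_zpow hq0 hq1 one_ne_zero n
    rw [one_mul] at this
    rw [this]
    have h1 : qPochInf q 1 = 0 := (qPochInf_eq_zero_iff hq1).2 ⟨0, by simp⟩
    simp [theta, h1]

lemma theta_ne_zero (hq0 : q ≠ 0) (hq1 : ‖q‖ < 1) {x : ℂ} (hx : x ≠ 0) (h : ∀ n : ℤ, x ≠ q ^ n) :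
    theta q x ≠ 0 := fun h0 => by
  obtain ⟨n, hn⟩ := (theta_eq_zero_iff hq0 hq1 hx).1 h0
  exact h n hn

lemma differentiableAt_theta (hq1 : ‖q‖ < 1) {x : ℂ} (hx : x ≠ 0) :
    DifferentiableAt ℂ (theta q) x := by
  have hP := differentiable_qPochInf hq1
  exact (hP x).mul ((hP _).comp x (by fun_prop (disch := assumption)))

/-- `(q^{1-k}/a)_∞` in terms of `(a)_k`. -/
lemma qPochInf_div_zpow (hq0 : q ≠ 0) (hq1 : ‖q‖ < 1) {a : ℂ} (ha0 : a ≠ 0)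
    (ha : ∀ n : ℤ, a ≠ q ^ n) (k : ℤ) :
    qPochInf q (q / (a * q ^ k)) =
      (-1) ^ k * a ^ (-k) * q ^ (-(k * (k - 1) / 2)) * qPoch q a k * qPochInf q (q / a) := by
  -- Expand θ(a q^k) and θ(a) by definition, insert (a)_∞ = (a)_k (a q^k)_∞, and cancel (a q^k)_∞.
  have h := theta_mul_zpow hq0 hq1 ha0 k
  have hne := qPochInf_ne_zero hq1 (mul_zpow_avoids hq0 ha k)
  rw [theta, theta, qPochInf_eq_qPoch_mul hq0 hq1 ha k] at h
  apply mul_left_cancel₀ hne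
  rw [h]; ring

end Theta

end Rahman

namespace Rahman

open Filter Topology

/-! ### Division and a Liouville theorem on the punctured plane. -/

section PuncturedPlane

/-- `f` is holomorphic on `ℂ \ {0}` with only simple zeros there. -/
def SimpleZeros (f : ℂ → ℂ) : Prop :=
  ∀ z : ℂ, z ≠ 0 → DifferentiableAt ℂ f z ∧ (f z = 0 → deriv f z ≠ 0)

lemma SimpleZeros.mul {f g : ℂ → ℂ} (hf : SimpleZeros f) (hg : SimpleZeros g)
    (h : ∀ z, z ≠ 0 → f z = 0 → g z ≠ 0) : SimpleZeros (fun z => f z * g z) := by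
  intro z hz
  obtain ⟨hf1, hf2⟩ := hf z hz
  obtain ⟨hg1, hg2⟩ := hg z hz
  refine ⟨hf1.mul hg1, fun h0 => ?_⟩
  have hd : deriv (fun z => f z * g z) z = deriv f z * g z + f z * deriv g z := deriv_mul hf1 hg1
  rw [hd]
  rcases mul_eq_zero.1 h0 with h1 | h1
  · rw [h1, zero_mul, add_zero]
    exact mul_ne_zero (hf2 h1) (h z hz h1)
  · have hfz : f z ≠ 0 := fun h2 => h z hz h2 h1
    rw [h1, mul_zero, zero_add]
    exact mul_ne_zero hfz (hg2 h1)

lemma SimpleZeros.comp {f φ : ℂ → ℂ} (hf : SimpleZeros f)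
    (h : ∀ z, z ≠ 0 → φ z ≠ 0 ∧ ∃ d, d ≠ 0 ∧ HasDerivAt φ d z) :
    SimpleZeros (fun z => f (φ z)) := by
  intro z hz
  obtain ⟨h1, d, hd, hφ⟩ := h z hz
  obtain ⟨hf1, hf2⟩ := hf _ h1
  have := hf1.hasDerivAt.comp z hφ
  refine ⟨this.differentiableAt, fun h0 => ?_⟩
  have h3 : deriv (fun z => f (φ z)) z = deriv f (φ z) * d := this.deriv
  rw [h3]
  exact mul_ne_zero (hf2 h0) hd

lemma simpleZeros_const {c : ℂ} (hc : c ≠ 0) : SimpleZeros (fun _ => c) :=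
  fun _ _ => ⟨differentiableAt_const c, fun h => absurd h hc⟩

lemma SimpleZeros.const_mul {f : ℂ → ℂ} (hf : SimpleZeros f) {c : ℂ} (hc : c ≠ 0) :
    SimpleZeros (fun z => c * f z) :=
  (simpleZeros_const hc).mul hf (fun _ _ h => absurd h hc)

lemma SimpleZeros.finset_prod {ι : Type*} {f : ι → ℂ → ℂ} (s : Finset ι)
    (hf : ∀ i ∈ s, SimpleZeros (f i))
    (h : ∀ i ∈ s, ∀ j ∈ s, i ≠ j → ∀ z, z ≠ 0 → f i z = 0 → f j z ≠ 0) :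
    SimpleZeros (fun z => ∏ i ∈ s, f i z) := by
  classical
  induction s using Finset.induction_on with
  | empty => simpa using simpleZeros_const one_ne_zero
  | insert a s ha ih =>
    simp only [Finset.prod_insert ha]
    refine (hf a (by simp)).mul (ih (fun i hi => hf i (by simp [hi]))
      (fun i hi j hj => h i (by simp [hi]) j (by simp [hj]))) fun z hz h0 => ?_
    refine Finset.prod_ne_zero_iff.2 fun i hi => ?_
    exact h a (by simp) i (by simp [hi]) (by rintro rfl; exact ha hi) z hz h0

lemma hasDerivAt_const_mul (c z : ℂ) : HasDerivAt (fun z => c * z) c z := by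
  simpa using (hasDerivAt_id z).const_mul c

lemma hasDerivAt_const_div (c : ℂ) {z : ℂ} (hz : z ≠ 0) :
    HasDerivAt (fun z => c / z) (-c / z ^ 2) z := by
  have h := (hasDerivAt_inv hz).const_mul c
  rw [mul_neg, ← div_eq_mul_inv, ← neg_div] at h
  simpa only [div_eq_mul_inv] using h

/-- A function vanishing at the simple zeros of `g` is divisible by `g`. -/
lemma SimpleZeros.exists_eq_mul {f g : ℂ → ℂ} (hg : SimpleZeros g)
    (hf : ∀ z, z ≠ 0 → DifferentiableAt ℂ f z) (h0 : ∀ z, z ≠ 0 → g z = 0 → f z = 0) :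
    ∃ h : ℂ → ℂ, (∀ z, z ≠ 0 → DifferentiableAt ℂ h z) ∧ ∀ z, z ≠ 0 → f z = g z * h z := by
  classical
  -- At a zero of `g` the quotient is given its limit f'/g'. Near such a point it equals the
  -- quotient of the two `dslope`s, which are holomorphic.
  refine ⟨fun z => if g z = 0 then deriv f z / deriv g z else f z / g z, fun z hz => ?_,
    fun z hz => ?_⟩
  · obtain ⟨hg1, hg2⟩ := hg z hz
    by_cases hgz : g z = 0
    · have hs : ({0}ᶜ : Set ℂ) ∈ 𝓝 z := isOpen_compl_singleton.mem_nhds hz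
      have hdf : DifferentiableAt ℂ (dslope f z) z :=
        ((Complex.differentiableOn_dslope hs).2
          fun w hw => (hf w hw).differentiableWithinAt).differentiableAt hs
      have hdg : DifferentiableAt ℂ (dslope g z) z :=
        ((Complex.differentiableOn_dslope hs).2
          fun w hw => (hg w hw).1.differentiableWithinAt).differentiableAt hs
      have hne : dslope g z z ≠ 0 := by rw [dslope_same]; exact hg2 hgz
      refine (hdf.div hdg hne).congr_of_eventuallyEq ?_
      have hev := hg1.hasDerivAt.eventually_ne (c := 0) (hg2 hgz)
      rw [eventually_nhdsWithin_iff] at hev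
      filter_upwards [hev] with w hw
      by_cases hwz : w = z
      · subst hwz
        simp [hgz, dslope_same]
      · have hgw := hw hwz
        rw [if_neg hgw, Pi.div_apply, dslope_of_ne _ hwz, dslope_of_ne _ hwz, slope_def_field,
          slope_def_field, hgz, h0 z hz hgz, sub_zero, sub_zero,
          div_div_div_cancel_right₀ (sub_ne_zero.2 hwz)]
    · refine ((hf z hz).div hg1 hgz).congr_of_eventuallyEq ?_
      filter_upwards [hg1.continuousAt.eventually_ne hgz] with w hw
      simp [hw]
  · by_cases hgz : g z = 0
    · simp [hgz, h0 z hz hgz]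
    · simp [hgz, mul_div_cancel₀]

/-- A holomorphic function on `ℂ \ {0}` that is bounded on a bilateral geometric sequence of circles
is constant. -/
lemma exists_const_of_bounded_on_circles {h : ℂ → ℂ} (hh : ∀ z, z ≠ 0 → DifferentiableAt ℂ h z)
    {Q ρ M : ℝ} (hQ0 : 0 < Q) (hQ1 : Q < 1) (hρ : 0 < ρ)
    (hM : ∀ k : ℤ, ∀ z : ℂ, ‖z‖ = ρ * Q ^ k → ‖h z‖ ≤ M) :
    ∃ c, ∀ z, z ≠ 0 → h z = c := by
  -- Every point lies in an annulus between two of the circles, where the maximum principle applies.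
  have hbd : ∀ z, z ≠ 0 → ‖h z‖ ≤ M := by
    intro z hz
    have hz' : 0 < ‖z‖ := norm_pos_iff.2 hz
    obtain ⟨n, hn⟩ := exists_pow_lt_of_lt_one (div_pos hz' hρ) hQ1
    obtain ⟨m, hm⟩ := exists_pow_lt_of_lt_one (div_pos hρ hz') hQ1
    have h1 : ρ * Q ^ (n : ℤ) < ‖z‖ := by
      rw [lt_div_iff₀ hρ] at hn; rw [zpow_natCast]; linarith
    have h2 : ‖z‖ < ρ * Q ^ (-(m : ℤ)) := by
      rw [lt_div_iff₀ hz'] at hm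
      rw [zpow_neg, zpow_natCast, ← div_eq_mul_inv, lt_div_iff₀ (by positivity)]; linarith
    set a := ρ * Q ^ (n : ℤ) with ha
    set b := ρ * Q ^ (-(m : ℤ)) with hb
    have ha0 : 0 < a := by positivity
    let U : Set ℂ := {w | a < ‖w‖ ∧ ‖w‖ < b}
    have hUo : IsOpen U := (isOpen_lt continuous_const continuous_norm).inter
      (isOpen_lt continuous_norm continuous_const)
    have hcl : closure U ⊆ {w | a ≤ ‖w‖ ∧ ‖w‖ ≤ b} :=
      closure_minimal (fun w hw => ⟨hw.1.le, hw.2.le⟩)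
        ((isClosed_le continuous_const continuous_norm).inter
          (isClosed_le continuous_norm continuous_const))
    refine Complex.norm_le_of_forall_mem_frontier_norm_le (U := U) ?_ ?_ ?_
      (subset_closure ⟨h1, h2⟩)
    · exact (Metric.isBounded_ball (x := (0 : ℂ)) (r := b)).subset
        fun w (hw : a < ‖w‖ ∧ ‖w‖ < b) => by simpa using hw.2
    · refine DifferentiableOn.diffContOnCl fun w hw => (hh w ?_).differentiableWithinAt
      rw [← norm_pos_iff]
      exact ha0.trans_le (hcl hw).1
    · intro w hw
      have hw1 := hcl (frontier_subset_closure hw)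
      have hw2 : w ∉ U := by
        rw [hUo.frontier_eq] at hw; exact hw.2
      rcases hw1.1.eq_or_lt with h | h
      · exact hM n w h.symm
      · exact hM (-m) w (le_antisymm hw1.2 (not_lt.1 fun h' => hw2 ⟨h, h'⟩))
  -- The pull-back along exp is entire and bounded, hence constant.
  have hd : Differentiable ℂ (fun w => h (Complex.exp w)) := fun w =>
    (hh _ (Complex.exp_ne_zero w)).comp w Complex.differentiable_exp.differentiableAt
  obtain ⟨c, hc⟩ := hd.exists_const_forall_eq_of_bounded
    (isBounded_iff_forall_norm_le.2 ⟨M, by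
      rintro _ ⟨w, rfl⟩; exact hbd _ (Complex.exp_ne_zero w)⟩)
  refine ⟨c, fun z hz => ?_⟩
  rw [← Complex.exp_log hz]
  exact hc _

lemma exists_pos_notMem_of_countable {S : Set ℝ} (hS : S.Countable) : ∃ r : ℝ, 0 < r ∧ r ∉ S := by
  obtain ⟨r, hr, hr'⟩ := (hS.dense_compl ℝ).exists_mem_open (isOpen_Ioi (a := (0 : ℝ)))
    ⟨1, Set.mem_Ioi.2 zero_lt_one⟩
  exact ⟨r, hr', hr⟩

/-- The quotient of two functions on `ℂ \ {0}` with the same multiplier is constant, if it has no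
poles. -/
lemma SimpleZeros.exists_eq_const_mul {f g m : ℂ → ℂ} {q : ℂ} (hq0 : q ≠ 0) (hq1 : ‖q‖ < 1)
    (hg : SimpleZeros g) (hf : ∀ z, z ≠ 0 → DifferentiableAt ℂ f z)
    (h0 : ∀ z, z ≠ 0 → g z = 0 → f z = 0) (hm : ∀ z, z ≠ 0 → m z ≠ 0)
    (hfm : ∀ z, z ≠ 0 → f (z * q) = m z * f z) (hgm : ∀ z, z ≠ 0 → g (z * q) = m z * g z)
    {S : Set ℝ} (hS : S.Countable) (hgS : ∀ z, z ≠ 0 → g z = 0 → ‖z‖ ∈ S) :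
    ∃ c, ∀ z, z ≠ 0 → f z = c * g z := by
  obtain ⟨h, hh, hfgh⟩ := hg.exists_eq_mul hf h0
  obtain ⟨ρ, hρ, hρS⟩ := exists_pos_notMem_of_countable hS
  have hQ : 0 < ‖q‖ := norm_pos_iff.2 hq0
  -- The common multiplier cancels in the quotient `h`, which is therefore invariant under z → zq
  -- off the zeros of `g`. A bound on one zero-free circle then passes to all its dilates by powers
  -- of `q`.
  have hgper : ∀ k : ℤ, ∀ z, z ≠ 0 → g z ≠ 0 → g (z * q ^ k) ≠ 0 ∧ h (z * q ^ k) = h z := by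
    have up : ∀ z, z ≠ 0 → g z ≠ 0 → g (z * q) ≠ 0 ∧ h (z * q) = h z := by
      intro z hz hgz
      have h1 : g (z * q) ≠ 0 := by rw [hgm z hz]; exact mul_ne_zero (hm z hz) hgz
      refine ⟨h1, mul_left_cancel₀ h1 ?_⟩
      rw [← hfgh _ (mul_ne_zero hz hq0), hfm z hz, hgm z hz, hfgh z hz]; ring
    intro k z hz hgz
    induction k using Int.induction_on with
    | zero => simpa using hgz
    | succ n ih =>
      have := up _ (mul_ne_zero hz (zpow_ne_zero n hq0)) ih.1
      rw [zpow_add_one₀ hq0, ← mul_assoc]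
      exact ⟨this.1, this.2.trans ih.2⟩
    | pred n ih =>
      have hw : z * q ^ (-(n : ℤ) - 1) ≠ 0 := mul_ne_zero hz (zpow_ne_zero _ hq0)
      have e : z * q ^ (-(n : ℤ)) = z * q ^ (-(n : ℤ) - 1) * q := by
        rw [mul_assoc, ← zpow_add_one₀ hq0]; simp
      have hgw : g (z * q ^ (-(n : ℤ) - 1)) ≠ 0 := by
        intro h0
        apply ih.1
        rw [e, hgm _ hw, h0, mul_zero]
      have := up _ hw hgw
      rw [← e] at this
      exact ⟨hgw, this.2.symm.trans ih.2⟩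
  have hcont : ContinuousOn h (Metric.sphere 0 ρ) := fun z hz =>
    (hh z (by rintro rfl; simp at hz; exact hρ.ne hz)).continuousAt.continuousWithinAt
  obtain ⟨M, hM⟩ := (isCompact_sphere (0 : ℂ) ρ).exists_bound_of_continuousOn hcont
  obtain ⟨c, hc⟩ := exists_const_of_bounded_on_circles hh hQ hq1 hρ (M := M) (by
    intro k z hz
    have hw : ‖z * q ^ (-k)‖ = ρ := by
      rw [norm_mul, norm_zpow, hz, zpow_neg, mul_assoc, mul_inv_cancel₀ (zpow_ne_zero _ hQ.ne'),
        mul_one]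
    have hw0 : z * q ^ (-k) ≠ 0 := by rw [← norm_pos_iff, hw]; exact hρ
    have := (hgper k _ hw0 (fun h0 => hρS (hw ▸ hgS _ hw0 h0))).2
    rw [mul_assoc, ← zpow_add₀ hq0, neg_add_cancel, zpow_zero, mul_one] at this
    rw [this]
    exact hM _ (by simpa using hw))
  exact ⟨c, fun z hz => by rw [hfgh z hz, hc z hz, mul_comm]⟩

end PuncturedPlane

/-! ### Simplicity of the zeros of theta. -/

section SimpleZerosTheta

variable {q : ℂ}

lemma simpleZeros_qPochInf (hq0 : q ≠ 0) (hq1 : ‖q‖ < 1) : SimpleZeros (qPochInf q) :=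
  fun z _ => ⟨differentiable_qPochInf hq1 z, deriv_qPochInf_ne_zero hq0 hq1⟩

/-- The two factors have no common zero: z q^n = 1 and (q/z) q^m = 1 would multiply to q^{m+n+1} =
1. -/
lemma simpleZeros_theta (hq0 : q ≠ 0) (hq1 : ‖q‖ < 1) : SimpleZeros (theta q) := by
  refine (simpleZeros_qPochInf hq0 hq1).mul ((simpleZeros_qPochInf hq0 hq1).comp
    (φ := fun z => q / z) fun z hz => ⟨div_ne_zero hq0 hz, _, ?_, hasDerivAt_const_div q hz⟩) ?_
  · exact div_ne_zero (neg_ne_zero.2 hq0) (pow_ne_zero _ hz)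
  · intro z hz h1 h2
    obtain ⟨n, hn⟩ := (qPochInf_eq_zero_iff hq1).1 h1
    obtain ⟨m, hm⟩ := (qPochInf_eq_zero_iff hq1).1 h2
    have h3 : q ^ (m + n + 1) = 1 := by
      calc q ^ (m + n + 1) = (z * q ^ n) * (q / z * q ^ m) := by field_simp; ring
        _ = 1 := by rw [hn, hm, one_mul]
    have : ‖q‖ ^ (m + n + 1) = 1 := by rw [← norm_pow, h3, norm_one]
    exact absurd this (pow_lt_one₀ (norm_nonneg _) hq1 (by omega)).ne

end SimpleZerosTheta

end Rahman

namespace Rahman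

open Filter Topology

/-! ### The bilateral series cleared of denominators. -/

section Definitions

/-- The odd function `(z - 1/z) ∏ (q z^± / b_j)_∞`. -/
noncomputable def oddKernel (q : ℂ) (b : Fin 6 → ℂ) (z : ℂ) : ℂ :=
  (z - z⁻¹) * ∏ j, (qPochInf q (q * z / b j) * qPochInf q (q * z⁻¹ / b j))

/-- The terms of the bilateral series, normalized to be holomorphic in all parameters. -/
noncomputable def latticeTerm (q : ℂ) (b : Fin 6 → ℂ) (lam : ℂ) (x : ℤ) : ℂ :=
  lam ^ (6 * x) * q ^ (3 * x ^ 2) * oddKernel q b (lam * q ^ x)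

/-- The normalized bilateral series. -/
noncomputable def latticeSum (q : ℂ) (b : Fin 6 → ℂ) (lam : ℂ) : ℂ := ∑' x : ℤ, latticeTerm q b lam x

/-- One half of `latticeTerm` in the two distinguished parameters `s`, `t`, when these are replaced by
`s q^k`, `t q^{-k}` and the result is normalized. -/
noncomputable def pairFactor (q s t : ℂ) (k : ℕ) (z : ℂ) : ℂ :=
  (∏ i ∈ Finset.range k, (1 - s * z * q ^ i)) * qPochInf q (q * z / s) *
    qPochInf q (q ^ (k + 1) * z / t)

/-- The terms of the bilateral series with parameters `s q^k, t q^{-k}, c`, normalized so that they stay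
bounded as `k` grows. -/
noncomputable def shiftedTerm (q s t : ℂ) (c : Fin 4 → ℂ) (k : ℕ) (lam : ℂ) (x : ℤ) : ℂ :=
  lam ^ (6 * x) * q ^ (3 * x ^ 2) * (lam * q ^ x - (lam * q ^ x)⁻¹) *
    ((∏ j, (qPochInf q (q * (lam * q ^ x) / c j) * qPochInf q (q * (lam * q ^ x)⁻¹ / c j))) *
      (pairFactor q s t k (lam * q ^ x) * pairFactor q s t k (lam * q ^ x)⁻¹))

end Definitions

/-! ### Decay of the terms, uniform under shifts of two parameters. -/

section Bounds

variable {q : ℂ}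

/-- Pulling -u q^{-i} out of each factor isolates the growth u^n q^{-n(n-1)/2}; the remaining
product is bounded uniformly in `n`. -/
lemma prod_one_sub_mul_inv (hq0 : q ≠ 0) {u : ℂ} (hu : u ≠ 0) (n : ℕ) :
    ∏ i ∈ Finset.range n, (1 - u * (q ^ i)⁻¹) =
      (-u) ^ n * (q ^ (∑ i ∈ Finset.range n, i))⁻¹ * ∏ i ∈ Finset.range n, (1 - u⁻¹ * q ^ i) := by
  induction n with
  | zero => simp
  | succ n ih =>
    have hq := pow_ne_zero n hq0
    have hq' := pow_ne_zero (∑ i ∈ Finset.range n, i) hq0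
    rw [Finset.prod_range_succ, Finset.prod_range_succ, Finset.sum_range_succ, ih, pow_succ, pow_add,
      mul_inv]
    have : 1 - u * (q ^ n)⁻¹ = -u * (q ^ n)⁻¹ * (1 - u⁻¹ * q ^ n) := by field_simp; ring
    rw [this]; ring

lemma norm_prod_one_sub_mul_inv_le (hq0 : q ≠ 0) (hq1 : ‖q‖ < 1) {u : ℂ} (hu : u ≠ 0) {B : ℝ}
    (hB : ‖u⁻¹‖ ≤ B) (n : ℕ) :
    ‖∏ i ∈ Finset.range n, (1 - u * (q ^ i)⁻¹)‖ ≤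
      Real.exp (B / (1 - ‖q‖)) * (‖u‖ ^ n / ‖q‖ ^ (∑ i ∈ Finset.range n, i)) := by
  have h1 : 0 < 1 - ‖q‖ := by linarith
  rw [prod_one_sub_mul_inv hq0 hu, norm_mul, norm_mul, norm_pow, norm_neg, norm_inv, norm_pow,
    ← div_eq_mul_inv, mul_comm]
  gcongr
  exact (norm_prod_one_sub_le hq1 _ n).trans (by gcongr)

lemma qPochInf_mul_inv_pow (hq0 : q ≠ 0) (hq1 : ‖q‖ < 1) (u : ℂ) (n : ℕ) :
    qPochInf q (u * q * (q ^ n)⁻¹) =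
      (∏ i ∈ Finset.range n, (1 - u * (q ^ i)⁻¹)) * qPochInf q (u * q) := by
  rw [qPochInf_eq_prod_mul hq1 _ n, ← Finset.prod_range_reflect, inv_mul_cancel_right₀ (pow_ne_zero _ hq0)]
  congr 1
  refine Finset.prod_congr rfl fun i hi => ?_
  have hi' := Finset.mem_range.1 hi
  have hn : q ^ n = q * q ^ (n - 1 - i) * q ^ i := by
    rw [← pow_succ', ← pow_add]; congr 1; omega
  have h1 := pow_ne_zero i hq0
  have h2 := pow_ne_zero (n - 1 - i) hq0
  rw [hn]
  congr 1
  field_simp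

lemma norm_qPochInf_mul_inv_pow_le (hq0 : q ≠ 0) (hq1 : ‖q‖ < 1) {u : ℂ} (hu : u ≠ 0) {B : ℝ}
    (hB1 : ‖u‖ ≤ B) (hB : ‖u⁻¹‖ ≤ B) (n : ℕ) :
    ‖qPochInf q (u * q * (q ^ n)⁻¹)‖ ≤
      Real.exp (B / (1 - ‖q‖)) ^ 2 * (‖u‖ ^ n / ‖q‖ ^ (∑ i ∈ Finset.range n, i)) := by
  have h1 : 0 < 1 - ‖q‖ := by linarith
  rw [qPochInf_mul_inv_pow hq0 hq1, norm_mul, sq]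
  have h2 := norm_prod_one_sub_mul_inv_le hq0 hq1 hu hB n
  have h3 : ‖qPochInf q (u * q)‖ ≤ Real.exp (B / (1 - ‖q‖)) := by
    refine (norm_qPochInf_le hq1 _).trans ?_
    gcongr
    rw [norm_mul]
    nlinarith [norm_nonneg u, norm_nonneg q]
  calc _ ≤ (Real.exp (B / (1 - ‖q‖)) * (‖u‖ ^ n / ‖q‖ ^ (∑ i ∈ Finset.range n, i))) *
        Real.exp (B / (1 - ‖q‖)) := by gcongr
    _ = _ := by ring

/-- The bound is uniform in `k`. For n ≤ k only the first `n` factors of the finite product are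
large, each governed by |a/q| ≤ κ|d|, and the infinite product stays bounded. For n > k all `k`
factors are large and the infinite product contributes n - k more; the exponents of |q| add up to
the same triangular number. If k = 0 the finite product is empty and no comparison of `a` with `d`
is needed. -/
lemma norm_prod_mul_qPochInf_le (hq0 : q ≠ 0) (hq1 : ‖q‖ < 1) {a d : ℂ} (ha : a ≠ 0) (hd : d ≠ 0)
    {B κ : ℝ} (hBa : ‖a‖ ≤ B) (hBa' : ‖a⁻¹‖ ≤ B) (hBd : ‖d‖ ≤ B) (hBd' : ‖d⁻¹‖ ≤ B)
    (hκ : 1 ≤ κ) {k : ℕ} (hk : k = 0 ∨ ‖a‖ ≤ κ * (‖q‖ * ‖d‖)) (n : ℕ) :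
    ‖(∏ i ∈ Finset.range k, (1 - a * (q ^ n)⁻¹ * q ^ i)) *
        qPochInf q (q ^ (k + 1) * (d * (q ^ n)⁻¹))‖ ≤
      Real.exp (B / (1 - ‖q‖)) ^ 3 * ((κ * ‖d‖) ^ n / ‖q‖ ^ (∑ i ∈ Finset.range n, i)) := by
  have hQ : 0 < ‖q‖ := norm_pos_iff.2 hq0
  have h1 : 0 < 1 - ‖q‖ := by linarith
  have hB0 : 0 ≤ B := (norm_nonneg _).trans hBa
  set E := Real.exp (B / (1 - ‖q‖)) with hE
  have hE1 : 1 ≤ E := Real.one_le_exp (by positivity)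
  have hκ0 : 0 ≤ κ := by linarith
  have hd0 : 0 < ‖d‖ := norm_pos_iff.2 hd
  rcases le_or_gt n k with hnk | hnk
  · obtain ⟨m, rfl⟩ := Nat.exists_eq_add_of_le hnk
    have haq : a / q ≠ 0 := div_ne_zero ha hq0
    have hfirst : ∏ i ∈ Finset.range n, (1 - a * (q ^ n)⁻¹ * q ^ i) =
        ∏ i ∈ Finset.range n, (1 - a / q * (q ^ i)⁻¹) := by
      rw [← Finset.prod_range_reflect]
      refine Finset.prod_congr rfl fun i hi => ?_
      have hi' := Finset.mem_range.1 hi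
      have hn : q ^ n = q * q ^ (n - 1 - i) * q ^ i := by
        rw [← pow_succ', ← pow_add]; congr 1; omega
      have h1 := pow_ne_zero i hq0
      have h2 := pow_ne_zero (n - 1 - i) hq0
      rw [hn]
      congr 1
      field_simp
    have hsecond : ∏ i ∈ Finset.range m, (1 - a * (q ^ n)⁻¹ * q ^ (n + i)) =
        ∏ i ∈ Finset.range m, (1 - a * q ^ i) := by
      refine Finset.prod_congr rfl fun i _ => ?_
      rw [pow_add, mul_assoc, inv_mul_cancel_left₀ (pow_ne_zero _ hq0)]
    have hthird : q ^ (n + m + 1) * (d * (q ^ n)⁻¹) = d * q ^ (m + 1) := by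
      have := pow_ne_zero n hq0
      rw [show n + m + 1 = n + (m + 1) by omega, pow_add]
      field_simp
    rw [Finset.prod_range_add, hfirst, hsecond, hthird, norm_mul, norm_mul]
    have e1 : ‖∏ i ∈ Finset.range n, (1 - a / q * (q ^ i)⁻¹)‖ ≤
        E * (‖a / q‖ ^ n / ‖q‖ ^ (∑ i ∈ Finset.range n, i)) := by
      refine norm_prod_one_sub_mul_inv_le hq0 hq1 haq ?_ n
      rw [inv_div, norm_div, div_eq_mul_inv, ← norm_inv]
      nlinarith [norm_nonneg a⁻¹]
    have e2 : ‖∏ i ∈ Finset.range m, (1 - a * q ^ i)‖ ≤ E :=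
      (norm_prod_one_sub_le hq1 _ _).trans (by rw [hE]; gcongr)
    have e3 : ‖qPochInf q (d * q ^ (m + 1))‖ ≤ E := by
      refine (norm_qPochInf_le hq1 _).trans ?_
      rw [hE]
      gcongr
      rw [norm_mul, norm_pow]
      have := pow_le_one₀ (n := m + 1) hQ.le hq1.le
      nlinarith [norm_nonneg d]
    have e4 : ‖a / q‖ ^ n ≤ (κ * ‖d‖) ^ n := by
      rcases hk with hk | hk
      · have : n = 0 := by omega
        simp [this]
      · rw [norm_div]
        gcongr
        rw [div_le_iff₀ hQ]
        linarith
    calc _ ≤ E * (‖a / q‖ ^ n / ‖q‖ ^ (∑ i ∈ Finset.range n, i)) * E * E := by gcongr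
      _ ≤ E * ((κ * ‖d‖) ^ n / ‖q‖ ^ (∑ i ∈ Finset.range n, i)) * E * E := by gcongr
      _ = _ := by ring
  · obtain ⟨m, rfl⟩ := Nat.exists_eq_add_of_lt hnk
    set u := a * (q ^ (m + 2))⁻¹ with hu
    have hu0 : u ≠ 0 := mul_ne_zero ha (inv_ne_zero (pow_ne_zero _ hq0))
    have hfirst : ∏ i ∈ Finset.range k, (1 - a * (q ^ (k + m + 1))⁻¹ * q ^ i) =
        ∏ i ∈ Finset.range k, (1 - u * (q ^ i)⁻¹) := by
      rw [← Finset.prod_range_reflect]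
      refine Finset.prod_congr rfl fun i hi => ?_
      have hi' := Finset.mem_range.1 hi
      have hn : q ^ (k + m + 1) = q ^ (m + 2) * q ^ (k - 1 - i) * q ^ i := by
        rw [← pow_add, ← pow_add]; congr 1; omega
      have h1 := pow_ne_zero i hq0
      have h2 := pow_ne_zero (k - 1 - i) hq0
      have h3 := pow_ne_zero (m + 2) hq0
      rw [hn, hu]
      congr 1
      field_simp
    have hthird : q ^ (k + 1) * (d * (q ^ (k + m + 1))⁻¹) = d * q * (q ^ (m + 1))⁻¹ := by
      have := pow_ne_zero k hq0
      have := pow_ne_zero (m + 1) hq0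
      rw [show k + m + 1 = k + (m + 1) by omega, pow_add, pow_add]
      field_simp
    rw [hfirst, hthird, norm_mul]
    have e1 : ‖∏ i ∈ Finset.range k, (1 - u * (q ^ i)⁻¹)‖ ≤
        E * (‖u‖ ^ k / ‖q‖ ^ (∑ i ∈ Finset.range k, i)) := by
      refine norm_prod_one_sub_mul_inv_le hq0 hq1 hu0 ?_ k
      rw [hu, mul_inv, inv_inv, norm_mul, norm_pow]
      have := pow_le_one₀ (n := m + 2) hQ.le hq1.le
      nlinarith [norm_nonneg a⁻¹]
    have e2 := norm_qPochInf_mul_inv_pow_le hq0 hq1 hd hBd hBd' (m + 1)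
    have e3 : ‖u‖ ^ k ≤ (κ * ‖d‖) ^ k / ‖q‖ ^ (k * (m + 1)) := by
      rcases hk with hk | hk
      · simp [hk]
      · rw [mul_comm k, pow_mul, ← div_pow]
        gcongr
        rw [hu, norm_mul, norm_inv, norm_pow, ← div_eq_mul_inv, pow_succ ‖q‖ (m + 1),
          div_le_div_iff₀ (by positivity) (by positivity)]
        calc ‖a‖ * ‖q‖ ^ (m + 1) ≤ (κ * (‖q‖ * ‖d‖)) * ‖q‖ ^ (m + 1) := by gcongr
          _ = _ := by ring
    have e4 : ‖d‖ ^ (m + 1) ≤ (κ * ‖d‖) ^ (m + 1) := by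
      gcongr
      nlinarith
    have hsum : ∑ i ∈ Finset.range (k + m + 1), i =
        k * (m + 1) + ∑ i ∈ Finset.range k, i + ∑ i ∈ Finset.range (m + 1), i := by
      rw [add_assoc k m 1, Finset.sum_range_add, Finset.sum_add_distrib]
      simp
      ring
    calc _ ≤ (E * (((κ * ‖d‖) ^ k / ‖q‖ ^ (k * (m + 1))) / ‖q‖ ^ (∑ i ∈ Finset.range k, i))) *
          (E ^ 2 * ((κ * ‖d‖) ^ (m + 1) / ‖q‖ ^ (∑ i ∈ Finset.range (m + 1), i))) := by
            refine mul_le_mul (e1.trans ?_) (e2.trans ?_) (norm_nonneg _) (by positivity)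
            · gcongr
            · gcongr
      _ = _ := by
        rw [hsum, add_assoc k m 1, pow_add (κ * ‖d‖) k (m + 1), pow_add ‖q‖, pow_add ‖q‖]
        field_simp

end Bounds

end Rahman

namespace Rahman

open Filter Topology

section Bounds

variable {q : ℂ}

/-- Only z - 1/z changes, by a sign, under λ → 1/λ, x → -x. Decay for negative `x` thus follows from
decay for nonnegative `x` at 1/λ. -/
lemma shiftedTerm_inv (q s t : ℂ) (c : Fin 4 → ℂ) (k : ℕ) (lam : ℂ) (x : ℤ) :
    shiftedTerm q s t c k lam⁻¹ x = -shiftedTerm q s t c k lam (-x) := by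
  have h : lam⁻¹ * q ^ x = (lam * q ^ (-x))⁻¹ := by rw [mul_inv, zpow_neg, inv_inv]
  have e : lam⁻¹ ^ (6 * x) = lam ^ (6 * -x) := by rw [inv_zpow', mul_neg]
  simp only [shiftedTerm, h, inv_inv, e, neg_sq]
  have : ∀ j, qPochInf q (q * (lam * q ^ (-x))⁻¹ / c j) * qPochInf q (q * (lam * q ^ (-x)) / c j) =
    qPochInf q (q * (lam * q ^ (-x)) / c j) * qPochInf q (q * (lam * q ^ (-x))⁻¹ / c j) :=
    fun j => mul_comm _ _
  simp only [this]
  ring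

lemma norm_pairFactor_le (hq1 : ‖q‖ < 1) {s t z : ℂ} {B : ℝ} (hs : ‖s‖ ≤ B) (hs' : ‖s⁻¹‖ ≤ B)
    (ht' : ‖t⁻¹‖ ≤ B) (hz : ‖z‖ ≤ B) (k : ℕ) :
    ‖pairFactor q s t k z‖ ≤ Real.exp (B ^ 2 / (1 - ‖q‖)) ^ 3 := by
  have h1 : 0 < 1 - ‖q‖ := by linarith
  have hB : 0 ≤ B := (norm_nonneg _).trans hs
  have hQ := norm_nonneg q
  have e : ∀ {u : ℂ}, ‖u‖ ≤ B ^ 2 →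
      Real.exp (‖u‖ / (1 - ‖q‖)) ≤ Real.exp (B ^ 2 / (1 - ‖q‖)) := fun h => by gcongr
  have hcube : ∀ E : ℝ, E ^ 3 = E * E * E := fun E => by ring
  rw [pairFactor, norm_mul, norm_mul, hcube]
  gcongr
  · refine (norm_prod_one_sub_le hq1 _ _).trans (e ?_)
    rw [norm_mul, sq]; gcongr
  · refine (norm_qPochInf_le hq1 _).trans (e ?_)
    rw [div_eq_mul_inv, norm_mul, norm_mul, sq]
    calc ‖q‖ * ‖z‖ * ‖s⁻¹‖ ≤ 1 * B * B := by gcongr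
      _ = B * B := by ring
  · refine (norm_qPochInf_le hq1 _).trans (e ?_)
    rw [div_eq_mul_inv, norm_mul, norm_mul, norm_pow, sq]
    calc ‖q‖ ^ (k + 1) * ‖z‖ * ‖t⁻¹‖ ≤ 1 * B * B := by
          gcongr; exact pow_le_one₀ hQ hq1.le
      _ = B * B := by ring

/-- The decay of the terms of the bilateral series, uniform in the shift `k`. -/
lemma exists_norm_shiftedTerm_nat_le (hq0 : q ≠ 0) (hq1 : ‖q‖ < 1) (B : ℝ) :
    ∃ M : ℝ, 0 ≤ M ∧ ∀ (s t : ℂ) (c : Fin 4 → ℂ) (lam : ℂ) (κ : ℝ) (k : ℕ),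
      s * t * ∏ j, c j = q → lam ≠ 0 → ‖lam‖ ≤ B → ‖lam⁻¹‖ ≤ B → ‖s‖ ≤ B → ‖s⁻¹‖ ≤ B → ‖t‖ ≤ B →
      ‖t⁻¹‖ ≤ B → (∀ j, ‖c j‖ ≤ B) → (∀ j, ‖(c j)⁻¹‖ ≤ B) → 1 ≤ κ →
      (k = 0 ∨ ‖s * t‖ ≤ κ * ‖q‖) →
      ∀ n : ℕ, ‖shiftedTerm q s t c k lam n‖ ≤ M * (κ * ‖q‖) ^ n := by
  have hQ : 0 < ‖q‖ := norm_pos_iff.2 hq0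
  have h1 : 0 < 1 - ‖q‖ := by linarith
  set E := Real.exp (B ^ 2 / (1 - ‖q‖)) with hE
  refine ⟨(2 * |B|) * ((E * E ^ 2) ^ 4 * (E ^ 3 * (E ^ 2 * E ^ 3))), by positivity, ?_⟩
  intro s t c lam κ k hprod hlam hl hl' hs hs' ht ht' hc hc' hκ hk n
  have hB : 0 ≤ B := (norm_nonneg _).trans hs
  rw [abs_of_nonneg hB]
  have hst : s * t ≠ 0 := fun h => hq0 (by rw [← hprod, h, zero_mul])
  have hs0 : s ≠ 0 := left_ne_zero_of_mul hst
  have ht0 : t ≠ 0 := right_ne_zero_of_mul hst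
  have hc0 : ∀ j, c j ≠ 0 := fun j h => hq0 (by
    rw [← hprod, Finset.prod_eq_zero (Finset.mem_univ j) h, mul_zero])
  have hle : ∀ {u v : ℂ}, ‖u‖ ≤ B → ‖v‖ ≤ B → ‖u * v‖ ≤ B ^ 2 := fun hu hv => by
    rw [norm_mul, sq]; gcongr
  set w := ‖q‖ ^ (∑ i ∈ Finset.range n, i) with hw
  have hw0 : 0 < w := by positivity
  have hqn : q ^ n ≠ 0 := pow_ne_zero _ hq0
  have hz : lam * q ^ (n : ℤ) = lam * q ^ n := by rw [zpow_natCast]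
  have hzB : ‖lam * q ^ n‖ ≤ B := by
    rw [norm_mul, norm_pow]
    have := pow_le_one₀ (n := n) hQ.le hq1.le
    nlinarith [norm_nonneg lam]
  -- the first factor
  have f1 : ‖lam * q ^ n - (lam * q ^ n)⁻¹‖ ≤ 2 * B / ‖q‖ ^ n := by
    refine (norm_sub_le _ _).trans ?_
    have hi : ‖(lam * q ^ n)⁻¹‖ ≤ B / ‖q‖ ^ n := by
      rw [mul_inv, norm_mul, norm_inv (q ^ n), norm_pow, ← div_eq_mul_inv]; gcongr
    have : B ≤ B / ‖q‖ ^ n := by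
      rw [le_div_iff₀ (by positivity)]
      have := pow_le_one₀ (n := n) hQ.le hq1.le
      nlinarith
    calc _ ≤ B / ‖q‖ ^ n + B / ‖q‖ ^ n := by gcongr; exact hzB.trans this
      _ = _ := by ring
  have g1 : ∀ {b : ℂ}, ‖b⁻¹‖ ≤ B → ‖qPochInf q (q * (lam * q ^ n) / b)‖ ≤ E := by
    intro b hb
    refine (norm_qPochInf_le hq1 _).trans ?_
    rw [hE]
    gcongr
    rw [div_eq_mul_inv, norm_mul, norm_mul, sq]
    calc ‖q‖ * ‖lam * q ^ n‖ * ‖b⁻¹‖ ≤ 1 * B * B := by gcongr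
      _ = _ := by ring
  have g2 : ∀ {b : ℂ}, b ≠ 0 → ‖b‖ ≤ B → ‖b⁻¹‖ ≤ B →
      ‖qPochInf q (q * (lam * q ^ n)⁻¹ / b)‖ ≤ E ^ 2 * (‖(lam * b)⁻¹‖ ^ n / w) := by
    intro b hb0 hb hb'
    have e : q * (lam * q ^ n)⁻¹ / b = (lam * b)⁻¹ * q * (q ^ n)⁻¹ := by field_simp
    rw [e]
    refine norm_qPochInf_mul_inv_pow_le hq0 hq1 (inv_ne_zero (mul_ne_zero hlam hb0)) ?_ ?_ n
    · rw [mul_inv]; exact hle hl' hb'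
    · rw [inv_inv]; exact hle hl hb
  -- the factors of the four fixed parameters
  have f2 : ‖∏ j, (qPochInf q (q * (lam * q ^ n) / c j) * qPochInf q (q * (lam * q ^ n)⁻¹ / c j))‖ ≤
      (E * E ^ 2) ^ 4 * ((‖∏ j, (lam * c j)⁻¹‖) ^ n / w ^ 4) := by
    rw [norm_prod]
    calc _ ≤ ∏ j, (E * (E ^ 2 * (‖(lam * c j)⁻¹‖ ^ n / w))) := by
          refine Finset.prod_le_prod (fun _ _ => norm_nonneg _) fun j _ => ?_
          rw [norm_mul]
          gcongr
          · exact g1 (hc' j)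
          · exact g2 (hc0 j) (hc j) (hc' j)
      _ = _ := by
        rw [norm_prod, ← Finset.prod_pow]
        simp only [← mul_assoc, Finset.prod_mul_distrib, Finset.prod_div_distrib, Finset.prod_const,
          Finset.card_univ, Fintype.card_fin]
        ring
  have f3 := norm_pairFactor_le hq1 hs hs' ht' hzB k
  have f4 : ‖pairFactor q s t k (lam * q ^ n)⁻¹‖ ≤
      (E ^ 2 * (‖(lam * s)⁻¹‖ ^ n / w)) * (E ^ 3 * ((κ * ‖(lam * t)⁻¹‖) ^ n / w)) := by
    have e1 : ∀ i, s * (lam * q ^ n)⁻¹ * q ^ i = s * lam⁻¹ * (q ^ n)⁻¹ * q ^ i := fun i => by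
      rw [mul_inv, ← mul_assoc]
    have e2 : q ^ (k + 1) * (lam * q ^ n)⁻¹ / t = q ^ (k + 1) * ((lam * t)⁻¹ * (q ^ n)⁻¹) := by
      rw [mul_inv, mul_inv, div_eq_mul_inv]; ring
    have h := norm_prod_mul_qPochInf_le hq0 hq1 (a := s * lam⁻¹) (d := (lam * t)⁻¹) (B := B ^ 2)
      (mul_ne_zero hs0 (inv_ne_zero hlam)) (inv_ne_zero (mul_ne_zero hlam ht0)) (hle hs hl')
      (by rw [mul_inv, inv_inv]; exact hle hs' hl) (by rw [mul_inv]; exact hle hl' ht')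
      (by rw [inv_inv]; exact hle hl ht) hκ (k := k) (hk.imp_right fun hk => by
        have : ‖s * lam⁻¹‖ = ‖s * t‖ * ‖(lam * t)⁻¹‖ := by
          rw [← norm_mul]; congr 1; field_simp
        rw [this, ← mul_assoc]; gcongr) n
    have g := g2 hs0 hs hs'
    simp only [pairFactor, e1, e2]
    rw [mul_right_comm, mul_comm, norm_mul]
    gcongr
  have hz3 : lam ^ (6 * (n : ℤ)) * q ^ (3 * (n : ℤ) ^ 2) = (lam ^ 6) ^ n * q ^ (3 * n ^ 2) := by
    rw [zpow_mul]; norm_cast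
  rw [shiftedTerm, hz, hz3, norm_mul, norm_mul, norm_mul, norm_mul, norm_mul, norm_pow (lam ^ 6),
    norm_pow q (3 * n ^ 2)]
  calc _ ≤ (‖lam ^ 6‖ ^ n * ‖q‖ ^ (3 * n ^ 2) * (2 * B / ‖q‖ ^ n)) *
        (((E * E ^ 2) ^ 4 * ((‖∏ j, (lam * c j)⁻¹‖) ^ n / w ^ 4)) * (E ^ 3 *
          ((E ^ 2 * (‖(lam * s)⁻¹‖ ^ n / w)) * (E ^ 3 * ((κ * ‖(lam * t)⁻¹‖) ^ n / w))))) := by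
        gcongr
    _ = (2 * B) * ((E * E ^ 2) ^ 4 * (E ^ 3 * (E ^ 2 * E ^ 3))) *
        ((‖lam ^ 6‖ * ‖∏ j, (lam * c j)⁻¹‖ * ‖(lam * s)⁻¹‖ * ‖(lam * t)⁻¹‖ * κ) ^ n *
          (‖q‖ ^ (3 * n ^ 2) / (w ^ 6 * ‖q‖ ^ n))) := by
        generalize ‖lam ^ 6‖ = x1, ‖∏ j, (lam * c j)⁻¹‖ = x2, ‖(lam * s)⁻¹‖ = x3, ‖(lam * t)⁻¹‖ = x4
        rw [mul_pow κ x4, mul_pow _ κ, mul_pow _ x4, mul_pow _ x3, mul_pow _ x2]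
        field_simp
    _ = _ := by
      congr 1
      -- The balancing condition makes the linear exponentials collapse to |q|^{-n}, while the six
      -- triangular exponents and the factor |q|^{-n} leave |q|^{2n} of |q|^{3n²}. The net decay is
      -- (κ|q|)^n.
      have a1 : ‖lam ^ 6‖ * ‖∏ j, (lam * c j)⁻¹‖ * ‖(lam * s)⁻¹‖ * ‖(lam * t)⁻¹‖ = ‖q‖⁻¹ := by
        rw [← norm_mul, ← norm_mul, ← norm_mul, ← norm_inv, ← hprod]
        congr 1
        have : ∏ j, (lam * c j)⁻¹ = (lam ^ 4)⁻¹ * (∏ j, c j)⁻¹ := by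
          simp [Finset.prod_mul_distrib, Finset.prod_inv_distrib, mul_comm]
        have hp0 : ∏ j, c j ≠ 0 := Finset.prod_ne_zero_iff.2 fun j _ => hc0 j
        rw [this]
        field_simp
      have a2 : w ^ 6 * ‖q‖ ^ n * ‖q‖ ^ (2 * n) = ‖q‖ ^ (3 * n ^ 2) := by
        rw [hw, ← pow_mul, ← pow_add, ← pow_add]
        congr 1
        have := Finset.sum_range_id_mul_two n
        rcases n with _ | n
        · simp
        · simp only [Nat.add_sub_cancel] at this
          nlinarith
      have a3 : ‖q‖ ^ (3 * n ^ 2) / (w ^ 6 * ‖q‖ ^ n) = ‖q‖ ^ (2 * n) := by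
        rw [← a2]; field_simp
      rw [a1, a3, mul_pow, mul_pow, inv_pow, two_mul, pow_add]
      field_simp

lemma exists_norm_shiftedTerm_le (hq0 : q ≠ 0) (hq1 : ‖q‖ < 1) (B : ℝ) :
    ∃ M : ℝ, 0 ≤ M ∧ ∀ (s t : ℂ) (c : Fin 4 → ℂ) (lam : ℂ) (κ : ℝ) (k : ℕ),
      s * t * ∏ j, c j = q → lam ≠ 0 → ‖lam‖ ≤ B → ‖lam⁻¹‖ ≤ B → ‖s‖ ≤ B → ‖s⁻¹‖ ≤ B → ‖t‖ ≤ B →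
      ‖t⁻¹‖ ≤ B → (∀ j, ‖c j‖ ≤ B) → (∀ j, ‖(c j)⁻¹‖ ≤ B) → 1 ≤ κ →
      (k = 0 ∨ ‖s * t‖ ≤ κ * ‖q‖) →
      ∀ x : ℤ, ‖shiftedTerm q s t c k lam x‖ ≤ M * (κ * ‖q‖) ^ x.natAbs := by
  obtain ⟨M, hM0, hM⟩ := exists_norm_shiftedTerm_nat_le hq0 hq1 B
  refine ⟨M, hM0, fun s t c lam κ k hprod hlam hl hl' hs hs' ht ht' hc hc' hκ hk x => ?_⟩
  obtain ⟨n, rfl | rfl⟩ := x.eq_nat_or_neg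
  · simpa using hM s t c lam κ k hprod hlam hl hl' hs hs' ht ht' hc hc' hκ hk n
  · have h := hM s t c lam⁻¹ κ k hprod (inv_ne_zero hlam) hl' (by rwa [inv_inv]) hs hs' ht ht' hc hc'
      hκ hk n
    rw [shiftedTerm_inv, norm_neg] at h
    simpa using h

lemma summable_pow_natAbs {r : ℝ} (h0 : 0 ≤ r) (h1 : r < 1) :
    Summable fun x : ℤ => r ^ x.natAbs := by
  have := summable_geometric_of_lt_one h0 h1
  exact Summable.of_nat_of_neg (by simpa using this) (by simpa using this)

/-- For k = 0 the pair factor is an ordinary product, so the uniform estimate with κ = 1 covers the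
series itself. -/
lemma latticeTerm_eq_shiftedTerm (q : ℂ) (b : Fin 6 → ℂ) (lam : ℂ) (x : ℤ) :
    latticeTerm q b lam x = shiftedTerm q (b 0) (b 1) (fun j => b j.succ.succ) 0 lam x := by
  simp only [latticeTerm, oddKernel, shiftedTerm, pairFactor, Fin.prod_univ_succ (n := 5),
    Fin.prod_univ_succ (n := 4), Finset.range_zero, Finset.prod_empty, zero_add, pow_one,
    Fin.succ_zero_eq_one]
  ring

lemma exists_norm_latticeTerm_le (hq0 : q ≠ 0) (hq1 : ‖q‖ < 1) (B : ℝ) :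
    ∃ M : ℝ, ∀ (b : Fin 6 → ℂ) (lam : ℂ), ∏ j, b j = q → lam ≠ 0 → ‖lam‖ ≤ B → ‖lam⁻¹‖ ≤ B →
      (∀ j, ‖b j‖ ≤ B) → (∀ j, ‖(b j)⁻¹‖ ≤ B) →
      ∀ x : ℤ, ‖latticeTerm q b lam x‖ ≤ M * ‖q‖ ^ x.natAbs := by
  obtain ⟨M, -, hM⟩ := exists_norm_shiftedTerm_le hq0 hq1 B
  refine ⟨M, fun b lam hb hlam hl hl' hb1 hb2 x => ?_⟩
  rw [latticeTerm_eq_shiftedTerm]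
  simpa using hM (b 0) (b 1) (fun j => b j.succ.succ) lam 1 0
    (by rw [← hb, Fin.prod_univ_succ (n := 5), Fin.prod_univ_succ (n := 4), mul_assoc]; rfl)
    hlam hl hl' (hb1 _) (hb2 _) (hb1 _) (hb2 _) (fun _ => hb1 _) (fun _ => hb2 _) le_rfl (Or.inl rfl) x

lemma summable_latticeTerm (hq0 : q ≠ 0) (hq1 : ‖q‖ < 1) {b : Fin 6 → ℂ} (hb : ∏ j, b j = q)
    {lam : ℂ} (hlam : lam ≠ 0) : Summable fun x : ℤ => ‖latticeTerm q b lam x‖ := by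
  obtain ⟨M, hM⟩ := exists_norm_latticeTerm_le hq0 hq1
    (‖lam‖ + ‖lam⁻¹‖ + ∑ j, (‖b j‖ + ‖(b j)⁻¹‖))
  have hj : ∀ j, ‖b j‖ + ‖(b j)⁻¹‖ ≤ ∑ j, (‖b j‖ + ‖(b j)⁻¹‖) := fun j =>
    Finset.single_le_sum (f := fun j => ‖b j‖ + ‖(b j)⁻¹‖) (fun _ _ => by positivity)
      (Finset.mem_univ j)
  have hs := hj 0
  refine ((summable_pow_natAbs (norm_nonneg q) hq1).mul_left M).of_nonneg_of_le
    (fun _ => norm_nonneg _) (hM b lam hb hlam ?_ ?_ (fun j => ?_) (fun j => ?_))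
  all_goals first
    | linarith [norm_nonneg lam, norm_nonneg lam⁻¹, norm_nonneg (b 0), norm_nonneg (b 0)⁻¹]
    | linarith [norm_nonneg lam, norm_nonneg lam⁻¹, hj j, norm_nonneg (b j), norm_nonneg (b j)⁻¹]

lemma differentiableAt_oddKernel (hq1 : ‖q‖ < 1) {b : Fin 6 → ℂ → ℂ} {φ : ℂ → ℂ} {w : ℂ}
    (hb : ∀ j, DifferentiableAt ℂ (b j) w) (hb0 : ∀ j, b j w ≠ 0)
    (hφ : DifferentiableAt ℂ φ w) (hφ0 : φ w ≠ 0) :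
    DifferentiableAt ℂ (fun v => oddKernel q (fun j => b j v) (φ v)) w := by
  have hP := differentiable_qPochInf hq1
  unfold oddKernel
  refine (hφ.sub (hφ.inv hφ0)).mul (DifferentiableAt.fun_finsetProd fun j _ => ?_)
  refine DifferentiableAt.mul ?_ ?_
  · exact (hP _).comp w ((hφ.const_mul q).div (hb j) (hb0 j))
  · exact (hP _).comp w (((hφ.inv hφ0).const_mul q).div (hb j) (hb0 j))

/-- The normalized bilateral series is holomorphic in all its parameters. -/
lemma differentiableOn_latticeSum (hq0 : q ≠ 0) (hq1 : ‖q‖ < 1) {b : Fin 6 → ℂ → ℂ} {φ : ℂ → ℂ}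
    {U : Set ℂ} (hU : IsOpen U) (hb : ∀ j, DifferentiableOn ℂ (b j) U)
    (hφ : DifferentiableOn ℂ φ U) (hφ0 : ∀ w ∈ U, φ w ≠ 0) (hprod : ∀ w ∈ U, ∏ j, b j w = q) :
    DifferentiableOn ℂ (fun w => latticeSum q (fun j => b j w) (φ w)) U := by
  have hb0 : ∀ w ∈ U, ∀ j, b j w ≠ 0 := fun w hw j h => hq0 (by
    rw [← hprod w hw, Finset.prod_eq_zero (Finset.mem_univ j) h])
  intro w₀ hw₀
  refine DifferentiableAt.differentiableWithinAt ?_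
  -- A single constant dominates all parameters and their inverses near `w₀`; the summand 1 makes
  -- the inequalities strict at `w₀`. The equation for `B` is only an abbreviation, removed by
  -- `forall_eq`.
  have hbd : ∀ᶠ w in 𝓝 w₀, ∀ B, B = (∑ j, (‖b j w₀‖ + ‖(b j w₀)⁻¹‖) + ‖φ w₀‖ + ‖(φ w₀)⁻¹‖ + 1) →
      w ∈ U ∧ ‖φ w‖ < B ∧ ‖(φ w)⁻¹‖ < B ∧ (∀ j, ‖b j w‖ < B) ∧ ∀ j, ‖(b j w)⁻¹‖ < B := by
    have hj : ∀ j, ‖b j w₀‖ + ‖(b j w₀)⁻¹‖ ≤ ∑ j, (‖b j w₀‖ + ‖(b j w₀)⁻¹‖) := fun j =>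
      Finset.single_le_sum (f := fun j => ‖b j w₀‖ + ‖(b j w₀)⁻¹‖) (fun _ _ => by positivity)
        (Finset.mem_univ j)
    have hs := hj 0
    have hc1 := (hφ.differentiableAt (hU.mem_nhds hw₀)).continuousAt
    have hc3 : ContinuousAt (fun w => ‖(φ w)⁻¹‖) w₀ := (hc1.inv₀ (hφ0 _ hw₀)).norm
    have hc2 := fun j => ((hb j).differentiableAt (hU.mem_nhds hw₀)).continuousAt
    have hc4 : ∀ j, ContinuousAt (fun w => ‖(b j w)⁻¹‖) w₀ := fun j =>
      ((hc2 j).inv₀ (hb0 _ hw₀ j)).norm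
    simp only [forall_eq]
    refine (hU.eventually_mem hw₀).and (Eventually.and ?_ (Eventually.and ?_ (Eventually.and ?_ ?_)))
    · refine hc1.norm.eventually_lt_const ?_
      linarith [norm_nonneg (φ w₀)⁻¹, norm_nonneg (b 0 w₀), norm_nonneg (b 0 w₀)⁻¹]
    · refine hc3.eventually_lt_const ?_
      linarith [norm_nonneg (φ w₀), norm_nonneg (b 0 w₀), norm_nonneg (b 0 w₀)⁻¹]
    · refine eventually_all.2 fun j => (hc2 j).norm.eventually_lt_const ?_
      linarith [norm_nonneg (φ w₀), norm_nonneg (φ w₀)⁻¹, hj j, norm_nonneg (b j w₀)⁻¹]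
    · refine eventually_all.2 fun j => (hc4 j).eventually_lt_const ?_
      linarith [norm_nonneg (φ w₀), norm_nonneg (φ w₀)⁻¹, hj j, norm_nonneg (b j w₀)]
  simp only [forall_eq] at hbd
  obtain ⟨V, hV, hVo, hwV⟩ := eventually_nhds_iff.1 hbd
  obtain ⟨M, hM⟩ := exists_norm_latticeTerm_le hq0 hq1
    (∑ j, (‖b j w₀‖ + ‖(b j w₀)⁻¹‖) + ‖φ w₀‖ + ‖(φ w₀)⁻¹‖ + 1)
  have key := Complex.differentiableOn_tsum_of_summable_norm
    (F := fun (x : ℤ) w => latticeTerm q (fun j => b j w) (φ w) x)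
    ((summable_pow_natAbs (norm_nonneg q) hq1).mul_left M) (U := V) (fun x => ?_) hVo
    (fun x w hw => ?_)
  · exact key.differentiableAt (hVo.mem_nhds hwV)
  · intro w hw
    have hwU := (hV w hw).1
    have h1 := hφ.differentiableAt (hU.mem_nhds hwU)
    have h2 := fun j => (hb j).differentiableAt (hU.mem_nhds hwU)
    refine DifferentiableAt.differentiableWithinAt ?_
    refine DifferentiableAt.mul (DifferentiableAt.mul_const ?_ _) ?_
    · exact (differentiableAt_zpow.2 (Or.inl (hφ0 w hwU))).comp w h1
    · exact differentiableAt_oddKernel hq1 h2 (hb0 w hwU) (h1.mul_const _)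
        (mul_ne_zero (hφ0 w hwU) (zpow_ne_zero _ hq0))
  · obtain ⟨h0, h1, h2, h3, h4⟩ := hV w hw
    exact hM _ _ (hprod w h0) (hφ0 w h0) h1.le h2.le (fun j => (h3 j).le) (fun j => (h4 j).le) x

end Bounds

end Rahman

namespace Rahman

open Filter Topology

/-! ### Odd theta functions of degree six. -/

section Definitions

/-- The theta product `μ⁻² ∏ θ(μ b_j)`. -/
noncomputable def thetaHalf (q : ℂ) (b : Fin 6 → ℂ) (mu : ℂ) : ℂ :=
  (mu ^ 2)⁻¹ * ∏ j, theta q (mu * b j)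

/-- The odd part of the theta product `μ⁻² ∏ θ(μ b_j)`. -/
noncomputable def thetaDiff (q : ℂ) (b : Fin 6 → ℂ) (mu : ℂ) : ℂ :=
  thetaHalf q b mu - thetaHalf q b mu⁻¹

/-- The antisymmetric theta function with zeros at `λ², μ², λμ, μ/λ ∈ q^ℤ`. -/
noncomputable def thetaCross (q lam mu : ℂ) : ℂ :=
  (lam * mu ^ 2)⁻¹ *
    (theta q (lam ^ 2) * theta q (mu ^ 2) * theta q (lam * mu) * theta q (mu / lam))

/-- The odd theta functions of degree `6`. -/
structure IsOddTheta (q : ℂ) (F : ℂ → ℂ) : Prop where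
  differentiableAt : ∀ z, z ≠ 0 → DifferentiableAt ℂ F z
  mul_q : ∀ z, z ≠ 0 → F (z * q) = (q ^ 3)⁻¹ * z ^ (-6 : ℤ) * F z
  inv : ∀ z, z ≠ 0 → F z⁻¹ = -F z

end Definitions

section OddTheta

variable {q : ℂ}

lemma IsOddTheta.mul_zpow {F : ℂ → ℂ} (hF : IsOddTheta q F) (hq0 : q ≠ 0) {z : ℂ} (hz : z ≠ 0)
    (n : ℤ) : F (z * q ^ n) = q ^ (-(3 * n ^ 2)) * z ^ (-(6 * n)) * F z := by
  rw [quasiperiodic_iterate hq0 (inv_ne_zero (pow_ne_zero 3 hq0)) (m := 6) hF.mul_q hz n]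
  have h := two_mul_choose_two n
  have e : (q ^ 3)⁻¹ ^ n * q ^ (-(6 * (n * (n - 1) / 2))) = q ^ (-(3 * n ^ 2)) := by
    have : (q ^ 3)⁻¹ ^ n = q ^ (-(3 * n)) := by
      rw [inv_zpow, ← zpow_natCast, ← zpow_mul, zpow_neg]; rfl
    rw [this, ← zpow_add₀ hq0]
    congr 1
    nlinarith
  rw [← e]; ring

lemma IsOddTheta.eq_zero_of_mul_eq {F : ℂ → ℂ} (hF : IsOddTheta q F) (hq0 : q ≠ 0) {z w : ℂ}
    (hz : z ≠ 0) (hw : w ≠ 0) (hFw : F w = 0) {n : ℤ} (h : z * w = q ^ n) : F z = 0 := by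
  have e : z = w⁻¹ * q ^ n := by rw [← h]; field_simp
  rw [e, hF.mul_zpow hq0 (inv_ne_zero hw), hF.inv w hw, hFw]
  simp

/-- Here z = z⁻¹ q^n, and the multiplier of this translation at z⁻¹ equals 1, so oddness gives F(z)
= -F(z). These are the four zero classes ±1, ±√q shared by all odd theta functions of this degree.
-/
lemma IsOddTheta.eq_zero_of_sq_eq {F : ℂ → ℂ} (hF : IsOddTheta q F) (hq0 : q ≠ 0) {z : ℂ}
    (hz : z ≠ 0) {n : ℤ} (h : z ^ 2 = q ^ n) : F z = 0 := by
  have e : z = z⁻¹ * q ^ n := by rw [← h]; field_simp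
  have h1 := hF.mul_zpow hq0 (inv_ne_zero hz) n
  rw [← e, hF.inv z hz] at h1
  have h2 : q ^ (-(3 * n ^ 2)) * z⁻¹ ^ (-(6 * n)) = 1 := by
    have : z⁻¹ ^ (-(6 * n)) = q ^ (3 * n ^ 2) := by
      rw [inv_zpow', neg_neg, show (6 * n) = ((2 : ℕ) : ℤ) * (3 * n) by push_cast; ring, zpow_mul,
        zpow_natCast, h, ← zpow_mul]
      congr 1; ring
    rw [this, ← zpow_add₀ hq0]; simp
  rw [h2, one_mul] at h1
  exact self_eq_neg.1 h1

lemma IsOddTheta.const_mul_sub {F G : ℂ → ℂ} (hF : IsOddTheta q F) (hG : IsOddTheta q G)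
    (a c : ℂ) : IsOddTheta q (fun z => F z * a - c * G z) where
  differentiableAt z hz := ((hF.differentiableAt z hz).mul_const a).sub
    ((hG.differentiableAt z hz).const_mul c)
  mul_q z hz := by rw [hF.mul_q z hz, hG.mul_q z hz]; ring
  inv z hz := by rw [hF.inv z hz, hG.inv z hz]; ring

lemma thetaCross_mul_q (hq0 : q ≠ 0) (hq1 : ‖q‖ < 1) {mu : ℂ} (hmu : mu ≠ 0) {z : ℂ} (hz : z ≠ 0) :
    thetaCross q (z * q) mu = (q ^ 3)⁻¹ * z ^ (-6 : ℤ) * thetaCross q z mu := by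
  have h1 : theta q ((z * q) ^ 2) = (z ^ 4 * q)⁻¹ * theta q (z ^ 2) := by
    have hz2 : z ^ 2 ≠ 0 := pow_ne_zero _ hz
    rw [show (z * q) ^ 2 = z ^ 2 * q * q by ring, theta_mul_q hq0 hq1 (mul_ne_zero hz2 hq0),
      theta_mul_q hq0 hq1 hz2]
    field_simp
  have h2 : theta q (z * q * mu) = -(z * mu)⁻¹ * theta q (z * mu) := by
    rw [show z * q * mu = z * mu * q by ring, theta_mul_q hq0 hq1 (mul_ne_zero hz hmu)]
  have h3 : theta q (mu / (z * q)) = -(mu / (z * q)) * theta q (mu / z) := by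
    have hne : mu / (z * q) ≠ 0 := div_ne_zero hmu (mul_ne_zero hz hq0)
    have := theta_mul_q hq0 hq1 hne
    rw [show mu / (z * q) * q = mu / z by field_simp] at this
    rw [this]; field_simp
  rw [thetaCross, thetaCross, h1, h2, h3, show (-6 : ℤ) = -((6 : ℕ) : ℤ) by rfl, zpow_neg,
    zpow_natCast]
  field_simp

lemma thetaCross_swap (hq1 : ‖q‖ < 1) {lam mu : ℂ} (hlam : lam ≠ 0) (hmu : mu ≠ 0) :
    thetaCross q mu lam = -thetaCross q lam mu := by
  have h := theta_inv hq1 (div_ne_zero hmu hlam)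
  rw [inv_div] at h
  rw [thetaCross, thetaCross, h, mul_comm mu lam]
  field_simp

lemma thetaCross_ne_zero (hq0 : q ≠ 0) (hq1 : ‖q‖ < 1) {lam mu : ℂ} (hlam : lam ≠ 0) (hmu : mu ≠ 0)
    (h1 : ∀ n : ℤ, lam ^ 2 ≠ q ^ n) (h2 : ∀ n : ℤ, mu ^ 2 ≠ q ^ n) (h3 : ∀ n : ℤ, lam * mu ≠ q ^ n)
    (h4 : ∀ n : ℤ, mu / lam ≠ q ^ n) : thetaCross q lam mu ≠ 0 := by
  refine mul_ne_zero (inv_ne_zero (mul_ne_zero hlam (pow_ne_zero _ hmu))) (mul_ne_zero (mul_ne_zero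
    (mul_ne_zero ?_ ?_) ?_) ?_)
  · exact theta_ne_zero hq0 hq1 (pow_ne_zero _ hlam) h1
  · exact theta_ne_zero hq0 hq1 (pow_ne_zero _ hmu) h2
  · exact theta_ne_zero hq0 hq1 (mul_ne_zero hlam hmu) h3
  · exact theta_ne_zero hq0 hq1 (div_ne_zero hmu hlam) h4

lemma eq_of_thetaCross_eq_zero (hq0 : q ≠ 0) (hq1 : ‖q‖ < 1) {lam mu : ℂ} (hlam : lam ≠ 0)
    (hmu : mu ≠ 0) (h2 : ∀ n : ℤ, mu ^ 2 ≠ q ^ n) (h : thetaCross q lam mu = 0) :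
    ∃ n : ℤ, lam ^ 2 = q ^ n ∨ lam * mu = q ^ n ∨ mu / lam = q ^ n := by
  by_contra! hn
  exact thetaCross_ne_zero hq0 hq1 hlam hmu (fun n => (hn n).1) h2 (fun n => (hn n).2.1)
    (fun n => (hn n).2.2) h

/-- The moduli of the zeros of `thetaCross q · μ`. -/
def crossNorms (q mu : ℂ) : Set ℝ :=
  Set.range (fun n : ℤ => √(‖q‖ ^ n)) ∪ (Set.range (fun n : ℤ => ‖q‖ ^ n / ‖mu‖) ∪
    Set.range (fun n : ℤ => ‖mu‖ / ‖q‖ ^ n))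

lemma countable_crossNorms (q mu : ℂ) : (crossNorms q mu).Countable :=
  (Set.countable_range _).union ((Set.countable_range _).union (Set.countable_range _))

lemma norm_mem_crossNorms {lam mu : ℂ} (hlam : lam ≠ 0) (hmu : mu ≠ 0)
    {n : ℤ} (h : lam ^ 2 = q ^ n ∨ lam * mu = q ^ n ∨ mu / lam = q ^ n) :
    ‖lam‖ ∈ crossNorms q mu := by
  have hl : 0 < ‖lam‖ := norm_pos_iff.2 hlam
  have hm : 0 < ‖mu‖ := norm_pos_iff.2 hmu
  rcases h with h | h | h
  · refine Or.inl ⟨n, ?_⟩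
    simp only
    rw [← norm_zpow, ← h, norm_pow, Real.sqrt_sq hl.le]
  · refine Or.inr (Or.inl ⟨n, ?_⟩)
    simp only
    rw [← norm_zpow, ← h, norm_mul]; field_simp
  · refine Or.inr (Or.inr ⟨n, ?_⟩)
    simp only
    rw [← norm_zpow, ← h, norm_div]; field_simp

/-- Two of the three theta factors vanishing together would force μ² ∈ q^ℤ. -/
lemma simpleZeros_thetaCross (hq0 : q ≠ 0) (hq1 : ‖q‖ < 1) {mu : ℂ} (hmu : mu ≠ 0)
    (h2 : ∀ n : ℤ, mu ^ 2 ≠ q ^ n) : SimpleZeros (fun z => thetaCross q z mu) := by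
  have hθ := simpleZeros_theta hq0 hq1
  have a1 : SimpleZeros (fun z => theta q (z ^ 2)) := hθ.comp (φ := fun z => z ^ 2) fun z hz =>
    ⟨pow_ne_zero _ hz, 2 * z, by simpa using hz, by simpa using hasDerivAt_pow 2 z⟩
  have a2 : SimpleZeros (fun z => theta q (z * mu)) := hθ.comp (φ := fun z => z * mu) fun z hz =>
    ⟨mul_ne_zero hz hmu, mu, hmu, by simpa using (hasDerivAt_id z).mul_const mu⟩
  have a3 : SimpleZeros (fun z => theta q (mu / z)) := hθ.comp (φ := fun z => mu / z) fun z hz =>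
    ⟨div_ne_zero hmu hz, _, div_ne_zero (neg_ne_zero.2 hmu) (pow_ne_zero 2 hz),
      hasDerivAt_const_div mu hz⟩
  have a4 : SimpleZeros (fun z : ℂ => z⁻¹) := fun z hz =>
    ⟨differentiableAt_inv hz, fun h => absurd h (inv_ne_zero hz)⟩
  have hc : (mu ^ 2)⁻¹ * theta q (mu ^ 2) ≠ 0 := mul_ne_zero (inv_ne_zero (pow_ne_zero _ hmu))
    (theta_ne_zero hq0 hq1 (pow_ne_zero _ hmu) h2)
  have key := (((a1.mul a2 ?_).mul a3 ?_).mul a4 ?_).const_mul hc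
  · refine fun z hz => ⟨(key z hz).1.congr_of_eventuallyEq ?_, fun h => ?_⟩
    · refine Eventually.of_forall fun w => ?_
      simp only [thetaCross, mul_inv]; ring
    · have e : (fun z => thetaCross q z mu) = fun z => (mu ^ 2)⁻¹ * theta q (mu ^ 2) *
          (theta q (z ^ 2) * theta q (z * mu) * theta q (mu / z) * z⁻¹) := by
        ext w; simp only [thetaCross, mul_inv]; ring
      rw [e]
      refine (key z hz).2 ?_
      rw [← h]
      simp only [thetaCross, mul_inv]; ring
  · intro z hz h h'
    obtain ⟨n, hn⟩ := (theta_eq_zero_iff hq0 hq1 (pow_ne_zero _ hz)).1 h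
    obtain ⟨m, hm⟩ := (theta_eq_zero_iff hq0 hq1 (mul_ne_zero hz hmu)).1 h'
    refine h2 (2 * m - n) ?_
    rw [zpow_sub₀ hq0, ← hn, mul_comm 2 m, zpow_mul, ← hm]
    norm_cast
    field_simp
  · intro z hz h h'
    obtain ⟨m, hm⟩ := (theta_eq_zero_iff hq0 hq1 (div_ne_zero hmu hz)).1 h'
    rcases mul_eq_zero.1 h with h | h
    · obtain ⟨n, hn⟩ := (theta_eq_zero_iff hq0 hq1 (pow_ne_zero _ hz)).1 h
      refine h2 (2 * m + n) ?_
      rw [zpow_add₀ hq0, ← hn, mul_comm 2 m, zpow_mul, ← hm]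
      norm_cast
      field_simp
    · obtain ⟨n, hn⟩ := (theta_eq_zero_iff hq0 hq1 (mul_ne_zero hz hmu)).1 h
      refine h2 (m + n) ?_
      rw [zpow_add₀ hq0, ← hn, ← hm]
      field_simp
  · intro z hz _ h'
    exact inv_ne_zero hz h'

/-- Odd theta functions of degree `6` with a prescribed zero form a one-dimensional space. -/
lemma IsOddTheta.exists_eq_mul_thetaCross {F : ℂ → ℂ} (hF : IsOddTheta q F) (hq0 : q ≠ 0)
    (hq1 : ‖q‖ < 1) {mu : ℂ} (hmu : mu ≠ 0) (h2 : ∀ n : ℤ, mu ^ 2 ≠ q ^ n) (hFmu : F mu = 0) :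
    ∃ c, ∀ z, z ≠ 0 → F z = c * thetaCross q z mu := by
  refine (simpleZeros_thetaCross hq0 hq1 hmu h2).exists_eq_const_mul (f := F)
    (m := fun z => (q ^ 3)⁻¹ * z ^ (-6 : ℤ)) hq0 hq1 hF.differentiableAt ?_ ?_ hF.mul_q
    (fun z hz => thetaCross_mul_q hq0 hq1 hmu hz) (countable_crossNorms q mu) ?_
  · intro z hz h
    obtain ⟨n, h | h | h⟩ := eq_of_thetaCross_eq_zero hq0 hq1 hz hmu h2 h
    · exact hF.eq_zero_of_sq_eq hq0 hz h
    · exact hF.eq_zero_of_mul_eq hq0 hz hmu hFmu h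
    · refine hF.eq_zero_of_mul_eq hq0 hz (inv_ne_zero hmu) ?_ (n := -n) ?_
      · rw [hF.inv mu hmu, hFmu, neg_zero]
      · rw [zpow_neg, ← h, inv_div, div_eq_mul_inv]
  · exact fun z hz => mul_ne_zero (inv_ne_zero (pow_ne_zero _ hq0)) (zpow_ne_zero _ hz)
  · intro z hz h
    obtain ⟨n, h⟩ := eq_of_thetaCross_eq_zero hq0 hq1 hz hmu h2 h
    exact norm_mem_crossNorms hz hmu h

lemma sq_avoids_of_notMem_crossNorms {lam mu : ℂ} (hlam : lam ≠ 0) (hmu : mu ≠ 0)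
    (h : ‖lam‖ ∉ crossNorms q mu) : (∀ n : ℤ, lam ^ 2 ≠ q ^ n) ∧ (∀ n : ℤ, lam * mu ≠ q ^ n) ∧
      ∀ n : ℤ, mu / lam ≠ q ^ n :=
  ⟨fun _ hn => h (norm_mem_crossNorms hlam hmu (Or.inl hn)),
    fun _ hn => h (norm_mem_crossNorms hlam hmu (Or.inr (Or.inl hn))),
    fun _ hn => h (norm_mem_crossNorms hlam hmu (Or.inr (Or.inr hn)))⟩

/-- The space of odd theta functions of degree `6` is two-dimensional. -/
lemma IsOddTheta.exists_casoratian {F G : ℂ → ℂ} (hF : IsOddTheta q F) (hG : IsOddTheta q G)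
    (hq0 : q ≠ 0) (hq1 : ‖q‖ < 1) :
    ∃ C, ∀ lam mu, lam ≠ 0 → mu ≠ 0 → (∀ n : ℤ, mu ^ 2 ≠ q ^ n) →
      F lam * G mu - F mu * G lam = C * thetaCross q lam mu := by
  -- For fixed μ the determinant is an odd theta function of λ with a zero at μ, so it is a multiple
  -- of `thetaCross`.
  have h1 : ∀ mu, mu ≠ 0 → (∀ n : ℤ, mu ^ 2 ≠ q ^ n) → ∃ c, ∀ lam, lam ≠ 0 →
      F lam * G mu - F mu * G lam = c * thetaCross q lam mu := fun mu hmu h2 =>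
    (hF.const_mul_sub hG (G mu) (F mu)).exists_eq_mul_thetaCross hq0 hq1 hmu h2 (by ring)
  choose! c hc using h1
  -- The determinant and `thetaCross` are both antisymmetric, so the factor found for μ equals the
  -- one found for λ.
  have hsymm : ∀ lam mu, lam ≠ 0 → mu ≠ 0 → (∀ n : ℤ, mu ^ 2 ≠ q ^ n) → ‖lam‖ ∉ crossNorms q mu →
      c mu = c lam := by
    intro lam mu hlam hmu h2 hS
    obtain ⟨s1, s2, s3⟩ := sq_avoids_of_notMem_crossNorms hlam hmu hS
    have e1 := hc mu hmu h2 lam hlam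
    have e2 := hc lam hlam s1 mu hmu
    rw [thetaCross_swap hq1 hlam hmu] at e2
    refine mul_right_cancel₀ (thetaCross_ne_zero hq0 hq1 hlam hmu s1 h2 s2 s3) ?_
    linear_combination -e1 - e2
  obtain ⟨r₀, hr₀, hr₀S⟩ := exists_pos_notMem_of_countable (countable_crossNorms q 1)
  have hn : ∀ r : ℝ, 0 < r → ‖(r : ℂ)‖ = r := fun r hr => by
    rw [Complex.norm_real, Real.norm_of_nonneg hr.le]
  have hne : ∀ r : ℝ, 0 < r → (r : ℂ) ≠ 0 := fun r hr => by exact_mod_cast hr.ne'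
  have hr₀2 := (sq_avoids_of_notMem_crossNorms (hne _ hr₀) one_ne_zero (by rwa [hn r₀ hr₀])).1
  refine ⟨c r₀, fun lam mu hlam hmu h2 => ?_⟩
  -- An intermediate radius generic with respect to both μ and `r₀` links the two constants, since μ
  -- and `r₀` need not be generic with respect to each other.
  obtain ⟨r, hr, hrS⟩ := exists_pos_notMem_of_countable
    ((countable_crossNorms q mu).union (countable_crossNorms q r₀))
  rw [Set.mem_union, not_or] at hrS
  rw [hc mu hmu h2 lam hlam, hsymm r mu (hne r hr) hmu h2 (by rw [hn r hr]; exact hrS.1),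
    hsymm r r₀ (hne r hr) (hne _ hr₀) hr₀2 (by rw [hn r hr]; exact hrS.2)]

/-- The six factors -(z b_j)⁻¹ multiply to z^{-6} q^{-1} by balancing; the prefactor contributes
q^{-2}. -/
lemma thetaHalf_mul_q (hq0 : q ≠ 0) (hq1 : ‖q‖ < 1) {b : Fin 6 → ℂ} (hb : ∏ j, b j = q) {z : ℂ}
    (hz : z ≠ 0) : thetaHalf q b (z * q) = (q ^ 3)⁻¹ * z ^ (-6 : ℤ) * thetaHalf q b z := by
  have hb0 : ∀ j, b j ≠ 0 := fun j h => hq0 (by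
    rw [← hb, Finset.prod_eq_zero (Finset.mem_univ j) h])
  have h1 : ∏ j, theta q (z * q * b j) = (z ^ 6 * q)⁻¹ * ∏ j, theta q (z * b j) := by
    have : ∀ j, theta q (z * q * b j) = -(z * b j)⁻¹ * theta q (z * b j) := fun j => by
      rw [show z * q * b j = z * b j * q by ring, theta_mul_q hq0 hq1 (mul_ne_zero hz (hb0 j))]
    have h2 : ∏ j, -(z * b j)⁻¹ = (z ^ 6 * q)⁻¹ := by
      rw [← hb, Finset.prod_neg, Finset.prod_inv_distrib, Finset.prod_mul_distrib]
      simp [show (-1 : ℂ) ^ 6 = 1 by norm_num]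
    simp only [this]
    rw [Finset.prod_mul_distrib, h2]
  rw [thetaHalf, thetaHalf, h1, show (-6 : ℤ) = -((6 : ℕ) : ℤ) by rfl, zpow_neg, zpow_natCast]
  field_simp

lemma isOddTheta_thetaDiff (hq0 : q ≠ 0) (hq1 : ‖q‖ < 1) {b : Fin 6 → ℂ} (hb : ∏ j, b j = q) :
    IsOddTheta q (thetaDiff q b) where
  differentiableAt z hz := by
    have hb0 : ∀ j, b j ≠ 0 := fun j h => hq0 (by
      rw [← hb, Finset.prod_eq_zero (Finset.mem_univ j) h])
    have h : ∀ w, w ≠ 0 → DifferentiableAt ℂ (thetaHalf q b) w := fun w hw => by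
      refine DifferentiableAt.mul ?_ (DifferentiableAt.fun_finsetProd fun j _ => ?_)
      · exact (differentiableAt_pow 2).inv (pow_ne_zero 2 hw)
      · exact (differentiableAt_theta hq1 (mul_ne_zero hw (hb0 j))).comp w
          (by fun_prop : DifferentiableAt ℂ (fun w => w * b j) w)
    exact (h z hz).sub ((h _ (inv_ne_zero hz)).comp z (differentiableAt_inv hz))
  mul_q z hz := by
    have h1 := thetaHalf_mul_q hq0 hq1 hb hz
    have h2 := thetaHalf_mul_q hq0 hq1 hb (inv_ne_zero (mul_ne_zero hz hq0))
    rw [show (z * q)⁻¹ * q = z⁻¹ by field_simp] at h2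
    have h3 : thetaHalf q b (z * q)⁻¹ = (q ^ 3)⁻¹ * z ^ (-6 : ℤ) * thetaHalf q b z⁻¹ := by
      rw [h2, inv_zpow', neg_neg, show (-6 : ℤ) = -((6 : ℕ) : ℤ) by rfl, zpow_neg, zpow_natCast,
        show (6 : ℤ) = ((6 : ℕ) : ℤ) by rfl, zpow_natCast]
      field_simp
    rw [thetaDiff, thetaDiff, h1, h3]; ring
  inv z hz := by rw [thetaDiff, thetaDiff, inv_inv]; ring

/-- Reindexing by x + 1 produces the multiplier, since 3(x + 1)² = 3x² + 6x + 3; reindexing by -x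
gives oddness. -/
lemma isOddTheta_latticeSum (hq0 : q ≠ 0) (hq1 : ‖q‖ < 1) {b : Fin 6 → ℂ} (hb : ∏ j, b j = q) :
    IsOddTheta q (latticeSum q b) where
  differentiableAt z hz :=
    (differentiableOn_latticeSum hq0 hq1 (b := fun j _ => b j) (φ := id) isOpen_compl_singleton
      (fun _ => differentiableOn_const _) differentiableOn_id (fun _ hw => hw)
      (fun _ _ => hb)).differentiableAt (isOpen_compl_singleton.mem_nhds hz)
  mul_q z hz := by
    rw [latticeSum, latticeSum, ← tsum_mul_left, ← (Equiv.addRight (1 : ℤ)).tsum_eq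
      (fun x => (q ^ 3)⁻¹ * z ^ (-6 : ℤ) * latticeTerm q b z x)]
    refine tsum_congr fun x => ?_
    rw [Equiv.coe_addRight, latticeTerm, latticeTerm, zpow_add_one₀ hq0, mul_zpow z q,
      show z * q * q ^ x = z * (q ^ x * q) by ring, mul_add, zpow_add₀ hz,
      show 3 * (x + 1) ^ 2 = 3 * x ^ 2 + 6 * x + 3 by ring, zpow_add₀ hq0, zpow_add₀ hq0, mul_one,
      zpow_neg, show q ^ (3 : ℤ) = q ^ 3 by norm_cast]
    have := zpow_ne_zero 6 hz
    have := pow_ne_zero 3 hq0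
    field_simp
  inv z hz := by
    rw [latticeSum, latticeSum, ← tsum_neg, ← (Equiv.neg ℤ).tsum_eq (fun x => -latticeTerm q b z x)]
    refine tsum_congr fun x => ?_
    rw [latticeTerm_eq_shiftedTerm, latticeTerm_eq_shiftedTerm, shiftedTerm_inv]
    simp

end OddTheta

end Rahman

namespace Rahman

open Filter Topology

/-! ### The determinant, its zeros and one special value. -/

section Definitions

/-- The determinant of the two odd theta functions `thetaDiff` and `latticeSum`. -/
noncomputable def casoratian (q : ℂ) (b : Fin 6 → ℂ) (lam mu : ℂ) : ℂ :=
  thetaDiff q b lam * latticeSum q b mu - thetaDiff q b mu * latticeSum q b lam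

/-- The product `(q)_∞ ∏_{i<j} (q / b_i b_j)_∞`. -/
noncomputable def pairProd (q : ℂ) (b : Fin 6 → ℂ) : ℂ :=
  qPochInf q q * ∏ i, ∏ j ∈ Finset.Ioi i, qPochInf q (q / (b i * b j))

/-- The parameter vector `(s, t, c)`. -/
def sixVec (s t : ℂ) (c : Fin 4 → ℂ) : Fin 6 → ℂ := Fin.cons s (Fin.cons t c)

end Definitions

section SixVec

variable {q : ℂ}

lemma sixVec_zero (s t : ℂ) (c : Fin 4 → ℂ) : sixVec s t c 0 = s := rfl

lemma sixVec_one (s t : ℂ) (c : Fin 4 → ℂ) : sixVec s t c 1 = t := rfl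

lemma sixVec_succ_succ (s t : ℂ) (c : Fin 4 → ℂ) (j : Fin 4) : sixVec s t c j.succ.succ = c j := rfl

lemma prod_sixVec (F : ℂ → ℂ) (s t : ℂ) (c : Fin 4 → ℂ) :
    ∏ j, F (sixVec s t c j) = F s * F t * ∏ j, F (c j) := by
  rw [Fin.prod_univ_succ, Fin.prod_univ_succ, mul_assoc]
  rfl

lemma pairProd_sixVec (s t : ℂ) (c : Fin 4 → ℂ) :
    pairProd q (sixVec s t c) = qPochInf q q * qPochInf q (q / (s * t)) *
      (∏ i, ∏ j ∈ Finset.Ioi i, qPochInf q (q / (c i * c j))) *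
      ((∏ j, qPochInf q (q / (s * c j))) * ∏ j, qPochInf q (q / (t * c j))) := by
  rw [pairProd, Fin.prod_univ_succ, Fin.prod_univ_succ]
  simp only [Fin.prod_Ioi_zero, Fin.prod_Ioi_succ, sixVec_succ_succ, sixVec_zero]
  rw [Fin.prod_univ_succ]
  simp only [sixVec_succ_succ, Fin.succ_zero_eq_one, sixVec_one]
  ring

lemma latticeSum_sixVec_swap (s t : ℂ) (c : Fin 4 → ℂ) (lam : ℂ) :
    latticeSum q (sixVec s t c) lam = latticeSum q (sixVec t s c) lam := by
  refine tsum_congr fun x => ?_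
  rw [latticeTerm, latticeTerm, oddKernel, oddKernel,
    prod_sixVec (fun b => qPochInf q (q * (lam * q ^ x) / b) * qPochInf q (q * (lam * q ^ x)⁻¹ / b)),
    prod_sixVec (fun b => qPochInf q (q * (lam * q ^ x) / b) * qPochInf q (q * (lam * q ^ x)⁻¹ / b))]
  ring

lemma thetaHalf_sixVec (s t : ℂ) (c : Fin 4 → ℂ) (mu : ℂ) :
    thetaHalf q (sixVec s t c) mu = (mu ^ 2)⁻¹ *
      (theta q (mu * s) * theta q (mu * t) * ∏ j, theta q (mu * c j)) := by
  rw [thetaHalf, prod_sixVec (fun b => theta q (mu * b))]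

lemma casoratian_sixVec_swap (s t : ℂ) (c : Fin 4 → ℂ) (lam mu : ℂ) :
    casoratian q (sixVec s t c) lam mu = casoratian q (sixVec t s c) lam mu := by
  have h : ∀ mu, thetaDiff q (sixVec s t c) mu = thetaDiff q (sixVec t s c) mu := fun mu => by
    simp only [thetaDiff, thetaHalf_sixVec]; ring
  rw [casoratian, casoratian, h, h, latticeSum_sixVec_swap s t, latticeSum_sixVec_swap s t]

end SixVec

section Zeros

variable {q : ℂ}

lemma qPochInf_zpow_eq_zero (hq0 : q ≠ 0) (hq1 : ‖q‖ < 1) {n : ℤ} (hn : n ≤ 0) :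
    qPochInf q (q ^ n) = 0 := by
  refine (qPochInf_eq_zero_iff hq1).2 ⟨(-n).toNat, ?_⟩
  rw [← zpow_natCast, Int.toNat_of_nonneg (by omega), ← zpow_add₀ hq0, add_neg_cancel, zpow_zero]

lemma theta_one (hq0 : q ≠ 0) (hq1 : ‖q‖ < 1) : theta q 1 = 0 :=
  (theta_eq_zero_iff hq0 hq1 one_ne_zero).2 ⟨0, by simp⟩

lemma oddKernel_eq_zero {b : Fin 6 → ℂ} {z : ℂ} (j : Fin 6)
    (h : qPochInf q (q * z / b j) = 0 ∨ qPochInf q (q * z⁻¹ / b j) = 0) : oddKernel q b z = 0 := by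
  rw [oddKernel, Finset.prod_eq_zero (Finset.mem_univ j) (by rcases h with h | h <;> simp [h]),
    mul_zero]

/-- At λ = b_j the kernel contains (q^{x+1})_∞, so the bilateral series is truncated on the left. A
relation b_i b_j = q^n truncates it on the right as well, through (q^{1-x-n})_∞. -/
lemma latticeTerm_of_neg (hq0 : q ≠ 0) (hq1 : ‖q‖ < 1) {b : Fin 6 → ℂ} {j : Fin 6} (hj : b j ≠ 0)
    {x : ℤ} (hx : x < 0) : latticeTerm q b (b j) x = 0 := by
  rw [latticeTerm, oddKernel_eq_zero j (Or.inl ?_), mul_zero]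
  have : q * (b j * q ^ x) / b j = q ^ (x + 1) := by rw [zpow_add_one₀ hq0]; field_simp
  rw [this]
  exact qPochInf_zpow_eq_zero hq0 hq1 (by omega)

lemma latticeTerm_of_mul_eq (hq0 : q ≠ 0) (hq1 : ‖q‖ < 1) {b : Fin 6 → ℂ} {i j : Fin 6}
    (hi : b i ≠ 0) (hj : b j ≠ 0) {n : ℤ} (h : b i * b j = q ^ n) {x : ℤ} (hx : 0 < x + n) :
    latticeTerm q b (b j) x = 0 := by
  rw [latticeTerm, oddKernel_eq_zero i (Or.inr ?_), mul_zero]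
  have : q * (b j * q ^ x)⁻¹ / b i = q ^ (1 - x - n) := by
    rw [zpow_sub₀ hq0, zpow_sub₀ hq0, ← h, zpow_one]; field_simp
  rw [this]
  exact qPochInf_zpow_eq_zero hq0 hq1 (by omega)

lemma thetaHalf_eq_zero {b : Fin 6 → ℂ} {mu : ℂ} (j : Fin 6) (h : theta q (mu * b j) = 0) :
    thetaHalf q b mu = 0 := by
  rw [thetaHalf, Finset.prod_eq_zero (Finset.mem_univ j) h, mul_zero]

lemma thetaHalf_inv_parameter (hq0 : q ≠ 0) (hq1 : ‖q‖ < 1) {b : Fin 6 → ℂ} {j : Fin 6}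
    (hj : b j ≠ 0) : thetaHalf q b (b j)⁻¹ = 0 :=
  thetaHalf_eq_zero j (by rw [inv_mul_cancel₀ hj, theta_one hq0 hq1])

lemma thetaDiff_parameter (hq0 : q ≠ 0) (hq1 : ‖q‖ < 1) {b : Fin 6 → ℂ} {i j : Fin 6}
    (hi : b i ≠ 0) (hj : b j ≠ 0) {n : ℤ} (h : b i * b j = q ^ n) : thetaDiff q b (b j) = 0 := by
  rw [thetaDiff, thetaHalf_inv_parameter hq0 hq1 hj, thetaHalf_eq_zero i, sub_zero]
  rw [mul_comm]
  exact (theta_eq_zero_iff hq0 hq1 (mul_ne_zero hi hj)).2 ⟨n, h⟩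

/-- The determinant vanishes at the zeros of `pairProd`. -/
lemma casoratian_parameter (hq0 : q ≠ 0) (hq1 : ‖q‖ < 1) {b : Fin 6 → ℂ} {i j : Fin 6}
    (hi : b i ≠ 0) (hj : b j ≠ 0) {n : ℕ} (h : b i * b j = q ^ (n + 1)) (lam : ℂ) :
    casoratian q b lam (b j) = 0 := by
  have h' : b i * b j = q ^ ((n : ℤ) + 1) := by rw [h]; norm_cast
  have : latticeSum q b (b j) = 0 := by
    rw [latticeSum, ← tsum_zero (β := ℤ)]
    refine tsum_congr fun x => ?_
    -- The two truncations overlap because the exponent n + 1 is positive, so no term survives.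
    rcases lt_or_ge x 0 with hx | hx
    · exact latticeTerm_of_neg hq0 hq1 hj hx
    · exact latticeTerm_of_mul_eq hq0 hq1 hi hj h' (by omega)
  rw [casoratian, this, thetaDiff_parameter hq0 hq1 hi hj h']
  ring

/-- The evaluation of the determinant when the bilateral series has only one term. -/
lemma casoratian_of_mul_eq_one (hq0 : q ≠ 0) (hq1 : ‖q‖ < 1) {t : ℂ} {c : Fin 4 → ℂ}
    (hc0 : ∀ j, c j ≠ 0) (ht : t ≠ 0) (hprod : (c 0)⁻¹ * t * ∏ j, c j = q) :
    casoratian q (sixVec (c 0)⁻¹ t c) (c 0) (c 1) =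
      pairProd q (sixVec (c 0)⁻¹ t c) * thetaCross q (c 0) (c 1) := by
  set b := sixVec (c 0)⁻¹ t c with hb
  have hb0 : b 0 ≠ 0 := inv_ne_zero (hc0 0)
  have hb2 : b 2 = c 0 := rfl
  have hb3 : b 3 = c 1 := rfl
  have hmul : b 0 * b 2 = q ^ (0 : ℤ) := by rw [zpow_zero]; exact inv_mul_cancel₀ (hc0 0)
  -- Since b_0 b_2 = 1, the truncations remove exactly x < 0 and x > 0.
  have hsum : latticeSum q b (c 0) = oddKernel q b (c 0) := by
    rw [latticeSum, tsum_eq_single 0]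
    · simp [latticeTerm]
    · intro x hx
      rcases lt_or_gt_of_ne hx with hx | hx
      · exact latticeTerm_of_neg hq0 hq1 (j := 2) (hc0 0) hx
      · exact latticeTerm_of_mul_eq hq0 hq1 (j := 2) hb0 (hc0 0) hmul (by omega)
  have h1 : thetaDiff q b (c 0) = 0 := thetaDiff_parameter hq0 hq1 (j := 2) hb0 (hc0 0) hmul
  have h2 : thetaDiff q b (c 1) = thetaHalf q b (c 1) := by
    have := thetaHalf_inv_parameter (b := b) (j := 3) hq0 hq1 (hc0 1)
    rw [hb3] at this
    rw [thetaDiff, this, sub_zero]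
  rw [casoratian, h1, h2, hsum, oddKernel,
    prod_sixVec (fun b => qPochInf q (q * c 0 / b) * qPochInf q (q * (c 0)⁻¹ / b)),
    thetaHalf_sixVec, pairProd_sixVec, thetaCross]
  have c0 := hc0 0
  have c1 := hc0 1
  have c2 := hc0 2
  have c3 := hc0 3
  rw [Fin.prod_univ_four] at hprod
  have hprod' : t * (c 1 * c 2 * c 3) = q := by
    rw [← hprod]; field_simp
  have e0 : q * c 0 / (c 0)⁻¹ = c 0 ^ 2 * q := by field_simp
  have e1 : q * (c 0)⁻¹ / (c 0)⁻¹ = q := by field_simp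
  have e2 : q * c 0 / t = q / ((c 0)⁻¹ * t) := by field_simp
  have e3 : q * (c 0)⁻¹ / t = q / (t * c 0) := by field_simp
  have e4 : ∀ j, q * c 0 / c j = q / ((c 0)⁻¹ * c j) := fun j => by field_simp
  have e5 : ∀ j, q * (c 0)⁻¹ / c j = q / (c 0 * c j) := fun j => by field_simp
  have e6 : q / ((c 0)⁻¹ * c 0) = q := by field_simp
  have e7 : q / (c 0 * c 0) = q / c 0 ^ 2 := by rw [sq]
  have t1 : theta q (c 0 ^ 2) = (1 - c 0 ^ 2) * qPochInf q (c 0 ^ 2 * q) * qPochInf q (q / c 0 ^ 2) := by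
    rw [theta, qPochInf_eq_one_sub_mul hq1 (c 0 ^ 2)]
  have t2 : c 1 * (c 0)⁻¹ = c 1 / c 0 := by rw [div_eq_mul_inv]
  -- By t c₁ c₂ c₃ = q the argument of each theta factor is also q over a product of two parameters,
  -- so the factor splits into two factors of `pairProd`.
  have t3 : theta q (c 1 * t) = qPochInf q (q / (c 2 * c 3)) * qPochInf q (q / (t * c 1)) := by
    rw [theta, mul_comm (c 1) t]; congr 2; rw [← hprod']; field_simp
  have t4 : theta q (c 1 * c 2) = qPochInf q (q / (t * c 3)) * qPochInf q (q / (c 1 * c 2)) := by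
    rw [theta]; congr 2; rw [← hprod']; field_simp
  have t5 : theta q (c 1 * c 3) = qPochInf q (q / (t * c 2)) * qPochInf q (q / (c 1 * c 3)) := by
    rw [theta]; congr 2; rw [← hprod']; field_simp
  have i0 : (Finset.Ioi (0 : Fin 4)) = {1, 2, 3} := by decide
  have i1 : (Finset.Ioi (1 : Fin 4)) = {2, 3} := by decide
  have i2 : (Finset.Ioi (2 : Fin 4)) = {3} := by decide
  have i3 : (Finset.Ioi (3 : Fin 4)) = ∅ := by decide
  simp only [Fin.prod_univ_four, i0, i1, i2, i3, Finset.prod_empty, Finset.prod_singleton]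
  rw [Finset.prod_insert (by decide), Finset.prod_insert (by decide), Finset.prod_singleton,
    Finset.prod_insert (by decide), Finset.prod_singleton]
  simp only [e0, e1, e2, e3, e4, e5, e6, e7, t1, t2, t3, t4, t5, mul_comm (c 1) (c 0), ← sq (c 1)]
  field_simp
  ring

end Zeros

end Rahman

namespace Rahman

open Filter Topology

/-! ### Shifting two parameters in opposite directions. -/

section Shift

variable {q : ℂ}

lemma qPochInf_div_mul_pow (hq0 : q ≠ 0) (hq1 : ‖q‖ < 1) {s z : ℂ} (hs : s ≠ 0) (hz : z ≠ 0) (k : ℕ) :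
    qPochInf q (q * z / (s * q ^ k)) = (-(z / s)) ^ k * (q ^ (∑ i ∈ Finset.range k, i))⁻¹ *
      (∏ i ∈ Finset.range k, (1 - s * z⁻¹ * q ^ i)) * qPochInf q (q * z / s) := by
  have e : q * z / (s * q ^ k) = z / s * q * (q ^ k)⁻¹ := by
    have := pow_ne_zero k hq0
    field_simp
  rw [e, qPochInf_mul_inv_pow hq0 hq1, prod_one_sub_mul_inv hq0 (div_ne_zero hz hs), inv_div,
    div_mul_eq_mul_div, mul_comm z q]
  simp only [div_eq_mul_inv]

/-- The powers of `z` and `z⁻¹` released by the two factors with parameter s q^k cancel, so the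
scalar pulled out is independent of `x`; the rest is the definition of `shiftedTerm`. -/
lemma latticeTerm_shift (hq0 : q ≠ 0) (hq1 : ‖q‖ < 1) {s t lam : ℂ} (hs : s ≠ 0) (ht : t ≠ 0)
    (hlam : lam ≠ 0) (c : Fin 4 → ℂ) (k : ℕ) (x : ℤ) :
    latticeTerm q (sixVec (s * q ^ k) (t * (q ^ k)⁻¹) c) lam x =
      ((s ^ k * q ^ (∑ i ∈ Finset.range k, i)) ^ 2)⁻¹ * shiftedTerm q s t c k lam x := by
  set z := lam * q ^ x with hzdef
  have hz : z ≠ 0 := mul_ne_zero hlam (zpow_ne_zero _ hq0)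
  have hk := pow_ne_zero k hq0
  have e : ∀ z, q * z / (t * (q ^ k)⁻¹) = q ^ (k + 1) * z / t := fun z => by
    rw [pow_succ]; field_simp
  rw [latticeTerm, shiftedTerm, ← hzdef, oddKernel,
    prod_sixVec (fun b => qPochInf q (q * z / b) * qPochInf q (q * z⁻¹ / b)),
    qPochInf_div_mul_pow hq0 hq1 hs hz, qPochInf_div_mul_pow hq0 hq1 hs (inv_ne_zero hz), e, e,
    inv_inv, pairFactor, pairFactor]
  have h1 : (-(z / s)) ^ k * (-(z⁻¹ / s)) ^ k = ((s ^ k) ^ 2)⁻¹ := by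
    rw [← mul_pow, ← pow_mul, mul_comm k 2, pow_mul, ← inv_pow]
    congr 1
    field_simp
  rw [mul_pow (s ^ k), mul_inv ((s ^ k) ^ 2), ← h1]
  ring

lemma thetaHalf_shift (hq0 : q ≠ 0) (hq1 : ‖q‖ < 1) {s t mu : ℂ} (hs : s ≠ 0) (ht : t ≠ 0)
    (hmu : mu ≠ 0) (c : Fin 4 → ℂ) (k : ℕ) :
    thetaHalf q (sixVec (s * q ^ k) (t * (q ^ k)⁻¹) c) mu =
      ((t / s) ^ k * (q ^ (k ^ 2))⁻¹) * thetaHalf q (sixVec s t c) mu := by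
  have e1 := theta_mul_zpow hq0 hq1 (mul_ne_zero hmu hs) k
  have e2 := theta_mul_zpow hq0 hq1 (mul_ne_zero hmu ht) (-k)
  have h1 := two_mul_choose_two k
  have h2 := two_mul_choose_two (-k)
  have e3 : q ^ (-((k : ℤ) * (k - 1) / 2)) * q ^ (-(-(k : ℤ) * (-k - 1) / 2)) = (q ^ (k ^ 2))⁻¹ := by
    rw [← zpow_add₀ hq0, ← zpow_natCast, ← zpow_neg]
    congr 1
    push_cast
    nlinarith
  have e4 : ((-1 : ℂ) ^ (k : ℤ)) * (-1) ^ (-(k : ℤ)) = 1 := by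
    rw [← zpow_add₀ (by norm_num), add_neg_cancel, zpow_zero]
  rw [thetaHalf_sixVec, thetaHalf_sixVec, ← mul_assoc mu, ← mul_assoc mu, ← zpow_natCast q k,
    ← zpow_neg, e1, e2, ← e3, neg_neg, zpow_neg (mu * s), zpow_natCast (mu * s),
    zpow_natCast (mu * t), mul_pow mu, mul_pow mu, div_pow]
  have := pow_ne_zero k hmu
  have := pow_ne_zero k hs
  calc _ = (((-1 : ℂ) ^ (k : ℤ)) * (-1) ^ (-(k : ℤ))) * ((mu ^ k * s ^ k)⁻¹ * (mu ^ k * t ^ k)) *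
        (q ^ (-((k : ℤ) * (k - 1) / 2)) * q ^ (-(-(k : ℤ) * (-k - 1) / 2))) *
        ((mu ^ 2)⁻¹ * (theta q (mu * s) * theta q (mu * t) * ∏ j, theta q (mu * c j))) := by
          ring
    _ = _ := by
      rw [e4, one_mul, show (mu ^ k * s ^ k)⁻¹ * (mu ^ k * t ^ k) = t ^ k / s ^ k by field_simp]

/-- The common factor of `casoratian` and `pairProd` under a shift of two parameters. -/
noncomputable def shiftFactor (q s t : ℂ) (k : ℕ) : ℂ :=
  (t / s) ^ k * (q ^ (k ^ 2))⁻¹ * ((s ^ k * q ^ (∑ i ∈ Finset.range k, i)) ^ 2)⁻¹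

lemma casoratian_shift (hq0 : q ≠ 0) (hq1 : ‖q‖ < 1) {s t lam mu : ℂ} (hs : s ≠ 0) (ht : t ≠ 0)
    (hlam : lam ≠ 0) (hmu : mu ≠ 0) (c : Fin 4 → ℂ) (k : ℕ) :
    casoratian q (sixVec (s * q ^ k) (t * (q ^ k)⁻¹) c) lam mu = shiftFactor q s t k *
      (thetaDiff q (sixVec s t c) lam * ∑' x : ℤ, shiftedTerm q s t c k mu x -
        thetaDiff q (sixVec s t c) mu * ∑' x : ℤ, shiftedTerm q s t c k lam x) := by
  have h1 : ∀ mu, mu ≠ 0 → thetaDiff q (sixVec (s * q ^ k) (t * (q ^ k)⁻¹) c) mu =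
      ((t / s) ^ k * (q ^ (k ^ 2))⁻¹) * thetaDiff q (sixVec s t c) mu := fun mu hmu => by
    rw [thetaDiff, thetaDiff, thetaHalf_shift hq0 hq1 hs ht hmu,
      thetaHalf_shift hq0 hq1 hs ht (inv_ne_zero hmu)]
    ring
  have h2 : ∀ mu, mu ≠ 0 → latticeSum q (sixVec (s * q ^ k) (t * (q ^ k)⁻¹) c) mu =
      ((s ^ k * q ^ (∑ i ∈ Finset.range k, i)) ^ 2)⁻¹ * ∑' x : ℤ, shiftedTerm q s t c k mu x :=
    fun mu hmu => by
      rw [latticeSum, ← tsum_mul_left]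
      exact tsum_congr fun x => latticeTerm_shift hq0 hq1 hs ht hmu c k x
  rw [casoratian, h1 lam hlam, h1 mu hmu, h2 lam hlam, h2 mu hmu, shiftFactor]
  ring

lemma sum_range_id_mul_two_add (k : ℕ) : k + 2 * ∑ i ∈ Finset.range k, i = k ^ 2 := by
  have := Finset.sum_range_id_mul_two k
  rcases k with _ | k
  · simp
  · simp only [Nat.add_sub_cancel] at this
    nlinarith

lemma pairProd_shift (hq0 : q ≠ 0) (hq1 : ‖q‖ < 1) {s t : ℂ} {c : Fin 4 → ℂ}
    (hprod : s * t * ∏ j, c j = q) (k : ℕ) :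
    pairProd q (sixVec (s * q ^ k) (t * (q ^ k)⁻¹) c) = shiftFactor q s t k *
      (qPochInf q q * qPochInf q (q / (s * t)) *
        (∏ i, ∏ j ∈ Finset.Ioi i, qPochInf q (q / (c i * c j))) *
        ((∏ j, (∏ i ∈ Finset.range k, (1 - s * c j * q ^ i)) * qPochInf q (q / (s * c j))) *
          ∏ j, qPochInf q (q / (t * c j) * q ^ k))) := by
  have hst : s * t ≠ 0 := fun h => hq0 (by rw [← hprod, h, zero_mul])
  have hs : s ≠ 0 := left_ne_zero_of_mul hst
  have ht : t ≠ 0 := right_ne_zero_of_mul hst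
  have hcp : ∏ j, c j ≠ 0 := right_ne_zero_of_mul (by rw [hprod]; exact hq0)
  have hc0 : ∀ j, c j ≠ 0 := fun j => Finset.prod_ne_zero_iff.1 hcp j (Finset.mem_univ j)
  have hk := pow_ne_zero k hq0
  have e1 : s * q ^ k * (t * (q ^ k)⁻¹) = s * t := by field_simp
  have e2 : ∀ j, qPochInf q (q / (s * q ^ k * c j)) = (-(s * c j)⁻¹) ^ k *
      (q ^ (∑ i ∈ Finset.range k, i))⁻¹ *
      ((∏ i ∈ Finset.range k, (1 - s * c j * q ^ i)) * qPochInf q (q / (s * c j))) := fun j => by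
    have h := qPochInf_div_mul_pow hq0 hq1 hs (inv_ne_zero (hc0 j)) k
    have a1 : q * (c j)⁻¹ / (s * q ^ k) = q / (s * q ^ k * c j) := by
      have := hc0 j; field_simp
    have a2 : q * (c j)⁻¹ / s = q / (s * c j) := by have := hc0 j; field_simp
    have a3 : (c j)⁻¹ / s = (s * c j)⁻¹ := by have := hc0 j; field_simp
    rw [a1, a2, a3, inv_inv] at h
    rw [h, mul_assoc]
  have e3 : ∀ j, q / (t * (q ^ k)⁻¹ * c j) = q / (t * c j) * q ^ k := fun j => by
    have := hc0 j
    field_simp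
  -- Balancing in the form q^k = s^k t^k (∏ c_j)^k identifies the scalar released by P with the one
  -- released by the determinant.
  have e4 : ∏ j, ((-(s * c j)⁻¹) ^ k * (q ^ (∑ i ∈ Finset.range k, i))⁻¹) = shiftFactor q s t k := by
    have a1 : ∏ j, (-(s * c j)⁻¹) = (s ^ 4 * ∏ j, c j)⁻¹ := by
      rw [Finset.prod_neg, Finset.prod_inv_distrib, Finset.prod_mul_distrib]
      simp [show (-1 : ℂ) ^ 4 = 1 by norm_num]
    rw [Finset.prod_mul_distrib, Finset.prod_pow, a1, shiftFactor, Finset.prod_const,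
      Finset.card_univ, Fintype.card_fin, ← sum_range_id_mul_two_add k, pow_add, mul_comm 2, pow_mul]
    have hqk : q ^ k = s ^ k * t ^ k * (∏ j, c j) ^ k := by rw [← mul_pow, ← mul_pow, hprod]
    have := pow_ne_zero (∑ i ∈ Finset.range k, i) hq0
    set T := q ^ (∑ i ∈ Finset.range k, i) with hT
    rw [hqk, inv_pow, mul_pow (s ^ 4), mul_pow (s ^ k), div_pow]
    have := pow_ne_zero k hs
    have := pow_ne_zero k ht
    have := pow_ne_zero k hcp
    have a2 : (s ^ 4) ^ k = (s ^ k) ^ 4 := by rw [← pow_mul, ← pow_mul, mul_comm]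
    rw [a2]
    field_simp
  rw [pairProd_sixVec, e1]
  simp only [e2, e3]
  rw [Finset.prod_mul_distrib, e4]
  ring

end Shift

/-! ### Comparison of the determinant with `pairProd` on circles. -/

section Growth

variable {q : ℂ}

lemma differentiableOn_thetaDiff_sixVec (hq1 : ‖q‖ < 1) {p : ℂ} (hp : p ≠ 0) {c : Fin 4 → ℂ}
    {mu : ℂ} (hmu : mu ≠ 0) :
    DifferentiableOn ℂ (fun s => thetaDiff q (sixVec s (p / s) c) mu) {0}ᶜ := by
  have h : ∀ mu, mu ≠ 0 →
      DifferentiableOn ℂ (fun s => thetaHalf q (sixVec s (p / s) c) mu) {0}ᶜ := by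
    intro mu hmu s hs
    have hs' : s ≠ 0 := hs
    simp only [thetaHalf_sixVec]
    refine DifferentiableAt.differentiableWithinAt ?_
    refine DifferentiableAt.const_mul (DifferentiableAt.mul_const (DifferentiableAt.mul ?_ ?_) _) _
    · exact (differentiableAt_theta hq1 (mul_ne_zero hmu hs')).comp s
        (by fun_prop : DifferentiableAt ℂ (fun s => mu * s) s)
    · exact (differentiableAt_theta hq1 (mul_ne_zero hmu (div_ne_zero hp hs'))).comp s
        ((hasDerivAt_const_div p hs').differentiableAt.const_mul mu)
  exact (h mu hmu).sub (h _ (inv_ne_zero hmu))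

lemma exists_norm_tsum_shiftedTerm_le (hq0 : q ≠ 0) (hq1 : ‖q‖ < 1) {p : ℂ} (hp0 : p ≠ 0)
    (hp1 : ‖p‖ < 1) {c : Fin 4 → ℂ} (hprod : p * ∏ j, c j = q) {ρ : ℝ} (hρ : 0 < ρ) {lam : ℂ}
    (hlam : lam ≠ 0) :
    ∃ M : ℝ, ∀ (k : ℕ) (s : ℂ), ‖s‖ = ρ → ‖∑' x : ℤ, shiftedTerm q s (p / s) c k lam x‖ ≤ M := by
  have hQ : 0 < ‖q‖ := norm_pos_iff.2 hq0
  set B := ‖lam‖ + ‖lam⁻¹‖ + ρ + ρ⁻¹ + ‖p‖ / ρ + ρ / ‖p‖ + ∑ j, (‖c j‖ + ‖(c j)⁻¹‖) with hB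
  obtain ⟨M, hM0, hM⟩ := exists_norm_shiftedTerm_le hq0 hq1 B
  -- With this choice κ|q| = max(|q|, |p|), so |p| < 1 makes the dominating series geometric, with a
  -- sum independent of `k`.
  set κ := max 1 (‖p‖ / ‖q‖) with hκ
  have hκ1 : κ * ‖q‖ < 1 := by
    rw [hκ, max_mul_of_nonneg _ _ hQ.le, one_mul, div_mul_cancel₀ _ hQ.ne']
    exact max_lt hq1 hp1
  have hκ0 : 1 ≤ κ := le_max_left _ _
  have hsum := (summable_pow_natAbs (r := κ * ‖q‖) (by positivity) hκ1).mul_left M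
  have n1 := norm_nonneg lam
  have n2 := norm_nonneg lam⁻¹
  have n3 : 0 ≤ ρ⁻¹ := by positivity
  have n4 : 0 ≤ ‖p‖ / ρ := by positivity
  have n5 : 0 ≤ ρ / ‖p‖ := by positivity
  have hj : ∀ j, ‖c j‖ + ‖(c j)⁻¹‖ ≤ ∑ j, (‖c j‖ + ‖(c j)⁻¹‖) := fun j =>
    Finset.single_le_sum (f := fun j => ‖c j‖ + ‖(c j)⁻¹‖) (fun _ _ => by positivity)
      (Finset.mem_univ j)
  have n6 := (by positivity : 0 ≤ ‖c 0‖ + ‖(c 0)⁻¹‖).trans (hj 0)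
  refine ⟨_, fun k s hs => tsum_of_norm_bounded hsum.hasSum ?_⟩
  have hs0 : s ≠ 0 := by rw [← norm_pos_iff, hs]; exact hρ
  refine hM s (p / s) c lam κ k (by rw [mul_div_cancel₀ _ hs0, hprod]) hlam ?_ ?_ ?_ ?_ ?_ ?_
    (fun j => ?_) (fun j => ?_) hκ0 (Or.inr ?_)
  · linarith
  · linarith
  · linarith
  · rw [norm_inv, hs]; linarith
  · rw [norm_div, hs]; linarith
  · rw [inv_div, norm_div, hs]; linarith
  · linarith [hj j, norm_nonneg (c j), norm_nonneg (c j)⁻¹]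
  · linarith [hj j, norm_nonneg (c j), norm_nonneg (c j)⁻¹]
  · rw [mul_div_cancel₀ _ hs0, ← div_le_iff₀ hQ]
    exact le_max_right _ _

/-- On suitable circles the determinant is dominated by `pairProd`. -/
lemma exists_norm_casoratian_le (hq0 : q ≠ 0) (hq1 : ‖q‖ < 1) {p : ℂ} (hp0 : p ≠ 0) (hp1 : ‖p‖ < 1)
    {c : Fin 4 → ℂ} (hprod : p * ∏ j, c j = q)
    (hpc : qPochInf q q * qPochInf q (q / p) *
        (∏ i, ∏ j ∈ Finset.Ioi i, qPochInf q (q / (c i * c j))) ≠ 0)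
    {ρ : ℝ} (hρ : 0 < ρ) (h1 : ∀ j, ∀ n : ℤ, ρ * ‖c j‖ ≠ ‖q‖ ^ n)
    (h2 : ∀ j, ∀ n : ℤ, ρ ≠ ‖p * c j‖ * ‖q‖ ^ n) {lam mu : ℂ} (hlam : lam ≠ 0) (hmu : mu ≠ 0) :
    ∃ M : ℝ, ∀ (k : ℕ) (s : ℂ), ‖s‖ = ρ →
      ‖casoratian q (sixVec (s * q ^ k) (p / (s * q ^ k)) c) lam mu‖ ≤
        M * ‖pairProd q (sixVec (s * q ^ k) (p / (s * q ^ k)) c)‖ := by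
  have hQ : 0 < ‖q‖ := norm_pos_iff.2 hq0
  have hcp : ∏ j, c j ≠ 0 := right_ne_zero_of_mul (by rw [hprod]; exact hq0)
  have hc0 : ∀ j, c j ≠ 0 := fun j => Finset.prod_ne_zero_iff.1 hcp j (Finset.mem_univ j)
  have hsph : ∀ s ∈ Metric.sphere (0 : ℂ) ρ, ‖s‖ = ρ := fun s hs => by simpa using hs
  have hs0 : ∀ s : ℂ, ‖s‖ = ρ → s ≠ 0 := fun s hs => by rw [← norm_pos_iff, hs]; exact hρ
  have hsub : Metric.sphere (0 : ℂ) ρ ⊆ {0}ᶜ := fun s hs => hs0 s (hsph s hs)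
  have hcomp := isCompact_sphere (0 : ℂ) ρ
  obtain ⟨A1, hA1⟩ := exists_norm_tsum_shiftedTerm_le hq0 hq1 hp0 hp1 hprod hρ hlam
  obtain ⟨A2, hA2⟩ := exists_norm_tsum_shiftedTerm_le hq0 hq1 hp0 hp1 hprod hρ hmu
  obtain ⟨A3, hA3⟩ := hcomp.exists_bound_of_continuousOn
    ((differentiableOn_thetaDiff_sixVec hq1 hp0 (c := c) hlam).continuousOn.mono hsub)
  obtain ⟨A4, hA4⟩ := hcomp.exists_bound_of_continuousOn
    ((differentiableOn_thetaDiff_sixVec hq1 hp0 (c := c) hmu).continuousOn.mono hsub)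
  -- the nonvanishing factors
  have z1 : ∀ s : ℂ, ‖s‖ = ρ → ∀ j, ∀ n : ℤ, s * c j ≠ q ^ n := fun s hs j n h => h1 j n (by
    rw [← hs, ← norm_mul, h, norm_zpow])
  have z2 : ∀ s : ℂ, ‖s‖ = ρ → ∀ j, qPochInf q (q / (s * c j)) ≠ 0 := fun s hs j =>
    qPochInf_ne_zero hq1 fun n h => z1 s hs j (1 - n) (by
      rw [zpow_sub₀ hq0, ← h, zpow_one, div_div_cancel₀ hq0])
  have z3 : ∀ s : ℂ, ‖s‖ = ρ → ∀ j, qPochInf q (q / (p / s * c j)) ≠ 0 := fun s hs j =>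
    qPochInf_ne_zero hq1 fun n h => h2 j (n - 1) (by
      have hh : s = p * c j * q ^ (n - 1) := by
        rw [zpow_sub_one₀ hq0, ← h]
        have := hs0 s hs
        have := hc0 j
        field_simp
      rw [← hs, ← norm_zpow, ← norm_mul, ← hh])
  have hP := (differentiable_qPochInf hq1).continuous
  -- The circle meets no zero of these infinite products, so their inverse is bounded on it by
  -- compactness.
  obtain ⟨A5, hA5⟩ := hcomp.exists_bound_of_continuousOn (f := fun s => (∏ j, (qPochInf q (s * c j) *
      qPochInf q (q / (s * c j)) * qPochInf q (q / (p / s * c j))))⁻¹) (by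
    intro s hs
    have hs' := hsph s hs
    have hsne := hs0 s hs'
    refine ContinuousAt.continuousWithinAt (ContinuousAt.inv₀ ?_ ?_)
    · refine tendsto_finsetProd _ fun j _ => ?_
      refine ContinuousAt.mul (ContinuousAt.mul ?_ ?_) ?_
      · exact hP.continuousAt.comp (by fun_prop)
      · refine hP.continuousAt.comp (ContinuousAt.div (by fun_prop) (by fun_prop) ?_)
        exact mul_ne_zero hsne (hc0 j)
      · refine hP.continuousAt.comp (ContinuousAt.div (by fun_prop) (ContinuousAt.mul
          (ContinuousAt.div (by fun_prop) (by fun_prop) hsne) (by fun_prop)) ?_)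
        exact mul_ne_zero (div_ne_zero hp0 hsne) (hc0 j)
    · refine Finset.prod_ne_zero_iff.2 fun j _ => mul_ne_zero (mul_ne_zero ?_ (z2 s hs' j)) (z3 s hs' j)
      exact qPochInf_ne_zero hq1 (z1 s hs' j))
  set K := qPochInf q q * qPochInf q (q / p) *
        (∏ i, ∏ j ∈ Finset.Ioi i, qPochInf q (q / (c i * c j))) with hK
  clear_value K
  have hKpos : 0 < ‖K‖ := norm_pos_iff.2 hpc
  set E1 : Fin 4 → ℝ := fun j => Real.exp (ρ * ‖c j‖ / (1 - ‖q‖)) with hE1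
  set E2 : Fin 4 → ℝ := fun j => Real.exp (‖q‖ / (‖p‖ / ρ * ‖c j‖) / (1 - ‖q‖)) with hE2
  refine ⟨(A3 * A2 + A4 * A1) * (‖K‖⁻¹ * (A5 * ∏ j, (E1 j * E2 j))), fun k s hs => ?_⟩
  have hsne := hs0 s hs
  have hmem : s ∈ Metric.sphere (0 : ℂ) ρ := by simpa using hs
  have hpk : p / (s * q ^ k) = p / s * (q ^ k)⁻¹ := by rw [← div_div, div_eq_mul_inv (p / s)]
  have hst : s * (p / s) = p := mul_div_cancel₀ _ hsne
  have hA10 := (norm_nonneg _).trans (hA1 k s hs)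
  have hA20 := (norm_nonneg _).trans (hA2 k s hs)
  have hA30 := (norm_nonneg _).trans (hA3 s hmem)
  have hA40 := (norm_nonneg _).trans (hA4 s hmem)
  have hA50 := (norm_nonneg _).trans (hA5 s hmem)
  rw [hpk, casoratian_shift hq0 hq1 hsne (div_ne_zero hp0 hsne) hlam hmu,
    pairProd_shift hq0 hq1 (by rw [hst, hprod]), hst, ← hK, norm_mul, norm_mul, norm_mul K,
    mul_left_comm]
  refine mul_le_mul_of_nonneg_left ?_ (norm_nonneg _)
  have num : ‖thetaDiff q (sixVec s (p / s) c) lam * ∑' x : ℤ, shiftedTerm q s (p / s) c k mu x -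
        thetaDiff q (sixVec s (p / s) c) mu * ∑' x : ℤ, shiftedTerm q s (p / s) c k lam x‖ ≤
      A3 * A2 + A4 * A1 := by
    refine (norm_sub_le _ _).trans ?_
    rw [norm_mul, norm_mul]
    have := hA3 s hmem
    have := hA4 s hmem
    have := hA1 k s hs
    have := hA2 k s hs
    gcongr
  set D := (∏ j, (∏ i ∈ Finset.range k, (1 - s * c j * q ^ i)) * qPochInf q (q / (s * c j))) *
          ∏ j, qPochInf q (q / (p / s * c j) * q ^ k) with hD
  -- Lower bound for the normalized `pairProd`, uniform in `k`. The product W of full infinite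
  -- products factors as X · D, where W is bounded below on the circle and X is bounded above
  -- independently of `k`.
  have den : 1 ≤ A5 * (∏ j, (E1 j * E2 j)) * ‖D‖ := by
    set W := ∏ j, (qPochInf q (s * c j) * qPochInf q (q / (s * c j)) *
      qPochInf q (q / (p / s * c j))) with hW
    have hW0 : W ≠ 0 := Finset.prod_ne_zero_iff.2 fun j _ => mul_ne_zero (mul_ne_zero
      (qPochInf_ne_zero hq1 (z1 s hs j)) (z2 s hs j)) (z3 s hs j)
    set X := ∏ j, (qPochInf q (s * c j * q ^ k) *
      ∏ i ∈ Finset.range k, (1 - q / (p / s * c j) * q ^ i)) with hX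
    have hWX : W = X * D := by
      rw [hW, hX, hD, ← Finset.prod_mul_distrib, ← Finset.prod_mul_distrib]
      refine Finset.prod_congr rfl fun j _ => ?_
      rw [qPochInf_eq_prod_mul hq1 (s * c j) k, qPochInf_eq_prod_mul hq1 (q / (p / s * c j)) k]
      ring
    have hXle : ‖X‖ ≤ ∏ j, (E1 j * E2 j) := by
      rw [hX, norm_prod]
      refine Finset.prod_le_prod (fun _ _ => norm_nonneg _) fun j _ => ?_
      rw [norm_mul]
      have hq1' : 0 < 1 - ‖q‖ := by linarith
      refine mul_le_mul ?_ ?_ (norm_nonneg _) (Real.exp_pos _).le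
      · refine (norm_qPochInf_le hq1 _).trans ?_
        simp only [hE1]
        gcongr
        rw [norm_mul, norm_mul, hs, norm_pow]
        exact mul_le_of_le_one_right (by positivity) (pow_le_one₀ hQ.le hq1.le)
      · refine (norm_prod_one_sub_le hq1 _ _).trans ?_
        simp only [hE2, norm_div, norm_mul, hs]
        exact le_rfl
    calc (1 : ℝ) = ‖W⁻¹‖ * ‖X * D‖ := by rw [← hWX, ← norm_mul, inv_mul_cancel₀ hW0, norm_one]
      _ ≤ A5 * ((∏ j, (E1 j * E2 j)) * ‖D‖) := by
        rw [norm_mul X D]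
        have := hA5 s hmem
        exact mul_le_mul this (mul_le_mul_of_nonneg_right hXle (norm_nonneg _)) (by positivity) hA50
      _ = _ := by ring
  calc _ ≤ (A3 * A2 + A4 * A1) * 1 := by rw [mul_one]; exact num
    _ ≤ (A3 * A2 + A4 * A1) * (A5 * (∏ j, (E1 j * E2 j)) * ‖D‖) := by gcongr
    _ = _ := by field_simp

end Growth

end Rahman

namespace Rahman

open Filter Topology

/-! ### Liouville argument for generic parameters. -/

section Generic

variable {q : ℂ}

lemma qPochInf_div_ne_zero (hq0 : q ≠ 0) (hq1 : ‖q‖ < 1) {a : ℂ} (ha : ∀ n : ℤ, a ≠ q ^ n) :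
    qPochInf q (q / a) ≠ 0 :=
  qPochInf_ne_zero hq1 fun n h => ha (1 - n) (by
    rw [zpow_sub₀ hq0, ← h, zpow_one, div_div_cancel₀ hq0])

/-- As the proportionality constant does not depend on (λ, μ), one pair with nonzero cross factor is
enough to recover it. -/
lemma exists_thetaCross_ne_zero (hq0 : q ≠ 0) (hq1 : ‖q‖ < 1) :
    ∃ lam mu : ℂ, lam ≠ 0 ∧ mu ≠ 0 ∧ (∀ n : ℤ, mu ^ 2 ≠ q ^ n) ∧ thetaCross q lam mu ≠ 0 := by
  have hn : ∀ r : ℝ, 0 < r → ‖(r : ℂ)‖ = r := fun r hr => by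
    rw [Complex.norm_real, Real.norm_of_nonneg hr.le]
  have hne : ∀ r : ℝ, 0 < r → (r : ℂ) ≠ 0 := fun r hr => by exact_mod_cast hr.ne'
  obtain ⟨r, hr, hrS⟩ := exists_pos_notMem_of_countable (countable_crossNorms q 1)
  have h2 := (sq_avoids_of_notMem_crossNorms (hne _ hr) one_ne_zero (by rwa [hn r hr])).1
  obtain ⟨r', hr', hrS'⟩ := exists_pos_notMem_of_countable (countable_crossNorms q r)
  obtain ⟨s1, s2, s3⟩ :=
    sq_avoids_of_notMem_crossNorms (hne _ hr') (hne _ hr) (by rwa [hn r' hr'])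
  exact ⟨r', r, hne _ hr', hne _ hr, h2, thetaCross_ne_zero hq0 hq1 (hne _ hr') (hne _ hr) s1 h2 s2 s3⟩

lemma exists_casoratian_eq (hq0 : q ≠ 0) (hq1 : ‖q‖ < 1) {b : Fin 6 → ℂ} (hb : ∏ j, b j = q) :
    ∃ C, ∀ lam mu, lam ≠ 0 → mu ≠ 0 → (∀ n : ℤ, mu ^ 2 ≠ q ^ n) →
      casoratian q b lam mu = C * thetaCross q lam mu :=
  (isOddTheta_thetaDiff hq0 hq1 hb).exists_casoratian (isOddTheta_latticeSum hq0 hq1 hb) hq0 hq1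

lemma pairProd_sixVec_swap (s t : ℂ) (c : Fin 4 → ℂ) :
    pairProd q (sixVec s t c) = pairProd q (sixVec t s c) := by
  rw [pairProd_sixVec, pairProd_sixVec, mul_comm s t]; ring

/-- The vanishing factor means b_i b_j = q^{n+1}, so the determinant vanishes at μ = b_j for every
λ. Choosing λ with nonzero cross factor forces the proportionality constant to be 0. -/
lemma casoratian_eq_zero_of_pairProd_eq_zero (hq0 : q ≠ 0) (hq1 : ‖q‖ < 1) {b : Fin 6 → ℂ}
    (hb0 : ∀ j, b j ≠ 0) (hb : ∏ j, b j = q) {i j : Fin 6}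
    (hj : ∀ n : ℤ, b j ^ 2 ≠ q ^ n) (h : qPochInf q (q / (b i * b j)) = 0) {lam mu : ℂ}
    (hlam : lam ≠ 0) (hmu : mu ≠ 0) (h2 : ∀ n : ℤ, mu ^ 2 ≠ q ^ n) : casoratian q b lam mu = 0 := by
  obtain ⟨C, hC⟩ := exists_casoratian_eq hq0 hq1 hb
  obtain ⟨n, hn⟩ := (qPochInf_eq_zero_iff hq1).1 h
  have hij : b i * b j = q ^ (n + 1) := by
    rw [div_mul_eq_mul_div, div_eq_one_iff_eq (mul_ne_zero (hb0 i) (hb0 j))] at hn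
    rw [← hn]; ring
  obtain ⟨r, hr, hrS⟩ := exists_pos_notMem_of_countable (countable_crossNorms q (b j))
  have hr0 : (r : ℂ) ≠ 0 := by exact_mod_cast hr.ne'
  obtain ⟨s1, s2, s3⟩ := sq_avoids_of_notMem_crossNorms hr0 (hb0 j)
    (by rwa [Complex.norm_real, Real.norm_of_nonneg hr.le])
  have h1 := hC r (b j) hr0 (hb0 j) hj
  rw [casoratian_parameter hq0 hq1 (hb0 i) (hb0 j) hij] at h1
  have hC0 : C = 0 := by
    rcases mul_eq_zero.1 h1.symm with h | h
    · exact h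
    · exact absurd h (thetaCross_ne_zero hq0 hq1 hr0 (hb0 j) s1 hj s2 s3)
  rw [hC lam mu hlam hmu h2, hC0, zero_mul]

/-- The zeros in `s` are of the form q^n/c_j or p c_j q^{-n}. Distinct `j` within a family are
separated by the condition on c_i/c_j, the two families by the condition on p c_i c_j. -/
lemma simpleZeros_pairProd_sixVec (hq0 : q ≠ 0) (hq1 : ‖q‖ < 1) {p : ℂ} (hp0 : p ≠ 0)
    {c : Fin 4 → ℂ} (hc0 : ∀ j, c j ≠ 0)
    (hK : qPochInf q q * qPochInf q (q / p) *
        (∏ i, ∏ j ∈ Finset.Ioi i, qPochInf q (q / (c i * c j))) ≠ 0)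
    (hdiv : ∀ i j, i ≠ j → ∀ n : ℤ, c i / c j ≠ q ^ n)
    (hpcc : ∀ i j, ∀ n : ℤ, p * (c i * c j) ≠ q ^ n) :
    SimpleZeros (fun s => pairProd q (sixVec s (p / s) c)) := by
  have hP := simpleZeros_qPochInf hq0 hq1
  have a1 : ∀ j, SimpleZeros (fun s => qPochInf q (q / c j / s)) := fun j =>
    hP.comp (φ := fun s => q / c j / s) fun z hz => ⟨div_ne_zero (div_ne_zero hq0 (hc0 j)) hz, _,
      div_ne_zero (neg_ne_zero.2 (div_ne_zero hq0 (hc0 j))) (pow_ne_zero 2 hz),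
      hasDerivAt_const_div _ hz⟩
  have hd0 : ∀ j, q / (p * c j) ≠ 0 := fun j => div_ne_zero hq0 (mul_ne_zero hp0 (hc0 j))
  have a2 : ∀ j, SimpleZeros (fun s => qPochInf q (q / (p * c j) * s)) := fun j =>
    hP.comp (φ := fun s => q / (p * c j) * s) fun z hz => ⟨mul_ne_zero (hd0 j) hz, _, hd0 j,
      hasDerivAt_const_mul _ z⟩
  have z1 : ∀ j z, z ≠ 0 → qPochInf q (q / c j / z) = 0 → ∃ n : ℤ, z = q ^ n / c j := by
    intro j z hz h
    obtain ⟨n, hn⟩ := (qPochInf_eq_zero_iff hq1).1 h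
    refine ⟨n + 1, ?_⟩
    have := hc0 j
    rw [zpow_add_one₀ hq0, zpow_natCast, eq_div_iff this]
    field_simp at hn
    linear_combination -hn
  have z2 : ∀ j z, z ≠ 0 → qPochInf q (q / (p * c j) * z) = 0 → ∃ n : ℤ, z * q ^ n = p * c j := by
    intro j z hz h
    obtain ⟨n, hn⟩ := (qPochInf_eq_zero_iff hq1).1 h
    refine ⟨n + 1, ?_⟩
    have := hc0 j
    rw [zpow_add_one₀ hq0, zpow_natCast]
    field_simp at hn
    rw [← hn]; ring
  have b1 := SimpleZeros.finset_prod Finset.univ (fun j _ => a1 j) (fun i _ j _ hij z hz h h' => by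
    obtain ⟨n, hn⟩ := z1 i z hz h
    obtain ⟨m, hm⟩ := z1 j z hz h'
    refine hdiv i j hij (n - m) ?_
    rw [zpow_sub₀ hq0]
    rw [hn] at hm
    have := hc0 i
    have := hc0 j
    have := zpow_ne_zero m hq0
    field_simp at hm ⊢
    linear_combination -hm)
  have b2 := SimpleZeros.finset_prod Finset.univ (fun j _ => a2 j) (fun i _ j _ hij z hz h h' => by
    obtain ⟨n, hn⟩ := z2 i z hz h
    obtain ⟨m, hm⟩ := z2 j z hz h'
    refine hdiv i j hij (n - m) ?_
    have : c i / c j = (p * c i) / (p * c j) := by rw [mul_div_mul_left _ _ hp0]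
    rw [this, ← hn, ← hm, mul_div_mul_left _ _ hz, zpow_sub₀ hq0])
  have b3 := (b1.mul b2 (fun z hz h h' => by
    obtain ⟨i, -, hi⟩ := Finset.prod_eq_zero_iff.1 h
    obtain ⟨j, -, hj⟩ := Finset.prod_eq_zero_iff.1 h'
    obtain ⟨n, hn⟩ := z1 i z hz hi
    obtain ⟨m, hm⟩ := z2 j z hz hj
    refine hpcc i j (n + m) ?_
    rw [zpow_add₀ hq0, mul_left_comm, ← hm, hn]
    have := hc0 i
    field_simp)).const_mul hK
  have e : ∀ s, s ≠ 0 → pairProd q (sixVec s (p / s) c) = qPochInf q q * qPochInf q (q / p) *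
      (∏ i, ∏ j ∈ Finset.Ioi i, qPochInf q (q / (c i * c j))) *
      ((∏ j, qPochInf q (q / c j / s)) * ∏ j, qPochInf q (q / (p * c j) * s)) := by
    intro s hs
    rw [pairProd_sixVec, mul_div_cancel₀ _ hs]
    congr 2
    · refine Finset.prod_congr rfl fun j _ => ?_
      rw [div_div, mul_comm s]
    · refine Finset.prod_congr rfl fun j _ => ?_
      congr 1
      have := hc0 j
      field_simp
  intro z hz
  have hev : (fun s => pairProd q (sixVec s (p / s) c)) =ᶠ[𝓝 z]
      fun s => qPochInf q q * qPochInf q (q / p) *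
      (∏ i, ∏ j ∈ Finset.Ioi i, qPochInf q (q / (c i * c j))) *
      ((∏ j, qPochInf q (q / c j / s)) * ∏ j, qPochInf q (q / (p * c j) * s)) := by
    filter_upwards [isOpen_compl_singleton.mem_nhds hz] with s hs using e s hs
  obtain ⟨k1, k2⟩ := b3 z hz
  refine ⟨k1.congr_of_eventuallyEq hev, fun h0 => ?_⟩
  rw [hev.deriv_eq]
  exact k2 ((e z hz).symm.trans h0)

lemma differentiableAt_casoratian (hq0 : q ≠ 0) (hq1 : ‖q‖ < 1) {p : ℂ} (hp0 : p ≠ 0)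
    {c : Fin 4 → ℂ} (hprod : p * ∏ j, c j = q) {lam mu : ℂ} (hlam : lam ≠ 0) (hmu : mu ≠ 0)
    {z : ℂ} (hz : z ≠ 0) :
    DifferentiableAt ℂ (fun s => casoratian q (sixVec s (p / s) c) lam mu) z := by
  have hT : ∀ lam, lam ≠ 0 →
      DifferentiableAt ℂ (fun s => thetaDiff q (sixVec s (p / s) c) lam) z := fun lam hlam =>
    (differentiableOn_thetaDiff_sixVec hq1 hp0 hlam).differentiableAt
      (isOpen_compl_singleton.mem_nhds hz)
  have hL : ∀ lam, lam ≠ 0 →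
      DifferentiableAt ℂ (fun s => latticeSum q (sixVec s (p / s) c) lam) z := fun lam hlam => by
    refine (differentiableOn_latticeSum hq0 hq1 (b := fun j s => sixVec s (p / s) c j)
      (φ := fun _ => lam) isOpen_compl_singleton (fun j => ?_) (differentiableOn_const _)
      (fun _ _ => hlam) (fun s hs => ?_)).differentiableAt (isOpen_compl_singleton.mem_nhds hz)
    · refine Fin.cases ?_ (fun j => Fin.cases ?_ (fun j => ?_) j) j
      · exact differentiableOn_id
      · exact fun s hs => (hasDerivAt_const_div p hs).differentiableAt.differentiableWithinAt
      · exact differentiableOn_const _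
    · have hs' : s ≠ 0 := hs
      rw [prod_sixVec (fun b => b), mul_div_cancel₀ _ hs', hprod]
  exact ((hT lam hlam).mul (hL mu hmu)).sub ((hT mu hmu).mul (hL lam hlam))

/-- The evaluation of the determinant for generic parameters with `|b₀ b₁| < 1`. -/
lemma casoratian_eq_of_generic (hq0 : q ≠ 0) (hq1 : ‖q‖ < 1) {p : ℂ} (hp1 : ‖p‖ < 1)
    {c : Fin 4 → ℂ} (hprod : p * ∏ j, c j = q) (hp : ∀ n : ℤ, p ≠ q ^ n)
    (hcc : ∀ i j, ∀ n : ℤ, c i * c j ≠ q ^ n) (hdiv : ∀ i j, i ≠ j → ∀ n : ℤ, c i / c j ≠ q ^ n)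
    (hpcc : ∀ i j, ∀ n : ℤ, p * (c i * c j) ≠ q ^ n) {s : ℂ} (hs : s ≠ 0) {lam mu : ℂ}
    (hlam : lam ≠ 0) (hmu : mu ≠ 0) (h2 : ∀ n : ℤ, mu ^ 2 ≠ q ^ n) :
    casoratian q (sixVec s (p / s) c) lam mu =
      pairProd q (sixVec s (p / s) c) * thetaCross q lam mu := by
  have hQ : 0 < ‖q‖ := norm_pos_iff.2 hq0
  have hp0 : p ≠ 0 := fun h => hq0 (by rw [← hprod, h, zero_mul])
  have hpn : 0 < ‖p‖ := norm_pos_iff.2 hp0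
  have hcp : ∏ j, c j ≠ 0 := right_ne_zero_of_mul (by rw [hprod]; exact hq0)
  have hc0 : ∀ j, c j ≠ 0 := fun j => Finset.prod_ne_zero_iff.1 hcp j (Finset.mem_univ j)
  have hcn : ∀ j, 0 < ‖c j‖ := fun j => norm_pos_iff.2 (hc0 j)
  have hsix : ∀ s, s ≠ 0 → ∏ j, sixVec s (p / s) c j = q := fun s hs => by
    rw [prod_sixVec (fun b => b), mul_div_cancel₀ _ hs, hprod]
  have hsix0 : ∀ s, s ≠ 0 → ∀ j, sixVec s (p / s) c j ≠ 0 := fun s hs j h => hq0 (by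
    rw [← hsix s hs, Finset.prod_eq_zero (Finset.mem_univ j) h])
  obtain ⟨lam0, mu0, hlam0, hmu0, hmu02, htc⟩ := exists_thetaCross_ne_zero hq0 hq1
  have hK : qPochInf q q * qPochInf q (q / p) *
        (∏ i, ∏ j ∈ Finset.Ioi i, qPochInf q (q / (c i * c j))) ≠ 0 := by
    refine mul_ne_zero (mul_ne_zero (qPochInf_self_ne_zero hq1) (qPochInf_div_ne_zero hq0 hq1 hp)) ?_
    exact Finset.prod_ne_zero_iff.2 fun i _ => Finset.prod_ne_zero_iff.2 fun j _ =>
      qPochInf_div_ne_zero hq0 hq1 (hcc i j)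
  have hg := simpleZeros_pairProd_sixVec hq0 hq1 hp0 hc0 hK hdiv hpcc
  -- `h` is the determinant divided by `pairProd` as a function of s ≠ 0, at the fixed pair (λ₀,
  -- μ₀).
  obtain ⟨h, hh, hfgh⟩ := hg.exists_eq_mul
    (f := fun s => casoratian q (sixVec s (p / s) c) lam0 mu0)
    (fun z hz => differentiableAt_casoratian hq0 hq1 hp0 hprod hlam0 hmu0 hz) (by
      intro z hz h0
      rw [pairProd_sixVec, mul_div_cancel₀ _ hz] at h0
      rcases mul_eq_zero.1 ((mul_eq_zero.1 h0).resolve_left hK) with h0 | h0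
      · obtain ⟨j, -, hj⟩ := Finset.prod_eq_zero_iff.1 h0
        exact casoratian_eq_zero_of_pairProd_eq_zero hq0 hq1 (hsix0 z hz) (hsix z hz) (i := 0)
          (j := j.succ.succ) (fun n => by rw [sixVec_succ_succ, sq]; exact hcc j j n) hj hlam0 hmu0
          hmu02
      · obtain ⟨j, -, hj⟩ := Finset.prod_eq_zero_iff.1 h0
        exact casoratian_eq_zero_of_pairProd_eq_zero hq0 hq1 (hsix0 z hz) (hsix z hz) (i := 1)
          (j := j.succ.succ) (fun n => by rw [sixVec_succ_succ, sq]; exact hcc j j n) hj hlam0 hmu0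
          hmu02)
  -- a circle avoiding all zeros
  obtain ⟨ρ, hρ, hρS⟩ := exists_pos_notMem_of_countable
    ((Set.countable_range (fun x : Fin 4 × ℤ => ‖q‖ ^ x.2 / ‖c x.1‖)).union
      (Set.countable_range (fun x : Fin 4 × ℤ => ‖p * c x.1‖ * ‖q‖ ^ x.2)))
  rw [Set.mem_union, not_or] at hρS
  have r1 : ∀ j, ∀ n : ℤ, ρ * ‖c j‖ ≠ ‖q‖ ^ n := fun j n hn => hρS.1 ⟨(j, n), by
    simp only [← hn]; exact mul_div_cancel_right₀ _ (hcn j).ne'⟩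
  have r2 : ∀ j, ∀ n : ℤ, ρ ≠ ‖p * c j‖ * ‖q‖ ^ n := fun j n hn => hρS.2 ⟨(j, n), hn.symm⟩
  -- The map s → p/s exchanges the first two parameters, so the circle of radius |p|/ρ inherits the
  -- zero-free conditions.
  have r1' : ∀ j, ∀ n : ℤ, ‖p‖ / ρ * ‖c j‖ ≠ ‖q‖ ^ n := fun j n hn => r2 j (-n) (by
    have := (hcn j).ne'
    rw [zpow_neg, ← hn, norm_mul]; field_simp)
  have r2' : ∀ j, ∀ n : ℤ, ‖p‖ / ρ ≠ ‖p * c j‖ * ‖q‖ ^ n := fun j n hn => r1 j (-n) (by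
    rw [norm_mul] at hn
    have hqn : ‖q‖ ^ n ≠ 0 := zpow_ne_zero _ hQ.ne'
    have := (hcn j).ne'
    field_simp at hn
    rw [zpow_neg]
    exact eq_inv_of_mul_eq_one_left hn.symm)
  obtain ⟨M1, hM1⟩ := exists_norm_casoratian_le hq0 hq1 hp0 hp1 hprod hK hρ r1 r2 hlam0 hmu0
  obtain ⟨M2, hM2⟩ := exists_norm_casoratian_le hq0 hq1 hp0 hp1 hprod hK (div_pos hpn hρ) r1' r2'
    hlam0 hmu0
  have hgne : ∀ k : ℤ, ∀ z : ℂ, ‖z‖ = ρ * ‖q‖ ^ k → z ≠ 0 ∧ pairProd q (sixVec z (p / z) c) ≠ 0 := by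
    intro k z hz
    have hz0 : z ≠ 0 := by rw [← norm_pos_iff, hz]; positivity
    refine ⟨hz0, ?_⟩
    have hqk : ‖q‖ ^ k ≠ 0 := zpow_ne_zero _ hQ.ne'
    rw [pairProd_sixVec, mul_div_cancel₀ _ hz0]
    refine mul_ne_zero hK (mul_ne_zero ?_ ?_)
    · refine Finset.prod_ne_zero_iff.2 fun j _ => qPochInf_div_ne_zero hq0 hq1 fun n hn => ?_
      refine r1 j (n - k) ?_
      rw [zpow_sub₀ hQ.ne', ← norm_zpow q n, ← hn, norm_mul, hz]
      field_simp
    · refine Finset.prod_ne_zero_iff.2 fun j _ => qPochInf_div_ne_zero hq0 hq1 fun n hn => ?_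
      refine r2 j (-n - k) ?_
      have hcj := (hcn j).ne'
      rw [zpow_sub₀ hQ.ne', zpow_neg, ← norm_zpow q n, ← hn, norm_mul (p / z), norm_div, hz, norm_mul p]
      field_simp
  obtain ⟨C, hC⟩ := exists_const_of_bounded_on_circles hh hQ hq1 hρ (M := max M1 M2) (by
    intro k z hz
    obtain ⟨hz0, hgz⟩ := hgne k z hz
    have hgz' : 0 < ‖pairProd q (sixVec z (p / z) c)‖ := norm_pos_iff.2 hgz
    have key : ‖casoratian q (sixVec z (p / z) c) lam0 mu0‖ ≤
        max M1 M2 * ‖pairProd q (sixVec z (p / z) c)‖ := by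
      obtain ⟨m, rfl | rfl⟩ := k.eq_nat_or_neg
      · have hqm := pow_ne_zero m hq0
        have hqm' : ‖q‖ ^ m ≠ 0 := pow_ne_zero m hQ.ne'
        have e : z / q ^ m * q ^ m = z := div_mul_cancel₀ _ hqm
        have := hM1 m (z / q ^ m) (by
          rw [norm_div, hz, norm_pow, zpow_natCast]; field_simp)
        rw [e] at this
        exact this.trans (mul_le_mul_of_nonneg_right (le_max_left _ _) hgz'.le)
      -- On circles of radius ρ|q|^{-m} the growth estimate is applied to p/z, of modulus
      -- (|p|/ρ)|q|^m, and the swap of the first two parameters returns to `z`.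
      · have hqm := pow_ne_zero m hq0
        have hqm' : ‖q‖ ^ m ≠ 0 := pow_ne_zero m hQ.ne'
        have e : p / z / q ^ m * q ^ m = p / z := div_mul_cancel₀ _ hqm
        have := hM2 m (p / z / q ^ m) (by
          rw [norm_div, norm_div, hz, norm_pow, zpow_neg, zpow_natCast]; field_simp)
        rw [e, div_div_cancel₀ hp0, casoratian_sixVec_swap, pairProd_sixVec_swap] at this
        exact this.trans (mul_le_mul_of_nonneg_right (le_max_right _ _) hgz'.le)
    have h3 := hfgh z hz0
    rw [h3, norm_mul, mul_comm (max M1 M2)] at key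
    exact le_of_mul_le_mul_left key hgz')
  -- evaluation of the constant
  have hs1 : (c 0)⁻¹ ≠ 0 := inv_ne_zero (hc0 0)
  have hCval : C = thetaCross q lam0 mu0 := by
    obtain ⟨C1, hC1⟩ := exists_casoratian_eq hq0 hq1 (hsix _ hs1)
    have h01 : thetaCross q (c 0) (c 1) ≠ 0 :=
      thetaCross_ne_zero hq0 hq1 (hc0 0) (hc0 1) (fun n => by rw [sq]; exact hcc 0 0 n)
        (fun n => by rw [sq]; exact hcc 1 1 n) (hcc 0 1) (hdiv 1 0 (by decide))
    have e1 := casoratian_of_mul_eq_one hq0 hq1 hc0 (div_ne_zero hp0 hs1)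
      (by rw [mul_div_cancel₀ _ hs1, hprod])
    rw [hC1 _ _ (hc0 0) (hc0 1) (fun n => by rw [sq]; exact hcc 1 1 n)] at e1
    have e2 := mul_right_cancel₀ h01 e1
    have hg1 : pairProd q (sixVec (c 0)⁻¹ (p / (c 0)⁻¹) c) ≠ 0 := by
      rw [pairProd_sixVec, mul_div_cancel₀ _ hs1]
      refine mul_ne_zero hK (mul_ne_zero ?_ ?_)
      · refine Finset.prod_ne_zero_iff.2 fun j _ => ?_
        by_cases hj : j = 0
        · rw [hj, inv_mul_cancel₀ (hc0 0), div_one]; exact qPochInf_self_ne_zero hq1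
        · rw [inv_mul_eq_div]
          exact qPochInf_div_ne_zero hq0 hq1 (hdiv j 0 hj)
      · refine Finset.prod_ne_zero_iff.2 fun j _ => ?_
        rw [div_inv_eq_mul, mul_assoc]
        exact qPochInf_div_ne_zero hq0 hq1 (hpcc 0 j)
    have e3 := hfgh _ hs1
    rw [hC _ hs1, hC1 lam0 mu0 hlam0 hmu0 hmu02, e2] at e3
    exact (mul_left_cancel₀ hg1 e3).symm
  -- The value of `h` at `s` fixes the proportionality constant there, and this constant serves
  -- every pair (λ, μ).
  obtain ⟨C2, hC2⟩ := exists_casoratian_eq hq0 hq1 (hsix s hs)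
  have e4 := hfgh s hs
  rw [hC s hs, hCval, hC2 lam0 mu0 hlam0 hmu0 hmu02] at e4
  rw [hC2 lam mu hlam hmu h2, mul_right_cancel₀ htc e4]

end Generic

end Rahman

namespace Rahman

open Filter Topology

/-! ### Analytic continuation to all admissible parameters. -/

section Extension

variable {q : ℂ}

/-- Positive real roots are unique, so each `n` excludes at most one `r`. -/
lemma countable_setOf_mul_pow_eq_zpow {A : ℂ} (hA : A ≠ 0) {k : ℕ} (hk : k ≠ 0) :
    {r : ℝ | 0 < r ∧ ∃ n : ℤ, A * (r : ℂ) ^ k = q ^ n}.Countable := by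
  have : {r : ℝ | 0 < r ∧ ∃ n : ℤ, A * (r : ℂ) ^ k = q ^ n} ⊆
      ⋃ n : ℤ, {r : ℝ | 0 < r ∧ A * (r : ℂ) ^ k = q ^ n} := fun r ⟨hr, n, hn⟩ =>
    Set.mem_iUnion.2 ⟨n, hr, hn⟩
  refine (Set.countable_iUnion fun n => Set.Subsingleton.countable ?_).mono this
  rintro r ⟨hr, h⟩ r' ⟨hr', h'⟩
  have e := mul_left_cancel₀ hA (h.trans h'.symm)
  exact (pow_left_inj₀ hr.le hr'.le hk).1 (by exact_mod_cast e)

/-- The deformation `(b₀ r², b₁ r², b₂ / r, …, b₅ / r)` of the parameters. -/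
noncomputable def deform (b : Fin 6 → ℂ) (r : ℂ) : Fin 6 → ℂ :=
  sixVec (b 0 * r ^ 2) (b 1 * r ^ 2) fun j => b j.succ.succ * r⁻¹

lemma deform_one (b : Fin 6 → ℂ) : deform b 1 = b := by
  funext j
  refine Fin.cases ?_ (fun j => Fin.cases ?_ (fun j => ?_) j) j <;> simp [deform, sixVec]

lemma prod_eq_mul_prod_succ_succ (b : Fin 6 → ℂ) :
    ∏ j, b j = b 0 * b 1 * ∏ j : Fin 4, b j.succ.succ := by
  rw [Fin.prod_univ_succ, Fin.prod_univ_succ, mul_assoc]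
  rfl

lemma prod_deform (b : Fin 6 → ℂ) {r : ℂ} (hr : r ≠ 0) : ∏ j, deform b r j = ∏ j, b j := by
  rw [deform, prod_sixVec (fun x => x), prod_eq_mul_prod_succ_succ, Finset.prod_mul_distrib,
    Finset.prod_const, Finset.card_univ, Fintype.card_fin]
  field_simp

lemma differentiableOn_deform (b : Fin 6 → ℂ) (j : Fin 6) :
    DifferentiableOn ℂ (fun r => deform b r j) {0}ᶜ := by
  refine Fin.cases ?_ (fun j => Fin.cases ?_ (fun j => ?_) j) j
  · exact (differentiableOn_pow 2).const_mul _
  · exact (differentiableOn_pow 2).const_mul _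
  · exact (differentiableOn_inv.mono fun x hx => hx).const_mul _

lemma differentiableAt_thetaDiff (hq1 : ‖q‖ < 1) {b : Fin 6 → ℂ → ℂ} {w : ℂ}
    (hb : ∀ j, DifferentiableAt ℂ (b j) w) (hb0 : ∀ j, b j w ≠ 0) {mu : ℂ} (hmu : mu ≠ 0) :
    DifferentiableAt ℂ (fun v => thetaDiff q (fun j => b j v) mu) w := by
  have h : ∀ mu, mu ≠ 0 → DifferentiableAt ℂ (fun v => thetaHalf q (fun j => b j v) mu) w :=
    fun mu hmu => DifferentiableAt.const_mul (DifferentiableAt.fun_finsetProd fun j _ =>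
      (differentiableAt_theta hq1 (mul_ne_zero hmu (hb0 j))).comp w ((hb j).const_mul mu)) _
  exact (h mu hmu).sub (h _ (inv_ne_zero hmu))

lemma differentiableAt_pairProd (hq1 : ‖q‖ < 1) {b : Fin 6 → ℂ → ℂ} {w : ℂ}
    (hb : ∀ j, DifferentiableAt ℂ (b j) w) (hb0 : ∀ j, b j w ≠ 0) :
    DifferentiableAt ℂ (fun v => pairProd q (fun j => b j v)) w :=
  DifferentiableAt.const_mul (DifferentiableAt.fun_finsetProd fun i _ =>
    DifferentiableAt.fun_finsetProd fun j _ => (differentiable_qPochInf hq1 _).comp w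
      ((differentiableAt_const q).div ((hb i).mul (hb j)) (mul_ne_zero (hb0 i) (hb0 j)))) _

lemma IsParameter.div_ne' {b : Fin 6 → ℂ} (hb : IsParameter q b) {i j : Fin 6}
    (h : i ≠ j) (n : ℤ) : b i / b j ≠ q ^ n := by
  rcases lt_or_gt_of_ne h with h | h
  · exact hb.div_ne i j h n
  · intro e
    refine hb.div_ne j i h (-n) ?_
    rw [zpow_neg, ← e, inv_div]

lemma IsParameter.mul_ne' {b : Fin 6 → ℂ} (hb : IsParameter q b) (i j : Fin 6) (n : ℤ) :
    b i * b j ≠ q ^ n := by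
  rcases le_total i j with h | h
  · exact hb.mul_ne i j h n
  · rw [mul_comm]; exact hb.mul_ne j i h n

lemma IsParameter.ne_zero (hq0 : q ≠ 0) {b : Fin 6 → ℂ} (hb : IsParameter q b) (j : Fin 6) :
    b j ≠ 0 := fun h => hq0 (by rw [← hb.balanced, Finset.prod_eq_zero (Finset.mem_univ j) h])

/-- The evaluation of the determinant of the two odd theta functions. -/
theorem casoratian_eq (hq0 : q ≠ 0) (hq1 : ‖q‖ < 1) {b : Fin 6 → ℂ} (hb : IsParameter q b)
    {lam mu : ℂ} (hlam : lam ≠ 0) (hmu : mu ≠ 0) (h2 : ∀ n : ℤ, mu ^ 2 ≠ q ^ n) :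
    casoratian q b lam mu = pairProd q b * thetaCross q lam mu := by
  have hb0 := hb.ne_zero hq0
  have hd0 : ∀ r : ℂ, r ≠ 0 → ∀ j, deform b r j ≠ 0 := fun r hr j h => hq0 (by
    rw [← hb.balanced, ← prod_deform b hr, Finset.prod_eq_zero (Finset.mem_univ j) h])
  have hU : IsOpen ({0}ᶜ : Set ℂ) := isOpen_compl_singleton
  have hdiff : DifferentiableOn ℂ (fun r => casoratian q (deform b r) lam mu) {0}ᶜ := by
    have hL : ∀ lam, lam ≠ 0 → DifferentiableOn ℂ (fun r => latticeSum q (deform b r) lam) {0}ᶜ :=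
      fun lam hlam => differentiableOn_latticeSum hq0 hq1 (b := fun j r => deform b r j)
        (φ := fun _ => lam) hU (differentiableOn_deform b) (differentiableOn_const _)
        (fun _ _ => hlam) (fun r hr => by rw [prod_deform b hr, hb.balanced])
    have hT : ∀ lam, lam ≠ 0 → DifferentiableOn ℂ (fun r => thetaDiff q (deform b r) lam) {0}ᶜ :=
      fun lam hlam r hr => (differentiableAt_thetaDiff hq1 (b := fun j r => deform b r j)
        (fun j => (differentiableOn_deform b j).differentiableAt (hU.mem_nhds hr)) (hd0 r hr)
        hlam).differentiableWithinAt
    exact ((hT lam hlam).mul (hL mu hmu)).sub ((hT mu hmu).mul (hL lam hlam))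
  have hdiff' : DifferentiableOn ℂ (fun r => pairProd q (deform b r) * thetaCross q lam mu) {0}ᶜ :=
    fun r hr => ((differentiableAt_pairProd hq1 (b := fun j r => deform b r j)
      (fun j => (differentiableOn_deform b j).differentiableAt (hU.mem_nhds hr))
      (hd0 r hr)).mul_const _).differentiableWithinAt
  -- The values of `r` at which a genericity condition of `casoratian_eq_of_generic` fails. The
  -- ratios c_i/c_j do not depend on `r`, so they contribute nothing.
  set S : Set ℝ := {r : ℝ | 0 < r ∧ ∃ n : ℤ, b 0 * b 1 * (r : ℂ) ^ 4 = q ^ n} ∪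
    ⋃ i : Fin 4, ⋃ j : Fin 4,
      ({r : ℝ | 0 < r ∧ ∃ n : ℤ, (b i.succ.succ * b j.succ.succ)⁻¹ * (r : ℂ) ^ 2 = q ^ n} ∪
        {r : ℝ | 0 < r ∧ ∃ n : ℤ,
          b 0 * b 1 * (b i.succ.succ * b j.succ.succ) * (r : ℂ) ^ 2 = q ^ n})
  have h01 := mul_ne_zero (hb0 0) (hb0 1)
  have hS : S.Countable := by
    refine (countable_setOf_mul_pow_eq_zpow h01 four_ne_zero).union
      (Set.countable_iUnion fun i => Set.countable_iUnion fun j => ?_)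
    have hij := mul_ne_zero (hb0 i.succ.succ) (hb0 j.succ.succ)
    exact (countable_setOf_mul_pow_eq_zpow (inv_ne_zero hij) two_ne_zero).union
      (countable_setOf_mul_pow_eq_zpow (mul_ne_zero h01 hij) two_ne_zero)
  -- for small real `r` outside of `S` the parameters are generic
  have hreal : ∀ r : ℝ, 0 < r → r ∉ S → ‖b 0 * b 1‖ * r ^ 4 < 1 →
      casoratian q (deform b r) lam mu = pairProd q (deform b r) * thetaCross q lam mu := by
    intro r hr hrS hr1
    have hr0 : (r : ℂ) ≠ 0 := by exact_mod_cast hr.ne'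
    simp only [S, Set.mem_union, Set.mem_iUnion, not_or, not_exists, Set.mem_ofPred_eq, not_and] at hrS
    obtain ⟨s1, s2⟩ := hrS
    have hdef : deform b r = sixVec (b 0 * (r : ℂ) ^ 2)
        (b 0 * b 1 * (r : ℂ) ^ 4 / (b 0 * (r : ℂ) ^ 2)) fun j => b j.succ.succ * (r : ℂ)⁻¹ := by
      rw [deform]
      congr 1
      have := hb0 0
      field_simp
    rw [hdef]
    refine casoratian_eq_of_generic hq0 hq1 ?_ ?_ (s1 hr) ?_ ?_ ?_
      (mul_ne_zero (hb0 0) (pow_ne_zero 2 hr0)) hlam hmu h2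
    · rwa [norm_mul, norm_pow, Complex.norm_real, Real.norm_of_nonneg hr.le]
    · rw [← hb.balanced, prod_eq_mul_prod_succ_succ, Finset.prod_mul_distrib, Finset.prod_const,
        Finset.card_univ, Fintype.card_fin]
      field_simp
    · intro i j n hn
      refine (s2 i j).1 hr (-n) ?_
      rw [zpow_neg, ← hn]
      have := hb0 i.succ.succ
      have := hb0 j.succ.succ
      field_simp
    · intro i j hij n
      rw [mul_div_mul_right _ _ (inv_ne_zero hr0)]
      exact hb.div_ne' (by simpa using hij) n
    · intro i j n hn
      refine (s2 i j).2 hr n ?_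
      rw [← hn]
      field_simp
  -- For small `r` the product of the first two deformed parameters, b_0 b_1 r⁴, lies in the unit
  -- disc.
  obtain ⟨r₀, hr₀, hr₀1⟩ : ∃ r₀ : ℝ, 0 < r₀ ∧ ∀ r : ℝ, 0 < r → r < r₀ → ‖b 0 * b 1‖ * r ^ 4 < 1 := by
    have hN := norm_pos_iff.2 h01
    have hN1 : 0 < ‖b 0 * b 1‖ + 1 := by positivity
    refine ⟨(‖b 0 * b 1‖ + 1)⁻¹, inv_pos.2 hN1, fun r hr hr1 => ?_⟩
    have h1 : r ≤ 1 := hr1.le.trans (inv_le_one_of_one_le₀ (by linarith))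
    have h2 : r ^ 4 ≤ r := by
      calc r ^ 4 ≤ r ^ 1 := pow_le_pow_of_le_one hr.le h1 (by norm_num)
        _ = r := pow_one r
    rw [lt_inv_comm₀ hr hN1] at hr1
    calc ‖b 0 * b 1‖ * r ^ 4 ≤ ‖b 0 * b 1‖ * r := by gcongr
      _ < (‖b 0 * b 1‖ + 1) * r := by nlinarith
      _ < r⁻¹ * r := by gcongr
      _ = 1 := inv_mul_cancel₀ hr.ne'
  -- Real points below `r₀` and outside the countable set `S` accumulate at `r₀`. The identity
  -- theorem on the connected set r ≠ 0 then carries the equation to r = 1, where the deformation is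
  -- trivial.
  have hfreq : ∃ᶠ z in 𝓝[≠] (r₀ : ℂ), casoratian q (deform b z) lam mu =
      pairProd q (deform b z) * thetaCross q lam mu := by
    intro hev
    have ht : Tendsto (fun r : ℝ => (r : ℂ)) (𝓝[<] r₀) (𝓝[≠] (r₀ : ℂ)) := by
      refine tendsto_nhdsWithin_iff.2 ⟨Complex.continuous_ofReal.continuousAt.mono_left
        nhdsWithin_le_nhds, ?_⟩
      filter_upwards [self_mem_nhdsWithin] with r hr h
      exact (ne_of_lt (Set.mem_Iio.1 hr)) (Complex.ofReal_injective h)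
    obtain ⟨l, hl, hsub⟩ := (mem_nhdsLT_iff_exists_Ioo_subset' hr₀).1 (ht.eventually hev)
    obtain ⟨r, hr, hrS⟩ := (hS.dense_compl ℝ).exists_mem_open
      (isOpen_Ioo (a := max l 0) (b := r₀)) (Set.nonempty_Ioo.2 (max_lt hl hr₀))
    have hr0 : 0 < r := (le_max_right _ _).trans_lt hrS.1
    exact hsub ⟨(le_max_left _ _).trans_lt hrS.1, hrS.2⟩ (hreal r hr0 hr (hr₀1 r hr0 hrS.2))
  have hpre : IsPreconnected ({0}ᶜ : Set ℂ) :=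
    (isConnected_compl_singleton_of_one_lt_rank (by simp) 0).isPreconnected
  have := (hdiff.analyticOnNhd hU).eqOn_of_preconnected_of_frequently_eq
    (hdiff'.analyticOnNhd hU) hpre (z₀ := (r₀ : ℂ)) (by simpa using hr₀.ne') hfreq
    (show (1 : ℂ) ∈ ({0}ᶜ : Set ℂ) by simp)
  simpa only [deform_one] using this

end Extension

end Rahman

namespace Rahman

open Filter Topology

/-! ### Weights and coefficients in terms of odd theta functions. -/

section Weight

variable {q : ℂ}

lemma inv_avoids {a : ℂ} (ha : ∀ n : ℤ, a ≠ q ^ n) : ∀ n : ℤ, a⁻¹ ≠ q ^ n := fun n h =>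
  ha (-n) (by rw [zpow_neg, ← h, inv_inv])

lemma prod_zpow_eq_zpow_sum₀ {ι : Type*} (s : Finset ι) (f : ι → ℤ) (hq0 : q ≠ 0) :
    ∏ i ∈ s, q ^ f i = q ^ ∑ i ∈ s, f i := by
  classical
  induction s using Finset.induction_on with
  | empty => simp
  | insert a s ha ih => rw [Finset.prod_insert ha, Finset.sum_insert ha, ih, zpow_add₀ hq0]

/-- Each ratio of shifted factorials, multiplied by its part of O(λ), becomes the same part of O(λ
q^x) times a monomial. By balancing the monomials combine to λ^{6x} q^{3x²}. -/
lemma weight_mul_oddKernel (hq0 : q ≠ 0) (hq1 : ‖q‖ < 1) {b : Fin 6 → ℂ} (hb : ∏ j, b j = q)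
    {lam : ℂ} (hlam : lam ≠ 0) (h2 : lam ^ 2 ≠ 1) (hm : ∀ j, ∀ n : ℤ, lam * b j ≠ q ^ n)
    (hd : ∀ j, ∀ n : ℤ, lam / b j ≠ q ^ n) (x : ℤ) :
    weight q b lam x * oddKernel q b lam = latticeTerm q b lam x := by
  have hb0 : ∀ j, b j ≠ 0 := fun j h => hq0 (by
    rw [← hb, Finset.prod_eq_zero (Finset.mem_univ j) h])
  have hqx := zpow_ne_zero x hq0
  have key : ∀ j, qPoch q (lam * b j) x / qPoch q (q * lam / b j) x *
      (qPochInf q (q * lam / b j) * qPochInf q (q * lam⁻¹ / b j)) =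
      (-1) ^ x * lam ^ x * b j ^ x * q ^ (x * (x - 1) / 2) *
        (qPochInf q (q * (lam * q ^ x) / b j) * qPochInf q (q * (lam * q ^ x)⁻¹ / b j)) := by
    intro j
    have hd' : ∀ n : ℤ, q * lam / b j ≠ q ^ n := fun n => by
      have := mul_zpow_avoids hq0 (hd j) 1 n
      rwa [zpow_one, mul_comm, ← mul_div_assoc] at this
    have h1 := qPochInf_eq_qPoch_mul hq0 hq1 hd' x
    have h3 := qPochInf_div_zpow hq0 hq1 (mul_ne_zero hlam (hb0 j)) (hm j) x
    have hne := qPoch_ne_zero hq0 hq1 hd' x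
    have e1 : q / (lam * b j * q ^ x) = q * (lam * q ^ x)⁻¹ / b j := by
      have := hb0 j
      field_simp
    have e2 : q / (lam * b j) = q * lam⁻¹ / b j := by
      have := hb0 j
      field_simp
    have e3 : q * lam / b j * q ^ x = q * (lam * q ^ x) / b j := by ring
    rw [e1, e2] at h3
    rw [e3] at h1
    rw [h1, h3, zpow_neg, zpow_neg, mul_zpow]
    have a1 := zpow_ne_zero x hlam
    have a2 := zpow_ne_zero x (hb0 j)
    have a3 := zpow_ne_zero (x * (x - 1) / 2) hq0
    have a4 : ((-1 : ℂ) ^ x) * (-1) ^ x = 1 := by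
      rw [← mul_zpow]; simp
    rw [div_mul_eq_mul_div, div_eq_iff hne]
    field_simp
    rw [sq, a4]
    ring
  have hprod : (∏ j, qPoch q (lam * b j) x / qPoch q (q * lam / b j) x) *
      ∏ j, (qPochInf q (q * lam / b j) * qPochInf q (q * lam⁻¹ / b j)) =
      ((-1) ^ x * lam ^ x) ^ 6 * q ^ x * (q ^ (x * (x - 1) / 2)) ^ 6 *
        ∏ j, (qPochInf q (q * (lam * q ^ x) / b j) * qPochInf q (q * (lam * q ^ x)⁻¹ / b j)) := by
    rw [← Finset.prod_mul_distrib, Finset.prod_congr rfl fun j _ => key j, Finset.prod_mul_distrib,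
      Finset.prod_mul_distrib, Finset.prod_mul_distrib, Finset.prod_zpow _ _ x, hb, Finset.prod_const,
      Finset.prod_const, Finset.card_univ, Fintype.card_fin]
  have hsign : ((-1 : ℂ) ^ x * lam ^ x) ^ 6 = lam ^ (6 * x) := by
    rw [mul_pow, ← zpow_natCast, ← zpow_natCast, ← zpow_mul, ← zpow_mul, mul_comm x]
    rw [zpow_mul (-1 : ℂ)]
    norm_num
  have hq6 : q ^ x * (q ^ (x * (x - 1) / 2)) ^ 6 * q ^ x * q ^ x = q ^ (3 * x ^ 2) := by
    rw [← zpow_natCast, ← zpow_mul, ← zpow_add₀ hq0, ← zpow_add₀ hq0, ← zpow_add₀ hq0]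
    congr 1
    have := two_mul_choose_two x
    push_cast
    linear_combination 3 * this
  have hden : 1 - lam ^ 2 ≠ 0 := sub_ne_zero.2 h2.symm
  have hpre : (1 - lam ^ 2 * q ^ (2 * x)) / (1 - lam ^ 2) * (lam - lam⁻¹) =
      q ^ x * (lam * q ^ x - (lam * q ^ x)⁻¹) := by
    rw [two_mul, zpow_add₀ hq0]
    field_simp
    ring
  calc weight q b lam x * oddKernel q b lam
      = (1 - lam ^ 2 * q ^ (2 * x)) / (1 - lam ^ 2) * (lam - lam⁻¹) * q ^ x *
        ((∏ j, qPoch q (lam * b j) x / qPoch q (q * lam / b j) x) *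
          ∏ j, (qPochInf q (q * lam / b j) * qPochInf q (q * lam⁻¹ / b j))) := by
        rw [weight, oddKernel]; ring
    _ = _ := by
        rw [hpre, hprod, hsign, latticeTerm, oddKernel, ← hq6]; ring

lemma theta_inv_mul_prod (hq1 : ‖q‖ < 1) {b : Fin 6 → ℂ} (hb : ∏ j, b j = q)
    (hb0 : ∀ j, b j ≠ 0) {mu : ℂ} (hmu : mu ≠ 0) :
    ∏ j, theta q (mu⁻¹ * b j) = q / mu ^ 6 * ∏ j, theta q (mu / b j) := by
  have : ∀ j, theta q (mu⁻¹ * b j) = -mu⁻¹ * b j * theta q (mu / b j) := fun j => by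
    rw [show mu⁻¹ * b j = (mu / b j)⁻¹ by rw [inv_div]; ring, theta_inv hq1 (div_ne_zero hmu (hb0 j)),
      inv_div]
    ring
  rw [Finset.prod_congr rfl fun j _ => this j, Finset.prod_mul_distrib, Finset.prod_mul_distrib, hb,
    Finset.prod_const, Finset.card_univ, Fintype.card_fin]
  field_simp

/-- The braces in the coefficient are μ² times the odd theta function, and 1 - λ² = -λ(λ - 1/λ)
produces the sign. In this form the two-term combination is a determinant divided by its value. -/
lemma coeff_eq (hq0 : q ≠ 0) (hq1 : ‖q‖ < 1) {b : Fin 6 → ℂ} (hb : ∏ j, b j = q) {lam mu : ℂ}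
    (hlam : lam ≠ 0) (hmu : mu ≠ 0) :
    coeff q b lam mu =
      -(oddKernel q b lam * thetaDiff q b mu) / (pairProd q b * thetaCross q lam mu) := by
  have hb0 : ∀ j, b j ≠ 0 := fun j h => hq0 (by
    rw [← hb, Finset.prod_eq_zero (Finset.mem_univ j) h])
  have e1 : thetaDiff q b mu = (mu ^ 2)⁻¹ *
      ((∏ j, theta q (mu * b j)) - q / mu ^ 2 * ∏ j, theta q (mu / b j)) := by
    rw [thetaDiff, thetaHalf, thetaHalf, theta_inv_mul_prod hq1 hb hb0 hmu]
    field_simp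
  have hc : lam * mu ^ 2 ≠ 0 := mul_ne_zero hlam (pow_ne_zero 2 hmu)
  rw [coeff, ← mul_div_mul_left _ (pairProd q b * thetaCross q lam mu) hc, e1, oddKernel, pairProd,
    thetaCross]
  generalize ∏ j, (qPochInf q (q * lam / b j) * qPochInf q (q * lam⁻¹ / b j)) = O
  congr 1
  · field_simp
    ring
  · field_simp

end Weight

/-! ### Absorbing a shifted product into the parameters. -/

section Shift

variable {q : ℂ}

/-- The parameters `b_j q^{k_j}`. -/
noncomputable def shiftParam (q : ℂ) (b : Fin 6 → ℂ) (k : Fin 6 → ℤ) : Fin 6 → ℂ := fun j => b j * q ^ k j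

/-- The product `∏ q^{k_j(k_j-1)/2} b_j^{k_j}`. -/
noncomputable def shiftScale (q : ℂ) (b : Fin 6 → ℂ) (k : Fin 6 → ℤ) : ℂ :=
  ∏ j, (q ^ (k j * (k j - 1) / 2) * b j ^ k j)

/-- The shifted product `∏ (b_j z, b_j / z)_{k_j}`. -/
noncomputable def shiftedProduct (q : ℂ) (b : Fin 6 → ℂ) (k : Fin 6 → ℤ) (z : ℂ) : ℂ :=
  ∏ j, (qPoch q (b j * z) (k j) * qPoch q (b j / z) (k j))

lemma IsParameter.shiftParam (hq0 : q ≠ 0) {b : Fin 6 → ℂ} (hb : IsParameter q b) {k : Fin 6 → ℤ}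
    (hk : ∑ j, k j = 0) : IsParameter q (shiftParam q b k) where
  balanced := by
    simp only [Rahman.shiftParam]
    rw [Finset.prod_mul_distrib, hb.balanced, prod_zpow_eq_zpow_sum₀ _ _ hq0, hk, zpow_zero, mul_one]
  div_ne i j hij n := by
    have := mul_zpow_avoids hq0 (hb.div_ne i j hij) (k i - k j) n
    rwa [zpow_sub₀ hq0, div_mul_div_comm] at this
  mul_ne i j hij n := by
    have := mul_zpow_avoids hq0 (hb.mul_ne i j hij) (k i + k j) n
    rwa [zpow_add₀ hq0, mul_mul_mul_comm] at this

lemma shiftScale_ne_zero (hq0 : q ≠ 0) {b : Fin 6 → ℂ} (hb0 : ∀ j, b j ≠ 0) (k : Fin 6 → ℤ) :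
    shiftScale q b k ≠ 0 :=
  Finset.prod_ne_zero_iff.2 fun j _ => mul_ne_zero (zpow_ne_zero _ hq0) (zpow_ne_zero _ (hb0 j))

lemma neg_one_zpow_mul_self (k : ℤ) : (-1 : ℂ) ^ k * (-1) ^ k = 1 := by
  rw [← mul_zpow]; simp

/-- Each (b_j z^±)_{k_j} moves the matching kernel factors to b_j q^{k_j}; the signs and powers of
`z` released by `z` and `1/z` cancel. -/
lemma oddKernel_shiftParam (hq0 : q ≠ 0) (hq1 : ‖q‖ < 1) {b : Fin 6 → ℂ} (hb0 : ∀ j, b j ≠ 0)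
    (k : Fin 6 → ℤ) {z : ℂ} (hz : z ≠ 0) (h1 : ∀ j, ∀ n : ℤ, b j * z ≠ q ^ n)
    (h2 : ∀ j, ∀ n : ℤ, b j / z ≠ q ^ n) :
    oddKernel q b z * shiftedProduct q b k z =
      shiftScale q b k ^ 2 * oddKernel q (shiftParam q b k) z := by
  have key : ∀ j, (qPochInf q (q * z / b j) * qPochInf q (q * z⁻¹ / b j)) *
      (qPoch q (b j * z) (k j) * qPoch q (b j / z) (k j)) =
      (q ^ (k j * (k j - 1) / 2) * b j ^ k j) ^ 2 *
      (qPochInf q (q * z / (b j * q ^ k j)) * qPochInf q (q * z⁻¹ / (b j * q ^ k j))) := by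
    intro j
    have hj := hb0 j
    have hqk := zpow_ne_zero (k j) hq0
    have e1 := qPochInf_div_zpow hq0 hq1 (mul_ne_zero hj hz) (h1 j) (k j)
    have e2 := qPochInf_div_zpow hq0 hq1 (div_ne_zero hj hz) (h2 j) (k j)
    rw [show q / (b j * z * q ^ k j) = q * z⁻¹ / (b j * q ^ k j) by field_simp,
      show q / (b j * z) = q * z⁻¹ / b j by field_simp] at e1
    rw [show q / (b j / z * q ^ k j) = q * z / (b j * q ^ k j) by field_simp,
      show q / (b j / z) = q * z / b j by field_simp] at e2
    rw [e1, e2, zpow_neg, zpow_neg, zpow_neg, mul_zpow, div_zpow]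
    have a1 := zpow_ne_zero (k j) hj
    have a2 := zpow_ne_zero (k j) hz
    have a3 := zpow_ne_zero (k j * (k j - 1) / 2) hq0
    have a4 := neg_one_zpow_mul_self (k j)
    field_simp
    rw [sq, a4]
    ring
  rw [oddKernel, shiftedProduct, mul_assoc, ← Finset.prod_mul_distrib,
    Finset.prod_congr rfl fun j _ => key j, Finset.prod_mul_distrib, Finset.prod_pow, oddKernel,
    shiftScale]
  simp only [shiftParam]
  ring

/-- The factors (-1/μ)^{k_j} released by the thetas multiply to 1 because the k_j sum to 0. -/
lemma thetaDiff_shiftParam (hq0 : q ≠ 0) (hq1 : ‖q‖ < 1) {b : Fin 6 → ℂ} (hb0 : ∀ j, b j ≠ 0)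
    {k : Fin 6 → ℤ} (hk : ∑ j, k j = 0) {mu : ℂ} (hmu : mu ≠ 0) :
    shiftScale q b k * thetaDiff q (shiftParam q b k) mu = thetaDiff q b mu := by
  have h : ∀ mu, mu ≠ 0 → shiftScale q b k * thetaHalf q (shiftParam q b k) mu = thetaHalf q b mu := by
    intro mu hmu
    have key : ∀ j, (q ^ (k j * (k j - 1) / 2) * b j ^ k j) * theta q (mu * (b j * q ^ k j)) =
        (-mu⁻¹) ^ k j * theta q (mu * b j) := by
      intro j
      rw [← mul_assoc, theta_mul_zpow hq0 hq1 (mul_ne_zero hmu (hb0 j)), zpow_neg, zpow_neg, mul_zpow]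
      have a1 := zpow_ne_zero (k j) (hb0 j)
      have a2 := zpow_ne_zero (k j) hmu
      have a3 := zpow_ne_zero (k j * (k j - 1) / 2) hq0
      rw [show -mu⁻¹ = (-1) * mu⁻¹ by ring, mul_zpow, inv_zpow]
      field_simp
    rw [thetaHalf, thetaHalf, shiftScale, mul_left_comm, ← Finset.prod_mul_distrib]
    simp only [shiftParam]
    rw [Finset.prod_congr rfl fun j _ => key j, Finset.prod_mul_distrib,
      prod_zpow_eq_zpow_sum₀ _ _ (neg_ne_zero.2 (inv_ne_zero hmu)), hk, zpow_zero, one_mul]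
  rw [thetaDiff, mul_sub, h mu hmu, h _ (inv_ne_zero hmu), thetaDiff]

lemma sum_compl_singleton (f : Fin 6 → ℤ) (i : Fin 6) : ∑ j ∈ {i}ᶜ, f j = ∑ j, f j - f i := by
  rw [← Finset.sum_add_sum_compl {i} f, Finset.sum_singleton]; ring

/-- Each index lies in five pairs, and Σ_{j≠i} (k_i + k_j) = 4k_i because the k_j sum to 0. The
binomial exponents follow likewise from C(k+l, 2) = C(k, 2) + C(l, 2) + kl. -/
lemma prod_pairs_eq_shiftScale (hq0 : q ≠ 0) {b : Fin 6 → ℂ} (hb0 : ∀ j, b j ≠ 0)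
    {k : Fin 6 → ℤ} (hk : ∑ j, k j = 0) :
    ∏ i, ∏ j ∈ Finset.Ioi i, ((-1) ^ (k i + k j) * (b i * b j) ^ (k i + k j) *
      q ^ ((k i + k j) * (k i + k j - 1) / 2)) = shiftScale q b k ^ 4 := by
  have hsum : ∀ i, ∑ j ∈ {i}ᶜ, (k j + k i) = 4 * k i := fun i => by
    rw [sum_compl_singleton (fun j => k j + k i), Finset.sum_add_distrib, hk, Finset.sum_const,
      Finset.card_univ, Fintype.card_fin]
    simp only [nsmul_eq_mul, Nat.cast_ofNat]
    ring
  have e1 : ∏ i, ∏ j ∈ Finset.Ioi i, (-1 : ℂ) ^ (k i + k j) = 1 := by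
    have : ∀ i j, (-1 : ℂ) ^ (k i + k j) = (-1) ^ k j * (-1) ^ k i := fun i j => by
      rw [add_comm, zpow_add₀ (by norm_num)]
    simp only [this]
    rw [Finset.prod_prod_Ioi_mul_eq_prod_prod_off_diag (fun j _ => (-1 : ℂ) ^ k j)]
    simp only [prod_zpow_eq_zpow_sum₀ _ _ (neg_ne_zero.2 (one_ne_zero (α := ℂ))),
      sum_compl_singleton, hk, Finset.sum_sub_distrib]
    simp
  have e2 : ∏ i, ∏ j ∈ Finset.Ioi i, (b i * b j) ^ (k i + k j) = (∏ j, b j ^ k j) ^ 4 := by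
    have : ∀ i j, (b i * b j) ^ (k i + k j) = b i ^ (k j + k i) * b j ^ (k i + k j) := fun i j => by
      rw [mul_zpow, add_comm (k i)]
    simp only [this]
    rw [Finset.prod_prod_Ioi_mul_eq_prod_prod_off_diag (fun j i => b i ^ (k j + k i)),
      ← Finset.prod_pow]
    refine Finset.prod_congr rfl fun i _ => ?_
    rw [prod_zpow_eq_zpow_sum₀ _ _ (hb0 i), hsum, mul_comm, zpow_mul, zpow_ofNat]
  have e3 : ∏ i, ∏ j ∈ Finset.Ioi i, q ^ ((k i + k j) * (k i + k j - 1) / 2) =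
      (∏ j, q ^ (k j * (k j - 1) / 2)) ^ 4 := by
    simp only [prod_zpow_eq_zpow_sum₀ _ _ hq0]
    rw [← zpow_natCast, ← zpow_mul]
    congr 1
    -- Doubling the exponents removes the integer divisions.
    apply mul_left_cancel₀ (two_ne_zero (α := ℤ))
    rw [← mul_assoc, Finset.mul_sum, Finset.mul_sum]
    simp only [Finset.mul_sum, two_mul_choose_two]
    have : ∀ i j, (k i + k j) * (k i + k j - 1) =
        (k i * (k i - 1) + k j * k i) + (k j * (k j - 1) + k i * k j) := fun i j => by ring
    simp only [this]
    rw [Finset.sum_sum_Ioi_add_eq_sum_sum_off_diag (fun j i => k i * (k i - 1) + k j * k i),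
      Finset.sum_mul]
    have hin : ∀ i, ∑ j ∈ {i}ᶜ, (k i * (k i - 1) + k j * k i) =
        4 * (k i * (k i - 1)) - k i := fun i => by
      rw [sum_compl_singleton (fun j => k i * (k i - 1) + k j * k i), Finset.sum_add_distrib,
        ← Finset.sum_mul Finset.univ k, hk, Finset.sum_const, Finset.card_univ, Fintype.card_fin]
      simp only [nsmul_eq_mul, Nat.cast_ofNat]
      ring
    simp only [hin]
    rw [Finset.sum_sub_distrib, hk, sub_zero]
    exact Finset.sum_congr rfl fun i _ => by push_cast; ring
  simp only [Finset.prod_mul_distrib]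
  rw [e1, e2, e3, shiftScale, Finset.prod_mul_distrib]
  ring

lemma pairProd_shiftParam (hq0 : q ≠ 0) (hq1 : ‖q‖ < 1) {b : Fin 6 → ℂ} (hb : IsParameter q b)
    {k : Fin 6 → ℤ} (hk : ∑ j, k j = 0) :
    shiftScale q b k ^ 4 * pairProd q (shiftParam q b k) =
      (∏ i, ∏ j ∈ Finset.Ioi i, qPoch q (b i * b j) (k i + k j)) * pairProd q b := by
  have hb0 := hb.ne_zero hq0
  have key : ∀ i j, ((-1) ^ (k i + k j) * (b i * b j) ^ (k i + k j) *
      q ^ ((k i + k j) * (k i + k j - 1) / 2)) * qPochInf q (q / (b i * q ^ k i * (b j * q ^ k j))) =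
      qPoch q (b i * b j) (k i + k j) * qPochInf q (q / (b i * b j)) := by
    intro i j
    have h := qPochInf_div_zpow hq0 hq1 (mul_ne_zero (hb0 i) (hb0 j)) (hb.mul_ne' i j) (k i + k j)
    rw [show b i * q ^ k i * (b j * q ^ k j) = b i * b j * q ^ (k i + k j) by
      rw [zpow_add₀ hq0]; ring, h, zpow_neg, zpow_neg]
    have a1 := zpow_ne_zero (k i + k j) (mul_ne_zero (hb0 i) (hb0 j))
    have a3 := zpow_ne_zero ((k i + k j) * (k i + k j - 1) / 2) hq0
    have a4 := neg_one_zpow_mul_self (k i + k j)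
    generalize (b i * b j) ^ (k i + k j) = B at *
    field_simp
    rw [sq, a4]
    ring
  have hprod := Finset.prod_congr rfl fun i (_ : i ∈ Finset.univ) =>
    Finset.prod_congr rfl fun j (_ : j ∈ Finset.Ioi i) => key i j
  simp only [Finset.prod_mul_distrib] at hprod
  rw [← prod_pairs_eq_shiftScale hq0 hb0 hk, pairProd, pairProd, mul_left_comm, mul_left_comm _ (qPochInf q q)]
  simp only [Finset.prod_mul_distrib, shiftParam]
  rw [hprod]

end Shift

end Rahman

namespace Rahman

open Filter Topology

/-! ### Values of the bilateral series on shifted products. -/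

section BilateralValue

variable {q : ℂ}

/-- The bilateral series of a function on `lam q^ℤ`. -/
noncomputable def bilateralSum (q : ℂ) (b : Fin 6 → ℂ) (lam : ℂ) (F : ℂ → ℂ) : ℂ :=
  ∑' x : ℤ, weight q b lam x * F (lam * q ^ x)

/-- The combination of two bilateral series that represents Rahman's functional. -/
noncomputable def bilateralValue (q : ℂ) (b : Fin 6 → ℂ) (lam mu : ℂ) (F : ℂ → ℂ) : ℂ :=
  coeff q b lam mu * bilateralSum q b lam F + coeff q b mu lam * bilateralSum q b mu F

lemma IsGenericPair.symm {b : Fin 6 → ℂ} {lam mu : ℂ} (h : IsGenericPair q b lam mu) :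
    IsGenericPair q b mu lam where
  lam_ne := h.mu_ne
  mu_ne := h.lam_ne
  lam_sq := h.mu_sq
  mu_sq := h.lam_sq
  lam_mul_mu n := by rw [mul_comm]; exact h.lam_mul_mu n
  mu_div_lam n := by rw [← inv_div]; exact inv_avoids h.mu_div_lam n
  lam_mul := h.mu_mul
  lam_div := h.mu_div
  mu_mul := h.lam_mul
  mu_div := h.lam_div

lemma IsGenericPair.mul_lattice (hq0 : q ≠ 0) {b : Fin 6 → ℂ} {lam mu : ℂ}
    (h : IsGenericPair q b lam mu) (x : ℤ) (j : Fin 6) (n : ℤ) : b j * (lam * q ^ x) ≠ q ^ n := by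
  have := mul_zpow_avoids hq0 (h.lam_mul j) x n
  rwa [mul_comm lam, mul_assoc] at this

lemma IsGenericPair.div_lattice (hq0 : q ≠ 0) {b : Fin 6 → ℂ} {lam mu : ℂ}
    (h : IsGenericPair q b lam mu) (x : ℤ) (j : Fin 6) (n : ℤ) : b j / (lam * q ^ x) ≠ q ^ n := by
  have := inv_avoids (mul_zpow_avoids hq0 (h.lam_div j) x) n
  rwa [div_mul_eq_mul_div, inv_div] at this

lemma bilateralSum_mul_oddKernel (hq0 : q ≠ 0) (hq1 : ‖q‖ < 1) {b : Fin 6 → ℂ}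
    (hb : ∏ j, b j = q) {lam mu : ℂ} (h : IsGenericPair q b lam mu) (F : ℂ → ℂ) :
    oddKernel q b lam * bilateralSum q b lam F =
      ∑' x : ℤ, latticeTerm q b lam x * F (lam * q ^ x) := by
  rw [bilateralSum, ← tsum_mul_left]
  refine tsum_congr fun x => ?_
  rw [← weight_mul_oddKernel hq0 hq1 hb h.lam_ne (by simpa using h.lam_sq 0) h.lam_mul h.lam_div x]
  ring

lemma tsum_latticeTerm_mul (hq0 : q ≠ 0) (hq1 : ‖q‖ < 1) {b : Fin 6 → ℂ} (hb0 : ∀ j, b j ≠ 0)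
    {lam mu : ℂ} (h : IsGenericPair q b lam mu) {k : Fin 6 → ℤ} {F : ℂ → ℂ}
    (hF : ∀ x : ℤ, F (lam * q ^ x) = shiftedProduct q b k (lam * q ^ x)) :
    ∑' x : ℤ, latticeTerm q b lam x * F (lam * q ^ x) =
      shiftScale q b k ^ 2 * latticeSum q (shiftParam q b k) lam := by
  rw [latticeSum, ← tsum_mul_left]
  refine tsum_congr fun x => ?_
  rw [hF, latticeTerm, latticeTerm, mul_assoc, oddKernel_shiftParam hq0 hq1 hb0 k
    (mul_ne_zero h.lam_ne (zpow_ne_zero x hq0)) (h.mul_lattice hq0 x) (h.div_lattice hq0 x)]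
  ring

lemma pairProd_ne_zero (hq0 : q ≠ 0) (hq1 : ‖q‖ < 1) {b : Fin 6 → ℂ} (hb : IsParameter q b) :
    pairProd q b ≠ 0 :=
  mul_ne_zero (qPochInf_self_ne_zero hq1) (Finset.prod_ne_zero_iff.2 fun i _ =>
    Finset.prod_ne_zero_iff.2 fun j _ => qPochInf_div_ne_zero hq0 hq1 (hb.mul_ne' i j))

/-- The bilateral series evaluate correctly on the shifted products. -/
theorem bilateralValue_shiftedProduct (hq0 : q ≠ 0) (hq1 : ‖q‖ < 1) {b : Fin 6 → ℂ}
    (hb : IsParameter q b) {lam mu : ℂ} (h : IsGenericPair q b lam mu) {k : Fin 6 → ℤ}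
    (hk : ∑ j, k j = 0) {F : ℂ → ℂ}
    (hF : ∀ x : ℤ, F (lam * q ^ x) = shiftedProduct q b k (lam * q ^ x))
    (hF' : ∀ x : ℤ, F (mu * q ^ x) = shiftedProduct q b k (mu * q ^ x)) :
    bilateralValue q b lam mu F =
      (∏ i, ∏ j ∈ Finset.Ioi i, qPoch q (b i * b j) (k i + k j)) / shiftScale q b k := by
  have hb0 := hb.ne_zero hq0
  have hT := thetaCross_ne_zero hq0 hq1 h.lam_ne h.mu_ne h.lam_sq h.mu_sq h.lam_mul_mu h.mu_div_lam
  have hP := pairProd_ne_zero hq0 hq1 hb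
  have hS := shiftScale_ne_zero hq0 hb0 k
  have h1 := bilateralSum_mul_oddKernel hq0 hq1 hb.balanced h F
  have h2 := bilateralSum_mul_oddKernel hq0 hq1 hb.balanced h.symm F
  rw [tsum_latticeTerm_mul hq0 hq1 hb0 h hF] at h1
  rw [tsum_latticeTerm_mul hq0 hq1 hb0 h.symm hF'] at h2
  have h3 := casoratian_eq hq0 hq1 (hb.shiftParam hq0 hk) h.lam_ne h.mu_ne h.mu_sq
  have h4 := pairProd_shiftParam hq0 hq1 hb hk
  rw [casoratian] at h3
  rw [bilateralValue, coeff_eq hq0 hq1 hb.balanced h.lam_ne h.mu_ne,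
    coeff_eq hq0 hq1 hb.balanced h.mu_ne h.lam_ne, thetaCross_swap hq1 h.lam_ne h.mu_ne,
    ← thetaDiff_shiftParam hq0 hq1 hb0 hk h.lam_ne, ← thetaDiff_shiftParam hq0 hq1 hb0 hk h.mu_ne,
    eq_div_iff hS]
  apply mul_left_cancel₀ (mul_ne_zero hP hT)
  calc _ = shiftScale q b k ^ 2 * (thetaDiff q (shiftParam q b k) lam *
          (oddKernel q b mu * bilateralSum q b mu F) -
        thetaDiff q (shiftParam q b k) mu * (oddKernel q b lam * bilateralSum q b lam F)) := by
        field_simp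
        ring
    _ = shiftScale q b k ^ 4 * (thetaDiff q (shiftParam q b k) lam *
          latticeSum q (shiftParam q b k) mu -
        thetaDiff q (shiftParam q b k) mu * latticeSum q (shiftParam q b k) lam) := by
        rw [h1, h2]; ring
    _ = _ := by rw [h3, ← mul_assoc, h4]; ring

lemma exists_isGenericPair {b : Fin 6 → ℂ} (hb0 : ∀ j, b j ≠ 0) :
    ∃ lam mu, IsGenericPair q b lam mu := by
  have hS : ∀ a : ℂ, a ≠ 0 → (crossNorms q a ∪ ⋃ j, crossNorms q (b j)).Countable := fun a ha =>
    (countable_crossNorms q a).union (Set.countable_iUnion fun j => countable_crossNorms q (b j))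
  have step : ∀ a : ℂ, a ≠ 0 → ∃ r : ℂ, r ≠ 0 ∧ (∀ n : ℤ, r ^ 2 ≠ q ^ n) ∧ (∀ n : ℤ, r * a ≠ q ^ n) ∧
      (∀ n : ℤ, a / r ≠ q ^ n) ∧ (∀ j, ∀ n : ℤ, r * b j ≠ q ^ n) ∧ ∀ j, ∀ n : ℤ, r / b j ≠ q ^ n := by
    intro a ha
    obtain ⟨r, hr, hrS⟩ := exists_pos_notMem_of_countable (hS a ha)
    rw [Set.mem_union, Set.mem_iUnion, not_or, not_exists] at hrS
    have hr0 : (r : ℂ) ≠ 0 := by exact_mod_cast hr.ne'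
    have hn : ‖(r : ℂ)‖ = r := by rw [Complex.norm_real, Real.norm_of_nonneg hr.le]
    obtain ⟨s1, s2, s3⟩ := sq_avoids_of_notMem_crossNorms hr0 ha (by rw [hn]; exact hrS.1)
    have hj := fun j => sq_avoids_of_notMem_crossNorms hr0 (hb0 j) (by rw [hn]; exact hrS.2 j)
    refine ⟨r, hr0, s1, s2, s3, fun j => (hj j).2.1, fun j n => ?_⟩
    rw [← inv_div]
    exact inv_avoids (hj j).2.2 n
  -- μ is chosen first with 1 as a dummy partner; the conditions linking the pair are imposed when λ
  -- is chosen.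
  obtain ⟨mu, m0, m1, -, -, m2, m3⟩ := step 1 one_ne_zero
  obtain ⟨lam, l0, l1, l2, l3, l4, l5⟩ := step mu m0
  exact ⟨lam, mu, l0, m0, l1, m1, l2, l3, l4, l5, m2, m3⟩

end BilateralValue

end Rahman

namespace Rahman

open Filter Topology

/-! ### Partial fractions in V. -/

section RationalFunctions

open Polynomial

/-- `RatFunc.eval` uses the reduced fraction, whose denominator divides `d` and so does not vanish
at `x` either; cross-multiplication compares the two fractions. -/
lemma ratFunc_eval_div (p : ℂ[X]) {d : ℂ[X]} {x : ℂ} (hd : d.eval x ≠ 0) :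
    RatFunc.eval (RingHom.id ℂ) x (algebraMap ℂ[X] (RatFunc ℂ) p / algebraMap ℂ[X] (RatFunc ℂ) d) =
      p.eval x / d.eval x := by
  have hd0 : d ≠ 0 := by rintro rfl; simp at hd
  set f := algebraMap ℂ[X] (RatFunc ℂ) p / algebraMap ℂ[X] (RatFunc ℂ) d
  have h := congrArg (eval x) ((RatFunc.num_mul_eq_mul_denom_iff (x := f) hd0).2 rfl)
  rw [eval_mul, eval_mul] at h
  have hne : f.denom.eval x ≠ 0 := fun h0 =>
    hd (eval_eq_zero_of_dvd_of_eval_eq_zero (RatFunc.denom_div_dvd p d) h0)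
  rw [RatFunc.eval, eval₂_id, eval₂_id, div_eq_div_iff hne hd, h]

/-- The fraction `1 / (X - a)`. -/
noncomputable def simpleFraction (a : ℂ) : RatFunc ℂ :=
  algebraMap ℂ[X] (RatFunc ℂ) 1 / algebraMap ℂ[X] (RatFunc ℂ) (X - C a)

/-- Splitting off a simple pole. -/
lemma exists_split_pole {p e : ℂ[X]} {a : ℂ} (he : e.eval a ≠ 0)
    (hp : p.natDegree ≤ e.natDegree + 1) :
    ∃ p' : ℂ[X], p'.natDegree ≤ e.natDegree ∧
      algebraMap ℂ[X] (RatFunc ℂ) p / algebraMap ℂ[X] (RatFunc ℂ) ((X - C a) * e) =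
        (p.eval a / e.eval a) • simpleFraction a +
          algebraMap ℂ[X] (RatFunc ℂ) p' / algebraMap ℂ[X] (RatFunc ℂ) e := by
  set r := p.eval a / e.eval a with hr
  have he0 : e ≠ 0 := by rintro rfl; simp at he
  obtain ⟨p', hp'⟩ : X - C a ∣ p - C r * e := by
    rw [dvd_iff_isRoot, IsRoot, eval_sub, eval_mul, eval_C, hr, div_mul_cancel₀ _ he, sub_self]
  refine ⟨p', ?_, ?_⟩
  · by_cases h0 : p' = 0
    · simp [h0]
    have h1 : (p - C r * e).natDegree ≤ e.natDegree + 1 :=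
      (natDegree_sub_le _ _).trans (max_le hp ((natDegree_C_mul_le _ _).trans (Nat.le_succ _)))
    rw [hp', natDegree_mul (X_sub_C_ne_zero a) h0, natDegree_X_sub_C] at h1
    omega
  · have e1 := RatFunc.algebraMap_ne_zero (X_sub_C_ne_zero a)
    have e2 := RatFunc.algebraMap_ne_zero he0
    have e3 : p = C r * e + (X - C a) * p' := by rw [← hp']; ring
    rw [RatFunc.smul_eq_C_mul, simpleFraction, ← RatFunc.algebraMap_C]
    conv_lhs => rw [e3]
    rw [map_add, map_mul, map_mul, map_mul, map_one]
    field_simp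

lemma div_prod_mem {W : Submodule ℂ (RatFunc ℂ)} (h1 : 1 ∈ W) (s : Finset ℂ)
    (hs : ∀ a ∈ s, simpleFraction a ∈ W) {p : ℂ[X]} (hp : p.natDegree ≤ s.card) :
    algebraMap ℂ[X] (RatFunc ℂ) p / algebraMap ℂ[X] (RatFunc ℂ) (∏ a ∈ s, (X - C a)) ∈ W := by
  induction s using Finset.induction_on generalizing p with
  | empty =>
    rw [Finset.card_empty, Nat.le_zero] at hp
    rw [eq_C_of_natDegree_eq_zero hp, Finset.prod_empty, map_one, div_one, RatFunc.algebraMap_C,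
      ← mul_one (RatFunc.C _), ← RatFunc.smul_eq_C_mul]
    exact W.smul_mem _ h1
  | insert a s ha ih =>
    rw [Finset.card_insert_of_notMem ha] at hp
    have he : (∏ a ∈ s, (X - C a)).eval a ≠ 0 := by
      rw [eval_prod]
      refine Finset.prod_ne_zero_iff.2 fun c hc => ?_
      rw [eval_sub, eval_X, eval_C]
      exact sub_ne_zero.2 fun h => ha (h ▸ hc)
    have hdeg : (∏ a ∈ s, (X - C a)).natDegree = s.card :=
      natDegree_finsetProd_X_sub_C_eq_card s fun a => a
    obtain ⟨p', hp', h⟩ := exists_split_pole he (p := p) (by rwa [hdeg])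
    rw [Finset.prod_insert ha, h]
    exact W.add_mem (W.smul_mem _ (hs a (Finset.mem_insert_self a s)))
      (ih (fun c hc => hs c (Finset.mem_insert_of_mem hc)) (hdeg ▸ hp'))

variable {q : ℂ} {b : Fin 6 → ℂ}

lemma div_prod_mem_V (s : Finset ℂ) (hs : ∀ a ∈ s, a ∈ polePoints q b) {p : ℂ[X]}
    (hp : p.natDegree ≤ s.card) :
    algebraMap ℂ[X] (RatFunc ℂ) p / algebraMap ℂ[X] (RatFunc ℂ) (∏ a ∈ s, (X - C a)) ∈ V q b := by
  set d : ℂ[X] := ∏ a ∈ s, (X - C a) with hd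
  have hm : d.Monic := monic_prod_of_monic _ _ fun a _ => monic_X_sub_C a
  have hdvd := RatFunc.denom_div_dvd p d
  have hroots : d.roots = s.val := roots_prod_X_sub_C s
  refine ⟨fun a ha => hs a ?_, fun a => ?_, ?_⟩
  · have := (mem_roots hm.ne_zero).2 (ha.dvd hdvd)
    rwa [hroots] at this
  · refine (rootMultiplicity_le_rootMultiplicity_of_dvd hm.ne_zero hdvd a).trans ?_
    rw [← count_roots, hroots]
    exact Multiset.nodup_iff_count_le_one.1 s.nodup a
  · set f := algebraMap ℂ[X] (RatFunc ℂ) p / algebraMap ℂ[X] (RatFunc ℂ) d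
    have h := (RatFunc.num_mul_eq_mul_denom_iff (x := f) hm.ne_zero).2 rfl
    by_cases h0 : f.num = 0
    · simp [h0]
    have hp0 : p ≠ 0 := by
      rintro rfl
      rw [zero_mul] at h
      exact (mul_ne_zero h0 hm.ne_zero) h
    have h2 := congrArg natDegree h
    rw [natDegree_mul h0 hm.ne_zero, natDegree_mul hp0 f.denom_ne_zero,
      hd, natDegree_finsetProd_X_sub_C_eq_card s] at h2
    omega

lemma one_mem_V : (1 : RatFunc ℂ) ∈ V q b := by
  have := div_prod_mem_V (q := q) (b := b) ∅ (by simp) (p := 1) (by simp)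
  simpa using this

lemma simpleFraction_mem_V {a : ℂ} (ha : a ∈ polePoints q b) : simpleFraction a ∈ V q b := by
  have := div_prod_mem_V (q := q) (b := b) {a} (by simpa using ha) (p := 1) (by simp)
  rwa [Finset.prod_singleton] at this

/-- `V` is spanned by `1` and the simple fractions. -/
lemma V_le {W : Submodule ℂ (RatFunc ℂ)} (h1 : 1 ∈ W)
    (h : ∀ a ∈ polePoints q b, simpleFraction a ∈ W) : V q b ≤ W := by
  rintro f ⟨hf1, hf2, hf3⟩
  classical
  -- The monic denominator splits over ℂ, and simplicity of the poles means that its multiset of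
  -- roots has no repetitions.
  have hprod : f.denom = ∏ a ∈ f.denom.roots.toFinset, (X - C a) := by
    conv_lhs => rw [(IsAlgClosed.splits f.denom).eq_prod_roots_of_monic f.monic_denom]
    rw [Finset.prod, Multiset.toFinset_val, Multiset.dedup_eq_self.2]
    exact Multiset.nodup_iff_count_le_one.2 fun a => by rw [count_roots]; exact hf2 a
  rw [← RatFunc.num_div_denom f, hprod]
  refine div_prod_mem h1 _ (fun a ha => h a (hf1 a ?_)) ?_
  · rw [Multiset.mem_toFinset] at ha
    exact isRoot_of_mem_roots ha
  · rw [← natDegree_finsetProd_X_sub_C_eq_card (R := ℂ) _ fun a => a, ← hprod]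
    exact hf3

end RationalFunctions

/-! ### The variable (z + 1/z)/2 and separation of the poles. -/

section Joukowski

variable {q : ℂ}

lemma joukowski_eq_iff {z w : ℂ} (hz : z ≠ 0) (hw : w ≠ 0) :
    joukowski z = joukowski w ↔ z = w ∨ z * w = 1 := by
  have : joukowski z - joukowski w = (z - w) * (z * w - 1) / (2 * z * w) := by
    unfold joukowski
    field_simp
    ring
  rw [← sub_eq_zero, this, div_eq_zero_iff, mul_eq_zero, sub_eq_zero, sub_eq_zero]
  have : 2 * z * w ≠ 0 := mul_ne_zero (mul_ne_zero two_ne_zero hz) hw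
  tauto

lemma one_sub_mul_one_sub_div {u z : ℂ} (hu : u ≠ 0) (hz : z ≠ 0) :
    (1 - u * z) * (1 - u / z) = -2 * u * (joukowski z - joukowski u) := by
  unfold joukowski
  field_simp
  ring

lemma zpow_injective (hq0 : q ≠ 0) (hq1 : ‖q‖ < 1) {n m : ℤ} (h : q ^ n = q ^ m) : n = m := by
  have := congrArg norm h
  rw [norm_zpow, norm_zpow] at this
  exact zpow_right_injective₀ (norm_pos_iff.2 hq0) hq1.ne this

/-- A coincidence of two such points would put some b_i/b_j with i ≠ j, or some b_i b_j, in q^ℤ. -/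
lemma IsParameter.eq_of_joukowski_eq (hq0 : q ≠ 0) (hq1 : ‖q‖ < 1) {b : Fin 6 → ℂ}
    (hb : IsParameter q b) {i j : Fin 6} {n m : ℤ}
    (h : joukowski (b i * q ^ n) = joukowski (b j * q ^ m)) : i = j ∧ n = m := by
  have hb0 := hb.ne_zero hq0
  have hn := zpow_ne_zero n hq0
  have hm := zpow_ne_zero m hq0
  rcases (joukowski_eq_iff (mul_ne_zero (hb0 i) hn) (mul_ne_zero (hb0 j) hm)).1 h with h | h
  · have hij : i = j := by
      by_contra hij
      refine hb.div_ne' hij (m - n) ?_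
      rw [zpow_sub₀ hq0, div_eq_div_iff (hb0 j) hn, h, mul_comm]
    subst hij
    exact ⟨rfl, zpow_injective hq0 hq1 (mul_left_cancel₀ (hb0 i) h)⟩
  · refine absurd ?_ (hb.mul_ne' i j (-(n + m)))
    rw [zpow_neg, zpow_add₀ hq0]
    refine eq_inv_of_mul_eq_one_left ?_
    rw [← h]; ring

lemma joukowski_notMem_polePoints (hq0 : q ≠ 0) {b : Fin 6 → ℂ} (hb0 : ∀ j, b j ≠ 0) {z : ℂ}
    (hz : z ≠ 0) (h1 : ∀ j, ∀ n : ℤ, b j * z ≠ q ^ n) (h2 : ∀ j, ∀ n : ℤ, b j / z ≠ q ^ n) :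
    joukowski z ∉ polePoints q b := by
  rintro ⟨j, n, -, h⟩
  have hn := zpow_ne_zero n hq0
  rcases (joukowski_eq_iff hz (mul_ne_zero (hb0 j) hn)).1 h with h | h
  · refine h2 j (-n) ?_
    have := hb0 j
    rw [h, zpow_neg]
    field_simp
  · refine h1 j (-n) ?_
    rw [zpow_neg]
    refine eq_inv_of_mul_eq_one_left ?_
    rw [← h]; ring

lemma qPoch_neg_natCast (q a : ℂ) (m : ℕ) :
    qPoch q a (-(m : ℤ)) = (∏ i ∈ Finset.range m, (1 - a * (q ^ (i + 1))⁻¹))⁻¹ := by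
  cases m with
  | zero => simp [qPoch]
  | succ n => rfl

lemma qPoch_zero (q a : ℂ) : qPoch q a 0 = 1 := rfl

end Joukowski

end Rahman

namespace Rahman

open Filter Topology

/-! ### V is spanned by shifted products. -/

section ShiftedProducts

open Polynomial

variable {q : ℂ} {b : Fin 6 → ℂ}

/-- The poles `(z + 1/z) / 2`, `z = b_j q^{-l-1}`. -/
noncomputable def pole (q : ℂ) (b : Fin 6 → ℂ) (j : Fin 6) (l : ℕ) : ℂ :=
  joukowski (b j * q ^ Int.negSucc l)

lemma pole_mem_polePoints (j : Fin 6) (l : ℕ) : pole q b j l ∈ polePoints q b :=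
  ⟨j, Int.negSucc l, Int.negSucc_lt_zero l, rfl⟩

lemma exists_eq_pole {a : ℂ} (ha : a ∈ polePoints q b) : ∃ j l, a = pole q b j l := by
  obtain ⟨j, n, hn, rfl⟩ := ha
  obtain ⟨l, rfl⟩ := Int.eq_negSucc_of_lt_zero hn
  exact ⟨j, l, rfl⟩

lemma pole_injective (hq0 : q ≠ 0) (hq1 : ‖q‖ < 1) (hb : IsParameter q b) (j : Fin 6) :
    Function.Injective (pole q b j) := fun l l' h => by
  have := (hb.eq_of_joukowski_eq hq0 hq1 h).2
  simpa using this

/-- The numerator of the shifted product `(b_j z^±)_{-m} (b_i z^±)_m`. -/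
noncomputable def shiftedNum (q : ℂ) (b : Fin 6 → ℂ) (i j : Fin 6) (m : ℕ) : ℂ[X] :=
  C ((∏ l ∈ Finset.range m, (-2 * (b i * q ^ (l : ℤ)))) /
      ∏ l ∈ Finset.range m, (-2 * (b j * q ^ Int.negSucc l))) *
    ∏ l ∈ Finset.range m, (X - C (joukowski (b i * q ^ (l : ℤ))))

lemma natDegree_shiftedNum_le (i j : Fin 6) (m : ℕ) : (shiftedNum q b i j m).natDegree ≤ m := by
  refine (natDegree_C_mul_le _ _).trans ?_
  have := natDegree_finsetProd_X_sub_C_eq_card (R := ℂ) (Finset.range m)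
    fun l => joukowski (b i * q ^ (l : ℤ))
  rw [this, Finset.card_range]

lemma prod_neg_two_mul_ne_zero (hq0 : q ≠ 0) (hb0 : ∀ j, b j ≠ 0) (j : Fin 6) (m : ℕ) (e : ℕ → ℤ) :
    ∏ l ∈ Finset.range m, (-2 * (b j * q ^ e l)) ≠ 0 :=
  Finset.prod_ne_zero_iff.2 fun l _ => mul_ne_zero (by norm_num)
    (mul_ne_zero (hb0 j) (zpow_ne_zero _ hq0))

/-- The zeros of the numerator come from b_i and the poles from b_j with i ≠ j, so nothing cancels.
This supplies the nonzero diagonal entries of the triangular system. -/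
lemma eval_shiftedNum_ne_zero (hq0 : q ≠ 0) (hq1 : ‖q‖ < 1) (hb : IsParameter q b) {i j : Fin 6}
    (hij : i ≠ j) (m l : ℕ) : (shiftedNum q b i j m).eval (pole q b j l) ≠ 0 := by
  have hb0 := hb.ne_zero hq0
  rw [shiftedNum, eval_mul, eval_C, eval_prod]
  refine mul_ne_zero (div_ne_zero (prod_neg_two_mul_ne_zero hq0 hb0 i m _)
    (prod_neg_two_mul_ne_zero hq0 hb0 j m _)) (Finset.prod_ne_zero_iff.2 fun l' _ => ?_)
  rw [eval_sub, eval_X, eval_C]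
  exact sub_ne_zero.2 fun h => hij (hb.eq_of_joukowski_eq hq0 hq1 h).1.symm

/-- The first `m` poles for `b_j`. -/
noncomputable def poleSet (q : ℂ) (b : Fin 6 → ℂ) (j : Fin 6) (m : ℕ) : Finset ℂ := by
  classical exact (Finset.range m).image (pole q b j)

lemma mem_poleSet {j : Fin 6} {m : ℕ} {a : ℂ} :
    a ∈ poleSet q b j m ↔ ∃ l < m, pole q b j l = a := by
  classical
  rw [poleSet, Finset.mem_image]
  simp only [Finset.mem_range]

lemma prod_poleSet (hq0 : q ≠ 0) (hq1 : ‖q‖ < 1) (hb : IsParameter q b) (j : Fin 6) (m : ℕ) :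
    ∏ a ∈ poleSet q b j m, (X - C a) = ∏ l ∈ Finset.range m, (X - C (pole q b j l)) := by
  classical
  rw [poleSet, Finset.prod_image fun _ _ _ _ h => pole_injective hq0 hq1 hb j h]

lemma card_poleSet (hq0 : q ≠ 0) (hq1 : ‖q‖ < 1) (hb : IsParameter q b) (j : Fin 6) (m : ℕ) :
    (poleSet q b j m).card = m := by
  classical
  rw [poleSet, Finset.card_image_of_injective _ (pole_injective hq0 hq1 hb j), Finset.card_range]

/-- The shifted product `(b_j z^±)_{-m} (b_i z^±)_m` as a rational function. -/
noncomputable def shiftedFun (q : ℂ) (b : Fin 6 → ℂ) (i j : Fin 6) (m : ℕ) : RatFunc ℂ :=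
  algebraMap ℂ[X] (RatFunc ℂ) (shiftedNum q b i j m) /
    algebraMap ℂ[X] (RatFunc ℂ) (∏ a ∈ poleSet q b j m, (X - C a))

lemma shiftedFun_mem_V (hq0 : q ≠ 0) (hq1 : ‖q‖ < 1) (hb : IsParameter q b) (i j : Fin 6) (m : ℕ) :
    shiftedFun q b i j m ∈ V q b := by
  refine div_prod_mem_V _ (fun a ha => ?_) ?_
  · obtain ⟨l, -, rfl⟩ := mem_poleSet.1 ha
    exact pole_mem_polePoints j l
  · rw [card_poleSet hq0 hq1 hb]
    exact natDegree_shiftedNum_le i j m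

/-- The shift vector with entries `m` at `i`, `-m` at `j` and `0` otherwise. -/
def pairShift (i j : Fin 6) (m : ℕ) : Fin 6 → ℤ := Pi.single i (m : ℤ) + Pi.single j (-(m : ℤ))

lemma sum_pairShift (i j : Fin 6) (m : ℕ) : ∑ l, pairShift i j m l = 0 := by
  simp [pairShift, Finset.sum_add_distrib]

lemma isShiftedProduct_shiftedFun (hq0 : q ≠ 0) (hq1 : ‖q‖ < 1) (hb : IsParameter q b) {i j : Fin 6}
    (hij : i ≠ j) (m : ℕ) :
    IsShiftedProduct (pairShift i j m) ⟨shiftedFun q b i j m, shiftedFun_mem_V hq0 hq1 hb i j m⟩ := by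
  intro z hz hav
  have hb0 := hb.ne_zero hq0
  have hpole : ∀ l, joukowski z - pole q b j l ≠ 0 := fun l => by
    refine sub_ne_zero.2 fun h => ?_
    rcases (joukowski_eq_iff hz (mul_ne_zero (hb0 j) (zpow_ne_zero _ hq0))).1 h with h | h
    · exact (hav j _).1 h
    · exact (hav j _).2 (inv_eq_of_mul_eq_one_right h)
  have hne : eval (joukowski z) (∏ l ∈ Finset.range m, (X - C (pole q b j l))) ≠ 0 := by
    rw [eval_prod]
    refine Finset.prod_ne_zero_iff.2 fun l _ => ?_
    rw [eval_sub, eval_X, eval_C]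
    exact hpole l
  have hrhs : ∏ l, (qPoch q (b l * z) (pairShift i j m l) * qPoch q (b l / z) (pairShift i j m l)) =
      (∏ l ∈ Finset.range m, (-2 * (b i * q ^ (l : ℤ)) *
        (joukowski z - joukowski (b i * q ^ (l : ℤ))))) *
      (∏ l ∈ Finset.range m, (-2 * (b j * q ^ Int.negSucc l) * (joukowski z - pole q b j l)))⁻¹ := by
    rw [Finset.prod_eq_mul i j hij (fun l _ hl => ?_) (by simp) (by simp)]
    · have e1 : pairShift i j m i = m := by simp [pairShift, Pi.single_eq_of_ne hij]
      have e2 : pairShift i j m j = -m := by simp [pairShift, Pi.single_eq_of_ne hij.symm]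
      rw [e1, e2, qPoch_neg_natCast, qPoch_neg_natCast, ← mul_inv, ← Finset.prod_mul_distrib]
      congr 1
      · change (∏ l ∈ Finset.range m, (1 - b i * z * q ^ l)) *
          (∏ l ∈ Finset.range m, (1 - b i / z * q ^ l)) = _
        rw [← Finset.prod_mul_distrib]
        refine Finset.prod_congr rfl fun l _ => ?_
        rw [← one_sub_mul_one_sub_div (mul_ne_zero (hb0 i) (zpow_ne_zero _ hq0)) hz, zpow_natCast]
        ring
      · congr 1
        refine Finset.prod_congr rfl fun l _ => ?_
        rw [pole, ← one_sub_mul_one_sub_div (mul_ne_zero (hb0 j) (zpow_ne_zero _ hq0)) hz,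
          zpow_negSucc]
        ring
    · have e : pairShift i j m l = 0 := by
        simp [pairShift, Pi.single_eq_of_ne hl.1, Pi.single_eq_of_ne hl.2]
      rw [e, qPoch_zero, qPoch_zero, one_mul]
  rw [hrhs, evalAt]
  change RatFunc.eval (RingHom.id ℂ) (joukowski z) (shiftedFun q b i j m) = _
  rw [shiftedFun, prod_poleSet hq0 hq1 hb, ratFunc_eval_div _ hne, shiftedNum, eval_mul, eval_C,
    eval_prod, eval_prod, Finset.prod_mul_distrib (f := fun l : ℕ => -2 * (b i * q ^ (l : ℤ))),
    Finset.prod_mul_distrib (f := fun l : ℕ => -2 * (b j * q ^ Int.negSucc l))]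
  simp only [eval_sub, eval_X, eval_C]
  rw [mul_inv]
  ring

/-- `V` is spanned by the shifted products. -/
lemma V_le_of_shiftedProducts (hq0 : q ≠ 0) (hq1 : ‖q‖ < 1) (hb : IsParameter q b)
    {W : Submodule ℂ (RatFunc ℂ)}
    (h : ∀ k : Fin 6 → ℤ, ∑ j, k j = 0 → ∀ f : V q b, IsShiftedProduct k f → (f : RatFunc ℂ) ∈ W) :
    V q b ≤ W := by
  have hmem : ∀ i j, i ≠ j → ∀ m, shiftedFun q b i j m ∈ W := fun i j hij m =>
    h _ (sum_pairShift i j m) _ (isShiftedProduct_shiftedFun hq0 hq1 hb hij m)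
  have h1 : (1 : RatFunc ℂ) ∈ W := by
    have := hmem 0 1 (by decide) 0
    simpa [shiftedFun, shiftedNum, poleSet] using this
  refine V_le h1 fun a ha => ?_
  obtain ⟨j, l, rfl⟩ := exists_eq_pole ha
  obtain ⟨i, hij⟩ : ∃ i : Fin 6, i ≠ j := exists_ne j
  induction l using Nat.strong_induction_on with
  | _ l ih =>
    -- This product has simple poles at exactly the first l + 1 points for b_j. Splitting off the
    -- last one leaves a function with earlier poles only, which is in `W` by induction.
    have hF := hmem i j hij (l + 1)
    have he : (∏ a ∈ poleSet q b j l, (X - C a)).eval (pole q b j l) ≠ 0 := by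
      rw [eval_prod]
      refine Finset.prod_ne_zero_iff.2 fun a ha => ?_
      obtain ⟨l', hl', rfl⟩ := mem_poleSet.1 ha
      rw [eval_sub, eval_X, eval_C]
      exact sub_ne_zero.2 fun h => hl'.ne' (pole_injective hq0 hq1 hb j h)
    have hdeg : (∏ a ∈ poleSet q b j l, (X - C a)).natDegree = l := by
      rw [natDegree_finsetProd_X_sub_C_eq_card (R := ℂ) _ fun a => a, card_poleSet hq0 hq1 hb]
    obtain ⟨p', hp', hsplit⟩ := exists_split_pole he (p := shiftedNum q b i j (l + 1))
      (by rw [hdeg]; exact natDegree_shiftedNum_le i j (l + 1))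
    have hden : (X - C (pole q b j l)) * ∏ a ∈ poleSet q b j l, (X - C a) =
        ∏ a ∈ poleSet q b j (l + 1), (X - C a) := by
      rw [prod_poleSet hq0 hq1 hb, prod_poleSet hq0 hq1 hb, Finset.prod_range_succ, mul_comm]
    rw [hden] at hsplit
    rw [shiftedFun, hsplit] at hF
    have hrest := div_prod_mem h1 (poleSet q b j l) (p := p') (fun a ha => by
      obtain ⟨l', hl', rfl⟩ := mem_poleSet.1 ha
      exact ih l' hl' (pole_mem_polePoints j l')) (by rwa [card_poleSet hq0 hq1 hb, ← hdeg])
    have hr := (W.add_mem_iff_left hrest).1 hF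
    exact (W.smul_mem_iff (div_ne_zero (eval_shiftedNum_ne_zero hq0 hq1 hb hij _ _) he)).1 hr

end ShiftedProducts

end Rahman

namespace Rahman

open Filter Topology

/-! ### Convergence, existence and uniqueness of the functional. -/

section Functional

variable {q : ℂ} {b : Fin 6 → ℂ}

lemma denom_eval_ne_zero (f : V q b) {z : ℂ} (hz : joukowski z ∉ polePoints q b) :
    Polynomial.eval₂ (RingHom.id ℂ) (joukowski z) (f : RatFunc ℂ).denom ≠ 0 := by
  rw [Polynomial.eval₂_id]
  exact fun h => hz (f.2.1 _ h)

/-- `RatFunc.eval` is additive only away from the poles, hence the restriction on `z`; generic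
lattices satisfy it. -/
lemma evalAt_add (f g : V q b) {z : ℂ} (hz : joukowski z ∉ polePoints q b) :
    evalAt (f + g) z = evalAt f z + evalAt g z :=
  RatFunc.eval_add _ _ (denom_eval_ne_zero f hz) (denom_eval_ne_zero g hz)

lemma evalAt_smul (c : ℂ) (f : V q b) {z : ℂ} (hz : joukowski z ∉ polePoints q b) :
    evalAt (c • f) z = c * evalAt f z := by
  rw [evalAt, Submodule.coe_smul, RatFunc.smul_eq_C_mul,
    RatFunc.eval_mul _ _ (by simp) (denom_eval_ne_zero f hz), RatFunc.eval_C]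
  rfl

lemma evalAt_zero (z : ℂ) : evalAt (0 : V q b) z = 0 := RatFunc.eval_zero _ _

lemma evalAt_one (z : ℂ) : evalAt (⟨1, one_mem_V⟩ : V q b) z = 1 := RatFunc.eval_one _ _

lemma evalAt_simpleFraction {a : ℂ} (ha : a ∈ polePoints q b) {z : ℂ}
    (hz : joukowski z ∉ polePoints q b) :
    evalAt (⟨simpleFraction a, simpleFraction_mem_V ha⟩ : V q b) z = (joukowski z - a)⁻¹ := by
  have hne : joukowski z - a ≠ 0 := sub_ne_zero.2 fun h => hz (h ▸ ha)
  change RatFunc.eval (RingHom.id ℂ) (joukowski z) (simpleFraction a) = _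
  rw [simpleFraction, ratFunc_eval_div _ (by simpa using hne)]
  simp

lemma IsGenericPair.notMem_polePoints (hq0 : q ≠ 0) (hb0 : ∀ j, b j ≠ 0) {lam mu : ℂ}
    (h : IsGenericPair q b lam mu) (x : ℤ) : joukowski (lam * q ^ x) ∉ polePoints q b :=
  joukowski_notMem_polePoints hq0 hb0 (mul_ne_zero h.lam_ne (zpow_ne_zero x hq0)) (h.mul_lattice hq0 x)
    (h.div_lattice hq0 x)

lemma IsGenericPair.oddKernel_ne_zero (hq0 : q ≠ 0) (hq1 : ‖q‖ < 1) (hb0 : ∀ j, b j ≠ 0)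
    {lam mu : ℂ} (h : IsGenericPair q b lam mu) : oddKernel q b lam ≠ 0 := by
  have hl := h.lam_ne
  refine mul_ne_zero (sub_ne_zero.2 fun e => h.lam_sq 0 ?_) (Finset.prod_ne_zero_iff.2 fun j _ =>
    mul_ne_zero ?_ ?_)
  · rw [zpow_zero, sq]
    nth_rewrite 2 [e]
    exact mul_inv_cancel₀ hl
  · rw [show q * lam / b j = q / (b j / lam) by rw [div_div_eq_mul_div]]
    exact qPochInf_div_ne_zero hq0 hq1 fun n => by
      simpa using h.div_lattice hq0 0 j n
  · have := hb0 j
    rw [show q * lam⁻¹ / b j = q / (lam * b j) by field_simp]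
    exact qPochInf_div_ne_zero hq0 hq1 (h.lam_mul j)

lemma summable_weight (hq0 : q ≠ 0) (hq1 : ‖q‖ < 1) (hb : IsParameter q b) {lam mu : ℂ}
    (h : IsGenericPair q b lam mu) : Summable fun x : ℤ => ‖weight q b lam x‖ := by
  have hK := h.oddKernel_ne_zero hq0 hq1 (hb.ne_zero hq0)
  refine ((summable_latticeTerm hq0 hq1 hb.balanced h.lam_ne).mul_right
    ‖oddKernel q b lam‖⁻¹).congr fun x => ?_
  rw [← weight_mul_oddKernel hq0 hq1 hb.balanced h.lam_ne (by simpa using h.lam_sq 0) h.lam_mul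
    h.lam_div x, norm_mul, mul_inv_cancel_right₀ (norm_ne_zero_iff.2 hK)]

lemma tendsto_joukowski_cobounded : Tendsto joukowski (𝓝[≠] 0) (Bornology.cobounded ℂ) := by
  rw [← tendsto_norm_atTop_iff_cobounded]
  have h1 : Tendsto (fun z : ℂ => ‖z⁻¹‖) (𝓝[≠] 0) atTop :=
    tendsto_norm_atTop_iff_cobounded.2 tendsto_inv₀_nhdsNE_zero
  have h2 : Tendsto (fun z : ℂ => -‖z‖) (𝓝[≠] 0) (𝓝 0) := by
    have : Tendsto (fun z : ℂ => -‖z‖) (𝓝 0) (𝓝 (-‖(0 : ℂ)‖)) :=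
      (continuous_norm.neg).continuousAt
    rw [norm_zero, neg_zero] at this
    exact this.mono_left nhdsWithin_le_nhds
  refine tendsto_atTop_mono (fun z => ?_) ((h1.atTop_add h2).atTop_div_const two_pos)
  rw [joukowski, norm_div, Complex.norm_ofNat]
  have := norm_sub_le (z + z⁻¹) z
  rw [add_sub_cancel_left] at this
  gcongr
  linarith

lemma tendsto_joukowski_pow (hq0 : q ≠ 0) (hq1 : ‖q‖ < 1) {lam : ℂ} (hlam : lam ≠ 0) :
    Tendsto (fun n : ℕ => joukowski (lam * q ^ n)) atTop (Bornology.cobounded ℂ) := by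
  refine tendsto_joukowski_cobounded.comp (tendsto_nhdsWithin_iff.2 ⟨?_, .of_forall fun n =>
    mul_ne_zero hlam (pow_ne_zero n hq0)⟩)
  simpa using (tendsto_pow_atTop_nhds_zero_of_norm_lt_one hq1).const_mul lam

lemma joukowski_inv (z : ℂ) : joukowski z⁻¹ = joukowski z := by
  rw [joukowski, joukowski, inv_inv, add_comm]

lemma tendsto_joukowski_lattice (hq0 : q ≠ 0) (hq1 : ‖q‖ < 1) {lam : ℂ} (hlam : lam ≠ 0) :
    Tendsto (fun x : ℤ => joukowski (lam * q ^ x)) cofinite (Bornology.cobounded ℂ) := by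
  have h : ∀ lam : ℂ, lam ≠ 0 →
      Tendsto (fun x : ℤ => joukowski (lam * q ^ x)) atTop (Bornology.cobounded ℂ) := by
    intro lam hlam
    rw [← Nat.map_cast_int_atTop, tendsto_map'_iff]
    simpa only [Function.comp_def, zpow_natCast] using tendsto_joukowski_pow hq0 hq1 hlam
  rw [Int.cofinite_eq, tendsto_sup]
  refine ⟨?_, h lam hlam⟩
  refine ((h lam⁻¹ (inv_ne_zero hlam)).comp tendsto_neg_atBot_atTop).congr fun x => ?_
  rw [Function.comp_apply, zpow_neg, ← mul_inv, joukowski_inv]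

/-- It suffices to treat a spanning set of V, namely 1 and the simple fractions. Summability in ℂ is
absolute convergence. -/
lemma summable_weight_mul_evalAt (hq0 : q ≠ 0) (hq1 : ‖q‖ < 1) (hb : IsParameter q b) {lam mu : ℂ}
    (h : IsGenericPair q b lam mu) (f : V q b) :
    Summable fun x : ℤ => weight q b lam x * evalAt f (lam * q ^ x) := by
  have hav := h.notMem_polePoints hq0 (hb.ne_zero hq0)
  have hw := summable_weight hq0 hq1 hb h
  set W : Submodule ℂ (V q b) :=
    { carrier := {f | Summable fun x : ℤ => weight q b lam x * evalAt f (lam * q ^ x)}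
      zero_mem' := by
        change Summable fun x : ℤ => weight q b lam x * evalAt (0 : V q b) (lam * q ^ x)
        simp only [evalAt_zero, mul_zero]
        exact summable_zero
      add_mem' := by
        intro f g hf hg
        refine (Summable.add hf hg).congr fun x => ?_
        rw [evalAt_add f g (hav x)]; ring
      smul_mem' := by
        intro c f hf
        refine (Summable.mul_left c hf).congr fun x => ?_
        rw [evalAt_smul c f (hav x)]; ring }
  have h1 : (1 : RatFunc ℂ) ∈ W.map (V q b).subtype := by
    refine ⟨⟨1, one_mem_V⟩, ?_, rfl⟩
    change Summable fun x : ℤ => weight q b lam x * evalAt (⟨1, one_mem_V⟩ : V q b) (lam * q ^ x)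
    simp only [evalAt_one, mul_one]
    exact hw.of_norm
  have h2 : ∀ a ∈ polePoints q b, simpleFraction a ∈ W.map (V q b).subtype := by
    intro a ha
    refine ⟨⟨simpleFraction a, simpleFraction_mem_V ha⟩, ?_, rfl⟩
    change Summable fun x : ℤ => weight q b lam x *
      evalAt (⟨simpleFraction a, simpleFraction_mem_V ha⟩ : V q b) (lam * q ^ x)
    refine Summable.of_norm_bounded_eventually hw ?_
    -- The lattice points tend to infinity in both directions, so the fraction has modulus less than
    -- 1 at all but finitely many of them.
    have ht := (tendsto_inv₀_cobounded.comp ((tendsto_sub_const_cobounded a).comp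
      (tendsto_joukowski_lattice hq0 hq1 h.lam_ne))).norm
    rw [norm_zero] at ht
    filter_upwards [ht.eventually (gt_mem_nhds one_pos)] with x hx
    rw [evalAt_simpleFraction ha (hav x), norm_mul]
    exact mul_le_of_le_one_right (norm_nonneg _) hx.le
  obtain ⟨g, hg, hgf⟩ := V_le h1 h2 f.2
  have : g = f := Subtype.ext hgf
  exact this ▸ hg

/-- Rahman's functional, as a sum of two bilateral series. -/
noncomputable def bilateralFunctional (hq0 : q ≠ 0) (hq1 : ‖q‖ < 1) (hb : IsParameter q b)
    {lam mu : ℂ} (h : IsGenericPair q b lam mu) : V q b →ₗ[ℂ] ℂ where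
  toFun f := bilateralValue q b lam mu (evalAt f)
  map_add' f g := by
    have key : ∀ {lam mu : ℂ}, IsGenericPair q b lam mu → bilateralSum q b lam (evalAt (f + g)) =
        bilateralSum q b lam (evalAt f) + bilateralSum q b lam (evalAt g) := fun h => by
      rw [bilateralSum, bilateralSum, bilateralSum,
        ← (summable_weight_mul_evalAt hq0 hq1 hb h f).tsum_add
          (summable_weight_mul_evalAt hq0 hq1 hb h g)]
      refine tsum_congr fun x => ?_
      rw [evalAt_add f g (h.notMem_polePoints hq0 (hb.ne_zero hq0) x)]; ring
    rw [bilateralValue, key h, key h.symm, bilateralValue, bilateralValue]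
    ring
  map_smul' c f := by
    have key : ∀ {lam mu : ℂ}, IsGenericPair q b lam mu → bilateralSum q b lam (evalAt (c • f)) =
        c * bilateralSum q b lam (evalAt f) := fun h => by
      rw [bilateralSum, bilateralSum, ← tsum_mul_left]
      refine tsum_congr fun x => ?_
      rw [evalAt_smul c f (h.notMem_polePoints hq0 (hb.ne_zero hq0) x)]; ring
    rw [bilateralValue, key h, key h.symm, bilateralValue, smul_eq_mul, RingHom.id_apply]
    ring

lemma isRahmanFunctional_bilateralFunctional (hq0 : q ≠ 0) (hq1 : ‖q‖ < 1) (hb : IsParameter q b)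
    {lam mu : ℂ} (h : IsGenericPair q b lam mu) :
    IsRahmanFunctional q b (bilateralFunctional hq0 hq1 hb h) := by
  intro k hk f hf
  have hb0 := hb.ne_zero hq0
  have key : ∀ {lam mu : ℂ}, IsGenericPair q b lam mu → ∀ x : ℤ,
      evalAt f (lam * q ^ x) = shiftedProduct q b k (lam * q ^ x) := fun {lam mu} h x => by
    refine hf _ (mul_ne_zero h.lam_ne (zpow_ne_zero x hq0)) fun j n => ⟨fun e => ?_, fun e => ?_⟩
    · refine h.div_lattice hq0 x j (-n) ?_
      have := hb0 j
      have := zpow_ne_zero n hq0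
      rw [e, zpow_neg]
      field_simp
    · refine h.mul_lattice hq0 x j (-n) ?_
      rw [zpow_neg]
      refine eq_inv_of_mul_eq_one_left ?_
      rw [mul_right_comm, ← e, inv_mul_cancel₀ (mul_ne_zero h.lam_ne (zpow_ne_zero x hq0))]
  exact bilateralValue_shiftedProduct hq0 hq1 hb h hk (key h) (key h.symm)

/-- Two such functionals agree on the shifted products, which span V. -/
lemma IsRahmanFunctional.unique (hq0 : q ≠ 0) (hq1 : ‖q‖ < 1) (hb : IsParameter q b)
    {J J' : V q b →ₗ[ℂ] ℂ} (hJ : IsRahmanFunctional q b J) (hJ' : IsRahmanFunctional q b J') :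
    J = J' := by
  have hle := V_le_of_shiftedProducts hq0 hq1 hb (W := (LinearMap.eqLocus J J').map (V q b).subtype)
    fun k hk f hf => ⟨f, (hJ k hk f hf).trans (hJ' k hk f hf).symm, rfl⟩
  ext f
  obtain ⟨g, hg, hgf⟩ := hle f.2
  have : g = f := Subtype.ext hgf
  exact this ▸ hg

end Functional

end Rahman

theorem mainTheorem7 (q : ℂ) (hq0 : q ≠ 0) (hq1 : ‖q‖ < 1) (b : Fin 6 → ℂ)
    (hb : Rahman.IsParameter q b) :
    (∃! J : Rahman.V q b →ₗ[ℂ] ℂ, Rahman.IsRahmanFunctional q b J) ∧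
    ∀ J : Rahman.V q b →ₗ[ℂ] ℂ, Rahman.IsRahmanFunctional q b J →
      ∀ lam mu : ℂ, Rahman.IsGenericPair q b lam mu → ∀ f : Rahman.V q b,
        Summable (fun x : ℤ => Rahman.weight q b lam x * Rahman.evalAt f (lam * q ^ x)) ∧
        Summable (fun x : ℤ => Rahman.weight q b mu x * Rahman.evalAt f (mu * q ^ x)) ∧
        J f =
          Rahman.coeff q b lam mu *
            ∑' x : ℤ, Rahman.weight q b lam x * Rahman.evalAt f (lam * q ^ x) +
          Rahman.coeff q b mu lam *
            ∑' x : ℤ, Rahman.weight q b mu x * Rahman.evalAt f (mu * q ^ x) := by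
  constructor
  · obtain ⟨lam, mu, h⟩ := Rahman.exists_isGenericPair (q := q) (hb.ne_zero hq0)
    have hJ := Rahman.isRahmanFunctional_bilateralFunctional hq0 hq1 hb h
    exact ⟨_, hJ, fun J' hJ' => hJ'.unique hq0 hq1 hb hJ⟩
  · intro J hJ lam mu h f
    refine ⟨Rahman.summable_weight_mul_evalAt hq0 hq1 hb h f,
      Rahman.summable_weight_mul_evalAt hq0 hq1 hb h.symm f, ?_⟩
    rw [hJ.unique hq0 hq1 hb (Rahman.isRahmanFunctional_bilateralFunctional hq0 hq1 hb h)]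
    rfl
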